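/- \textbf{Proposition.} Let $X$ be a nonempty complete geodesic metric space. Suppose that, for some ultrafilter $\omega$ on $\mathbb N$, some $\omega$-divergent sequence $d=(d_n)$ of positive real numbers and some $\varepsilon>0$, the space $X$ is uniformly $\varepsilon$-coarsely loop divisible with respect to $(\omega,d)$. Then $X$ has a simply connected asymptotic cone: there are an ultrafilter $\mu$ on $\mathbb N$, a $\mu$-divergent sequence $p=(p_n)$ of positive real numbers and a sequence $e=(e_n)$ of points of $X$ such that $\operatorname{Con}^\mu(X,e,p)$ is simply connected. Here the terms are used as follows. \emph{Asymptotic cones.} A sequence $(d_n)$ is $\omega$-divergent if $\{n : d_n>M\}\in\omega$ for every $M$. The cone $\operatorname{Con}^\omega(X,e,d)$ is the set of sequences $x=(x_n)$ in $X$ for which $\operatorname{dist}(x_n,e_n)/d_n$ is $\omega$-bounded (i.e. less than some constant for all $n$ in some set belonging to $\omega$), with the distance $\operatorname{dist}(x,y)=\lim^\omega \operatorname{dist}(x_n,y_n)/d_n$, modulo identification of sequences at distance $0$. \emph{Partitions of the disc.} Let $\mathbb D$ be the closed unit disc in the plane. A partition of $\mathbb D$ is a finite family $D_1,\dots,D_k$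 of closed topological discs with pairwise disjoint interiors such that $\mathbb D=\bigcup_i D_i$, $\partial\mathbb D=\partial(\bigcup_i D_i)$ and $D_i\cap D_j=\partial D_i\cap\partial D_j$ for $i\ne j$. Put $S=\bigcup_i\partial D_i$. A point of $S$ is a vertex if it has no open neighbourhood $U$ with $U\cap S$ homeomorphic to an open interval; the vertices form a finite set $V$. The edges are the connected components of $S\setminus V$. \emph{Partitions of loops.} A loop in $X$ is a continuous map $\gamma:\partial\mathbb D\to X$; its arc length is $|\gamma|\in[0,\infty]$. A partition $\Pi$ of $\gamma$ with $k$ pieces is a partition $D_1,\dots,D_k$ of $\mathbb D$ together with a map $\Pi:V\to X$ that agrees with $\gamma$ on $V\cap\partial\mathbb D$. The length of an edge contained in $\partial\mathbb D$ is the arc length of $\gamma$ on it; the length of any other edge is the distance between the images under $\Pi$ of its endpoints (it is mapped to a geodesic segment). The length of the $i$-th piece is the sum of the lengths of the edges contained in $\partial D_i$, and the mesh of $\Pi$ is the maximum of the lengths of its pieces. Let $P(\gamma,\delta)$ be the least number of pieces of a partition of $\gamma$ with mesh $<\delta$, and $P(\gamma,\delta)=\infty$ if there is none. \emph{Loop divisibility.}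 For $m\in\mathbb N$ let $$\vartheta(m)=\sup\{P(\alpha,|\alpha|/2) : \alpha \text{ a loop in } X,\ m-1<|\alpha|\le m\}\in\mathbb N\cup\{\infty\}.$$ The space $X$ is uniformly $\varepsilon$-coarsely loop divisible with respect to $(\omega,d)$ if there is a constant $K\in\mathbb N$ such that for every $\delta\in(0,\varepsilon)$ there is a set $A\in\omega$ with $\vartheta(m)\le K$ for every natural number $m\in\bigcup_{n\in A}[\delta d_n,\varepsilon d_n]$. -/

import Mathlib

open Set Filter Topology Metric
open scoped ENNReal

noncomputable section

/-! ### Geodesic spaces and asymptotic cones -/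

/-- A metric space is geodesic if any two points are joined by an isometrically embedded segment
whose length is their distance. -/
def IsGeodesicSpace (X : Type*) [MetricSpace X] : Prop :=
  ∀ x y : X, ∃ c : ℝ → X, c 0 = x ∧ c (dist x y) = y ∧
    ∀ s ∈ Icc 0 (dist x y), ∀ t ∈ Icc 0 (dist x y), dist (c s) (c t) = |s - t|

/-- An `ω`-divergent sequence of positive real numbers: `{n | d n > M} ∈ ω` for every `M`. -/
structure ScalingSequence (ω : Ultrafilter ℕ) where
  seq : ℕ → ℝ
  pos : ∀ n, 0 < seq n
  divergent : Tendsto seq (ω : Filter ℕ) atTop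

/-- Sequences `x` in `X` such that `dist (x n) (e n) / d n` is `ω`-bounded, i.e. at finite rescaled
distance from the observation sequence `e`. -/
structure PreCone (X : Type*) [MetricSpace X] (ω : Ultrafilter ℕ) (d : ScalingSequence ω)
    (e : ℕ → X) where
  seq : ℕ → X
  bounded : ∃ M : ℝ, ∀ᶠ n in (ω : Filter ℕ), dist (seq n) (e n) / d.seq n < M

namespace PreCone

variable {X : Type*} [MetricSpace X] {ω : Ultrafilter ℕ} {d : ScalingSequence ω} {e : ℕ → X}

/-- The rescaled distance `lim^ω dist (x n) (y n) / d n`. -/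
instance : Dist (PreCone X ω d e) where
  dist x y := limUnder (ω : Filter ℕ) (fun n => dist (x.seq n) (y.seq n) / d.seq n)

/-- The limit defining the distance exists. -/
theorem tendsto_dist (x y : PreCone X ω d e) :
    Tendsto (fun n => dist (x.seq n) (y.seq n) / d.seq n) (ω : Filter ℕ) (𝓝 (dist x y)) := by
  obtain ⟨M, hM⟩ := x.bounded
  obtain ⟨N, hN⟩ := y.bounded
  have hmem : ∀ᶠ n in (ω : Filter ℕ),
      dist (x.seq n) (y.seq n) / d.seq n ∈ Icc (0 : ℝ) (M + N) := by
    filter_upwards [hM, hN] with n h1 h2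
    refine ⟨div_nonneg dist_nonneg (d.pos n).le, ?_⟩
    have h3 := dist_triangle_right (x.seq n) (y.seq n) (e n)
    have h4 : dist (x.seq n) (y.seq n) / d.seq n ≤
        (dist (x.seq n) (e n) + dist (y.seq n) (e n)) / d.seq n :=
      div_le_div_of_nonneg_right h3 (d.pos n).le
    rw [add_div] at h4
    linarith
  have hc : IsCompact (Icc (0 : ℝ) (M + N)) := isCompact_Icc
  obtain ⟨a, -, ha⟩ := hc.ultrafilter_le_nhds'
    (ω.map (fun n => dist (x.seq n) (y.seq n) / d.seq n)) hmem
  have ha' : Tendsto (fun n => dist (x.seq n) (y.seq n) / d.seq n) (ω : Filter ℕ) (𝓝 a) := ha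
  exact tendsto_nhds_limUnder ⟨a, ha'⟩

instance : PseudoMetricSpace (PreCone X ω d e) where
  dist_self x := by
    refine tendsto_nhds_unique (tendsto_dist x x) ?_
    simp
  dist_comm x y := by
    refine tendsto_nhds_unique (tendsto_dist x y) ?_
    simpa only [dist_comm] using tendsto_dist y x
  dist_triangle x y z := by
    refine le_of_tendsto_of_tendsto' (tendsto_dist x z)
      ((tendsto_dist x y).add (tendsto_dist y z)) fun n => ?_
    rw [← add_div]
    exact div_le_div_of_nonneg_right (dist_triangle _ _ _) (d.pos n).le

end PreCone

/-- The asymptotic cone `Con^ω(X, e, d)`: sequences at finite rescaled distance from `e`, with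
sequences at rescaled distance zero identified, and the induced metric. -/
abbrev AsymptoticCone (X : Type*) [MetricSpace X] (ω : Ultrafilter ℕ) (d : ScalingSequence ω)
    (e : ℕ → X) : Type _ :=
  SeparationQuotient (PreCone X ω d e)

/-! ### Partitions of the unit disc -/

/-- A partition of the closed unit disc of the plane into `k` closed topological discs, each given
as the image of the closed unit disc under a continuous injection `chart i`. The boundary and the
interior of the `i`-th disc are the images of the unit circle and of the open unit disc. -/
structure DiscTiling (k : ℕ) where
  chart : Fin k → ℂ → ℂ
  continuousOn : ∀ i, ContinuousOn (chart i) (closedBall 0 1)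
  injOn : ∀ i, InjOn (chart i) (closedBall 0 1)
  interior_disjoint : ∀ i j, i ≠ j → Disjoint (chart i '' ball 0 1) (chart j '' ball 0 1)
  cover : ⋃ i, chart i '' closedBall 0 1 = closedBall 0 1
  sphere_subset : sphere 0 1 ⊆ ⋃ i, chart i '' sphere 0 1
  inter_eq : ∀ i j, i ≠ j → chart i '' closedBall 0 1 ∩ chart j '' closedBall 0 1 =
    chart i '' sphere 0 1 ∩ chart j '' sphere 0 1

namespace DiscTiling

variable {k : ℕ} (P : DiscTiling k)

/-- The boundary circle `∂D_i` of the `i`-th disc. -/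
def bdry (i : Fin k) : Set ℂ := P.chart i '' sphere 0 1

/-- The union `∂D_1 ∪ ⋯ ∪ ∂D_k`. -/
def skeleton : Set ℂ := ⋃ i, P.bdry i

/-- The points of the skeleton without a relatively open neighbourhood in the skeleton that is
homeomorphic to an (open) interval. -/
def vertices : Set ℂ :=
  {p | p ∈ P.skeleton ∧ ∀ U : Set ℂ, IsOpen U → p ∈ U → IsEmpty (↥(U ∩ P.skeleton) ≃ₜ ℝ)}

/-- The (open) edges: the connected components of the skeleton with the vertices removed. -/
def edges : Set (Set ℂ) :=
  {s | ∃ p ∈ P.skeleton \ P.vertices, s = connectedComponentIn (P.skeleton \ P.vertices) p}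

end DiscTiling

/-- A partition of the unit disc: a cellular decomposition into `k` closed discs, with finitely
many vertices. -/
structure DiscPartition (k : ℕ) extends DiscTiling k where
  finite_vertices : toDiscTiling.vertices.Finite

/-! ### Loops and their partitions -/

section Loops

variable {X : Type*} [MetricSpace X]

/-- The arc length of a loop. -/
def loopLength (γ : C(Circle, X)) : ℝ≥0∞ :=
  eVariationOn (fun t : ℝ => γ (Circle.exp t)) (Icc 0 (2 * Real.pi))

/-- The arc length of the restriction of a loop to an arc `s` of the unit circle (or to the whole
circle): the supremum of its lengths on compact subarcs of `s`, each traversed at most once. -/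
def arcLength (γ : C(Circle, X)) (s : Set ℂ) : ℝ≥0∞ :=
  ⨆ (a : ℝ) (b : ℝ) (_ : a ≤ b) (_ : b ≤ a + 2 * Real.pi)
    (_ : ∀ t ∈ Icc a b, (Circle.exp t : ℂ) ∈ s),
    eVariationOn (fun t : ℝ => γ (Circle.exp t)) (Icc a b)

/-- A partition of the loop `γ`: a map from the vertices of a partition of the unit disc to `X` that
agrees with `γ` at the vertices on the unit circle. -/
structure LoopPartition {k : ℕ} (P : DiscPartition k) (γ : C(Circle, X)) where
  toFun : P.vertices → X
  eq_loop : ∀ (z : Circle) (hz : (z : ℂ) ∈ P.vertices), toFun ⟨z, hz⟩ = γ z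

namespace LoopPartition

variable {k : ℕ} {P : DiscPartition k} {γ : C(Circle, X)} (Q : LoopPartition P γ)

open Classical in
/-- The length of the image of an edge `s`. An edge on the unit circle is mapped by `γ`; any other
edge is mapped to a geodesic segment joining the images of its two endpoints (the vertices in the
closure of `s`), so its length is the distance between these two images. -/
def edgeLength (s : Set ℂ) : ℝ≥0∞ :=
  if s ⊆ sphere 0 1 then arcLength γ s
  else ⨆ (u : P.vertices) (v : P.vertices) (_ : (u : ℂ) ∈ closure s) (_ : (v : ℂ) ∈ closure s),
    edist (Q.toFun u) (Q.toFun v)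

/-- The length of the `i`-th piece: the total length of the edges that make up `∂D_i`. -/
def pieceLength (i : Fin k) : ℝ≥0∞ :=
  ∑' s : {s : Set ℂ // s ∈ P.edges ∧ s ⊆ P.bdry i}, Q.edgeLength s

/-- The maximal length of a piece. -/
def mesh : ℝ≥0∞ := ⨆ i, Q.pieceLength i

end LoopPartition

/-- `P(γ, δ)`: the least number of pieces of a partition of `γ` with mesh less than `δ`, and `⊤` if
there is no such partition. -/
def partitionNumber (γ : C(Circle, X)) (δ : ℝ≥0∞) : ℕ∞ :=
  ⨅ (k : ℕ) (_ : ∃ (P : DiscPartition k) (Q : LoopPartition P γ), Q.mesh < δ), (k : ℕ∞)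

end Loops

/-! ### Coarse loop divisibility -/

/-- The divisibility function of `X` at `m`: the supremum of `P(α, |α| / 2)` over all loops `α` in `X`
with `m - 1 < |α| ≤ m`. -/
def divisibility (X : Type*) [MetricSpace X] (m : ℕ) : ℕ∞ :=
  ⨆ (α : C(Circle, X)) (_ : (m : ℝ≥0∞) < loopLength α + 1) (_ : loopLength α ≤ m),
    partitionNumber α (loopLength α / 2)

/-- `X` is uniformly `ε`-coarsely loop divisible with respect to `(ω, d)`: some constant `K` works
for all `δ ∈ (0, ε)`, in the sense that the divisibility function is bounded by `K` on the natural
numbers in `⋃ n ∈ A, [δ d n, ε d n]` for some `A` of full `ω`-measure. -/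
def UniformlyCoarselyLoopDivisible (X : Type*) [MetricSpace X] (ω : Ultrafilter ℕ)
    (d : ScalingSequence ω) (ε : ℝ) : Prop :=
  ∃ K : ℕ, ∀ δ : ℝ, 0 < δ → δ < ε → ∃ A : Set ℕ, A ∈ ω ∧
    ∀ n ∈ A, ∀ m : ℕ, (m : ℝ) ∈ Icc (δ * d.seq n) (ε * d.seq n) → divisibility X m ≤ K

end

noncomputable section

/-! ### Variation of continuous curves -/

/-! The scale is changed so that divisibility survives in the limit; a complete geodesic space whose
closed polygons all divide uniformly is then simply connected, because the divisions can be
iterated.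

The constant `K` is independent of `δ`. A diagonal choice of a scale `p` growing slower than `d`
(`UniformlyCoarselyLoopDivisible.exists_scaling`) therefore bounds the divisibility function by `K`
on every window `[a p_n, b p_n]` with `a > 0`. A closed polygon of length `D > 0` in the cone of
scale `p` is a limit of polygons in `X` of length about `D p_n`, and each of these is divided into
at most `K` pieces of at most half its length.

To pass to the limit, only finitely many combinatorial types of partition may occur. This is Euler's
inequality: a finite set `U` of points of the skeleton containing the vertices and `1` cuts the
skeleton of `k` tiles into at most `|U| + k` edges (`edges_le`); since at least three half-edges
leave each vertex, there are at most `2k` vertices (`vertices_le`). The ultrafilter selects one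
type, the images of the vertices define points of the cone, and geodesics of the cone serve as edges
(`AsymptoticCone.polygonDivisible`).

In the cone, a rectifiable loop is replaced by an inscribed polygon. The disc splits into thin
lenses between loop and polygon and an inner disc that carries the partition of the polygon. All
holes obtained have at most half the length, the regions shrink geometrically, and the limit map
fills the loop (`exists_filling_of_pos`). A loop of infinite length is treated by bisecting its
parameter interval: two halves remain, and the loops in between are rectifiable, of length
controlled by the diameter of the curve (`IsCap.exists_filling`). -/

theorem eVariationOn_Ioo_eq_Icc {C : Type*} [PseudoMetricSpace C] {f : ℝ → C} {a b : ℝ}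
    (hab : a < b) (hf : ContinuousOn f (Icc a b)) :
    eVariationOn f (Ioo a b) = eVariationOn f (Icc a b) := by
  have hb : ContinuousWithinAt f (Icc a b) b := hf b (right_mem_Icc.2 hab.le)
  have ha : ContinuousWithinAt f (Icc a b) a := hf a (left_mem_Icc.2 hab.le)
  have h1 : eVariationOn f (Ioo a b ∩ Iic b) = eVariationOn f (Ioo a b) := by
    congr 1; ext; simp only [mem_inter_iff, mem_Ioo, mem_Iic]; grind
  have h2 : eVariationOn f (Ioc a b) = eVariationOn f (Icc a b) := by
    apply eVariationOn.eVariationOn_Ioc_eq_Icc_of_continuousWithinAt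
    exact ha.mono_of_mem_nhdsWithin (Icc_mem_nhdsGE hab)
  rw [← h2]
  have h3 := eVariationOn.eVariationOn_inter_Iio_eq_inter_Iic_of_continuousWithinAt
    (f := f) (s := Ioc a b) (a := b) ?_ ?_
  · convert h3 using 2
    · ext; simp only [mem_inter_iff, mem_Ioo, mem_Ioc, mem_Iio]; grind
    · ext; simp only [mem_inter_iff, mem_Ioc, mem_Iic]; grind
  · have : Ioc a b ∩ Iio b = Ioo a b := by ext; simp only [mem_inter_iff, mem_Ioo, mem_Ioc, mem_Iio]; grind
    rw [this]
    exact right_nhdsWithin_Ioo_neBot hab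
  · exact hb.mono (fun x hx => ⟨hx.1.1.le, hx.2⟩)

/-- A continuous curve of finite variation has small variation near each point, on both sides; a
Lebesgue number of the resulting cover makes this uniform. -/
theorem exists_uniform_partition {C : Type*} [PseudoMetricSpace C] {f : ℝ → C} {a b : ℝ}
    (hab : a < b) (hf : ContinuousOn f (Icc a b)) (hv : eVariationOn f (Icc a b) ≠ ⊤)
    {ε : ℝ≥0∞} (hε : 0 < ε) :
    ∃ N : ℕ, 2 ≤ N ∧ ∀ j < N, eVariationOn f
      (Icc (a + (b - a) * j / N) (a + (b - a) * (j + 1 : ℕ) / N)) ≤ ε := by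
  have hε2 : 0 < ε / 2 := ENNReal.half_pos hε.ne'
  have key : ∀ x ∈ Icc a b, ∃ r > 0, eVariationOn f (Icc a b ∩ ball x r) ≤ ε := by
    intro x hx
    have hbv : BoundedVariationOn f (Icc a b) := hv
    have hl := hbv.tendsto_eVariationOn_Icc_zero_left (x := x)
      ((hf x hx).mono inter_subset_left)
    have hr := hbv.tendsto_eVariationOn_Icc_zero_right x
      ((hf x hx).mono inter_subset_left)
    have h := (hl.eventually (gt_mem_nhds hε2)).and (hr.eventually (gt_mem_nhds hε2))
    obtain ⟨r, hr0, hr⟩ := Metric.mem_nhdsWithin_iff.1 h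
    refine ⟨r / 2, by positivity, ?_⟩
    have e1 : eVariationOn f (Icc a b ∩ Icc (max a (x - r / 2)) x) ≤ ε / 2 := by
      refine (hr ⟨?_, ?_⟩).1.le
      · rw [mem_ball, Real.dist_eq, abs_lt]
        constructor
        · have := le_max_right a (x - r / 2); linarith
        · have : max a (x - r / 2) ≤ x := max_le hx.1 (by linarith)
          linarith
      · exact ⟨le_max_left _ _, (max_le hx.1 (by linarith)).trans hx.2⟩
    have e2 : eVariationOn f (Icc a b ∩ Icc x (min b (x + r / 2))) ≤ ε / 2 := by
      refine (hr ⟨?_, ?_⟩).2.le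
      · rw [mem_ball, Real.dist_eq, abs_lt]
        constructor
        · have : x ≤ min b (x + r / 2) := le_min hx.2 (by linarith)
          linarith
        · have := min_le_right b (x + r / 2); linarith
      · exact ⟨hx.1.trans (le_min hx.2 (by linarith)), min_le_left _ _⟩
    have h3 := eVariationOn.Icc_add_Icc f (s := Icc a b) (a := max a (x - r / 2)) (b := x)
      (c := min b (x + r / 2)) (max_le hx.1 (by linarith)) (le_min hx.2 (by linarith)) hx
    calc _ ≤ eVariationOn f (Icc a b ∩ Icc (max a (x - r / 2)) (min b (x + r / 2))) := by
          apply eVariationOn.mono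
          rintro y ⟨hy, hy'⟩
          rw [mem_ball, Real.dist_eq, abs_lt] at hy'
          exact ⟨hy, max_le hy.1 (by linarith), le_min hy.2 (by linarith)⟩
      _ ≤ ε / 2 + ε / 2 := by rw [← h3]; exact add_le_add e1 e2
      _ = ε := ENNReal.add_halves ε
  choose! r hr0 hr using key
  obtain ⟨δ, hδ, hδ'⟩ := lebesgue_number_lemma_of_metric (isCompact_Icc (a := a) (b := b))
    (c := fun x : Icc a b => ball (x : ℝ) (r x)) (fun x => isOpen_ball)
    (fun x hx => mem_iUnion.2 ⟨⟨x, hx⟩, mem_ball_self (hr0 x hx)⟩)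
  -- The summand 2 secures `2 ≤ N`, which injectivity of the lens charts will require.
  obtain ⟨N, hN⟩ := exists_nat_gt ((b - a) / δ + 2)
  have hN2 : (2 : ℝ) < N := lt_of_le_of_lt (by have : 0 ≤ (b - a) / δ := div_nonneg (by linarith) hδ.le; linarith) hN
  have hN0 : (0 : ℝ) < N := by linarith
  refine ⟨N, by exact_mod_cast hN2.le, fun j hj => ?_⟩
  have hj1 : ((j : ℝ) + 1) ≤ N := by exact_mod_cast hj
  have hj0 : (0 : ℝ) ≤ j := j.cast_nonneg
  have hstep : a + (b - a) * (j + 1 : ℕ) / N = a + (b - a) * j / N + (b - a) / N := by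
    push_cast; ring
  have hsm : (b - a) / N < δ := by
    rw [div_lt_iff₀ hN0]
    have : (b - a) / δ < N := by linarith
    rw [div_lt_iff₀ hδ] at this; linarith
  have hlow : a ≤ a + (b - a) * j / N := by
    have : 0 ≤ (b - a) * j / N := div_nonneg (mul_nonneg (by linarith) hj0) hN0.le
    linarith
  have hup : a + (b - a) * (j + 1 : ℕ) / N ≤ b := by
    have : (b - a) * (j + 1 : ℕ) / N ≤ (b - a) := by
      rw [div_le_iff₀ hN0]; push_cast; exact mul_le_mul_of_nonneg_left hj1 (by linarith)
    linarith
  have hpos : 0 < (b - a) / N := div_pos (by linarith) hN0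
  obtain ⟨i, hi⟩ := hδ' (a + (b - a) * j / N) ⟨hlow, by linarith⟩
  refine (eVariationOn.mono f ?_).trans (hr i i.2)
  intro y hy
  refine ⟨⟨hlow.trans hy.1, hy.2.trans hup⟩, hi ?_⟩
  rw [mem_ball, Real.dist_eq, abs_lt]
  rw [hstep] at hy
  constructor <;> linarith [hy.1, hy.2]

/-! ### Filling loops by iterated subdivision -/

/-- A map on a closed subset `body` of the closed unit disc whose complement consists of `k` open
discs, each given with its closure by a chart. -/
structure Division (C : Type*) [TopologicalSpace C] (k : ℕ) where
  chart : Fin k → ℂ → ℂ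
  body : Set ℂ
  map : ℂ → C
  continuousOn_chart : ∀ i, ContinuousOn (chart i) (closedBall 0 1)
  injOn_chart : ∀ i, InjOn (chart i) (closedBall 0 1)
  isClosed_body : IsClosed body
  sphere_subset : sphere 0 1 ⊆ body
  chart_sphere : ∀ i, chart i '' sphere 0 1 ⊆ body
  disjoint_body : ∀ i, Disjoint (chart i '' ball 0 1) body
  disjoint_ball : ∀ i j, i ≠ j → Disjoint (chart i '' ball 0 1) (chart j '' ball 0 1)
  cover : body ∪ ⋃ i, chart i '' ball 0 1 = closedBall 0 1
  continuousOn_map : ContinuousOn map body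

/-- A family of loops closed under subdivision: each loop extends to the body of a division whose
holes are again bounded by loops of the family, with all values in nested closed regions. -/
structure FillSystem (C : Type*) [TopologicalSpace C] (σ : Type*) where
  loop : σ → ℂ → C
  region : σ → Set C
  k : σ → ℕ
  div : ∀ s, Division C (k s)
  child : ∀ s, Fin (k s) → σ
  map_eq : ∀ s, ∀ z ∈ sphere (0 : ℂ) 1, (div s).map z = loop s z
  child_eq : ∀ s i, ∀ z ∈ sphere (0 : ℂ) 1, loop (child s i) z = (div s).map ((div s).chart i z)
  isClosed_region : ∀ s, IsClosed (region s)
  map_mem : ∀ s, ∀ x ∈ (div s).body, (div s).map x ∈ region s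
  child_region : ∀ s i, region (child s i) ⊆ region s

namespace FillSystem

variable {C : Type*} [MetricSpace C] {σ : Type*} (Φ : FillSystem C σ)

/-- After finitely many subdivisions of `s` all regions have diameter at most `δ`. -/
inductive Fine (δ : ℝ) : σ → Prop
  | small (s : σ) : (∀ x ∈ Φ.region s, ∀ y ∈ Φ.region s, dist x y ≤ δ) → Fine δ s
  | step (s : σ) : (∀ i, Fine δ (Φ.child s i)) → Fine δ s

open Classical in
/-- The filling after `m` subdivisions, constant on each of the remaining holes. -/
def approx : ℕ → σ → ℂ → C
  -- Any value in `region s` would serve; the point 1 lies on the unit circle, hence in the body.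
  | 0, s, _ => (Φ.div s).map 1
  | m + 1, s, x =>
    if h : ∃ i : Fin (Φ.k s), ∃ y ∈ ball (0 : ℂ) 1, (Φ.div s).chart i y = x then
      approx m (Φ.child s h.choose) h.choose_spec.choose
    else (Φ.div s).map x

theorem approx_chart (m : ℕ) (s : σ) (i : Fin (Φ.k s)) {y : ℂ} (hy : y ∈ ball (0 : ℂ) 1) :
    Φ.approx (m + 1) s ((Φ.div s).chart i y) = Φ.approx m (Φ.child s i) y := by
  have h : ∃ j : Fin (Φ.k s), ∃ y' ∈ ball (0 : ℂ) 1, (Φ.div s).chart j y' = (Φ.div s).chart i y :=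
    ⟨i, y, hy, rfl⟩
  have hj : h.choose = i := by
    by_contra hne
    exact Set.disjoint_left.1 ((Φ.div s).disjoint_ball _ _ hne)
      ⟨_, h.choose_spec.choose_spec.1, h.choose_spec.choose_spec.2⟩ ⟨y, hy, rfl⟩
  have hy' : h.choose_spec.choose = y := by
    refine (Φ.div s).injOn_chart i (ball_subset_closedBall h.choose_spec.choose_spec.1)
      (ball_subset_closedBall hy) ?_
    exact (congrArg (fun j => (Φ.div s).chart j h.choose_spec.choose) hj.symm).trans
      h.choose_spec.choose_spec.2
  rw [approx, dif_pos h, hy', hj]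

theorem approx_body (m : ℕ) (s : σ) {x : ℂ} (hx : x ∈ (Φ.div s).body) :
    Φ.approx (m + 1) s x = (Φ.div s).map x := by
  rw [approx, dif_neg]
  rintro ⟨i, y, hy, rfl⟩
  exact Set.disjoint_left.1 ((Φ.div s).disjoint_body i) ⟨y, hy, rfl⟩ hx

theorem approx_mem (m : ℕ) (s : σ) {x : ℂ} (hx : x ∈ closedBall (0 : ℂ) 1) :
    Φ.approx m s x ∈ Φ.region s := by
  induction m generalizing s x with
  | zero => exact Φ.map_mem s 1 ((Φ.div s).sphere_subset (by simp))
  | succ m ih =>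
    rw [← (Φ.div s).cover] at hx
    rcases hx with hx | hx
    · rw [approx_body _ _ _ hx]; exact Φ.map_mem s x hx
    · obtain ⟨i, y, hy, rfl⟩ := mem_iUnion.1 hx
      rw [approx_chart _ _ _ _ hy]
      exact Φ.child_region s i (ih _ (ball_subset_closedBall hy))

/-- On a small region any two approximations are within `δ`. At a subdivision the values on the body
are final after one stage, and the finitely many children have a common threshold. -/
theorem approx_cauchy {δ : ℝ} (hδ : 0 ≤ δ) {s : σ} (hs : Φ.Fine δ s) :
    ∃ M, ∀ m ≥ M, ∀ m' ≥ M, ∀ x ∈ closedBall (0 : ℂ) 1,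
      dist (Φ.approx m s x) (Φ.approx m' s x) ≤ δ := by
  induction hs with
  | small s h => exact ⟨0, fun m _ m' _ x hx => h _ (Φ.approx_mem _ _ hx) _ (Φ.approx_mem _ _ hx)⟩
  | step s _ ih =>
    choose M hM using ih
    refine ⟨(Finset.univ.sup M) + 1, fun m hm m' hm' x hx => ?_⟩
    obtain ⟨m, rfl⟩ : ∃ n, m = n + 1 := ⟨m - 1, by omega⟩
    obtain ⟨m', rfl⟩ : ∃ n, m' = n + 1 := ⟨m' - 1, by omega⟩
    rw [← (Φ.div s).cover] at hx
    rcases hx with hx | hx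
    · rw [approx_body _ _ _ hx, approx_body _ _ _ hx, dist_self]; exact hδ
    · obtain ⟨i, y, hy, rfl⟩ := mem_iUnion.1 hx
      rw [approx_chart _ _ _ _ hy, approx_chart _ _ _ _ hy]
      have := Finset.le_sup (f := M) (Finset.mem_univ i)
      exact hM i m (by omega) m' (by omega) y (ball_subset_closedBall hy)

theorem exists_limit [CompleteSpace C] (h : ∀ δ > 0, ∀ s, Φ.Fine δ s) (s : σ) {x : ℂ}
    (hx : x ∈ closedBall (0 : ℂ) 1) : ∃ c, Tendsto (fun m => Φ.approx m s x) atTop (𝓝 c) := by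
  apply cauchySeq_tendsto_of_complete
  rw [Metric.cauchySeq_iff]
  intro ε hε
  obtain ⟨M, hM⟩ := Φ.approx_cauchy (half_pos hε).le (h (ε / 2) (half_pos hε) s)
  exact ⟨M, fun m hm n hn => (hM m hm n hn x hx).trans_lt (half_lt_self hε)⟩

theorem cover_closed (s : σ) :
    closedBall (0 : ℂ) 1 = (Φ.div s).body ∪ ⋃ i, (Φ.div s).chart i '' closedBall 0 1 := by
  apply Subset.antisymm
  · refine (Φ.div s).cover.symm.subset.trans (union_subset_union_right _ ?_)
    exact iUnion_mono fun i => image_mono ball_subset_closedBall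
  · refine Subset.trans ?_ (Φ.div s).cover.subset
    refine union_subset subset_union_left (iUnion_subset fun i => ?_)
    rw [← ball_union_sphere, image_union]
    refine union_subset (fun x hx => Or.inr (mem_iUnion.2 ⟨i, hx⟩)) fun x hx => Or.inl ?_
    exact (Φ.div s).chart_sphere i hx

/-- A continuous injection of a compact disc is a homeomorphism onto its image. The filter form
turns an eventual estimate at `x` into one at `chart i x` within the closed hole. -/
theorem nhdsWithin_chart (s : σ) (i : Fin (Φ.k s)) {x : ℂ} (hx : x ∈ closedBall (0 : ℂ) 1) :
    𝓝[(Φ.div s).chart i '' closedBall 0 1] ((Φ.div s).chart i x) ≤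
      map ((Φ.div s).chart i) (𝓝[closedBall 0 1] x) := by
  set g := (Φ.div s).chart i
  have hK : IsCompact (closedBall (0 : ℂ) 1) := isCompact_closedBall 0 1
  intro A hA
  rw [mem_map, mem_nhdsWithin] at hA
  obtain ⟨O, hO, hxO, hsub⟩ := hA
  have hc : IsClosed (g '' (closedBall 0 1 \ O)) :=
    ((hK.diff hO).image_of_continuousOn
      (((Φ.div s).continuousOn_chart i).mono sdiff_subset)).isClosed
  rw [mem_nhdsWithin]
  refine ⟨(g '' (closedBall 0 1 \ O))ᶜ, hc.isOpen_compl, ?_, ?_⟩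
  · rintro ⟨z, hz, hzx⟩
    exact hz.2 ((Φ.div s).injOn_chart i hz.1 hx hzx ▸ hxO)
  · rintro _ ⟨h1, z, hz, rfl⟩
    by_cases hzO : z ∈ O
    · exact hsub ⟨hzO, hz⟩
    · exact absurd ⟨z, ⟨hz, hzO⟩, rfl⟩ h1

/-- The filling is the pointwise limit of the approximations, which inherits the values on the body
and the compatibility with the charts of the children. -/
theorem exists_filling [CompleteSpace C] (h : ∀ δ > 0, ∀ s, Φ.Fine δ s) (s : σ) :
    ∃ F : ℂ → C, ContinuousOn F (closedBall 0 1) ∧ (∀ z ∈ sphere (0 : ℂ) 1, F z = Φ.loop s z) ∧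
      ∀ x ∈ closedBall (0 : ℂ) 1, F x ∈ Φ.region s := by
  have : Nonempty C := ⟨Φ.loop s 0⟩
  choose! F hF using fun s x (hx : x ∈ closedBall (0 : ℂ) 1) => Φ.exists_limit h s hx
  have Fmem : ∀ s, ∀ x ∈ closedBall (0 : ℂ) 1, F s x ∈ Φ.region s := fun s x hx =>
    (Φ.isClosed_region s).mem_of_tendsto (hF s x hx)
      (Eventually.of_forall fun m => Φ.approx_mem m s hx)
  have Fbody : ∀ s, ∀ x ∈ (Φ.div s).body, F s x = (Φ.div s).map x := by
    intro s x hx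
    have hx' : x ∈ closedBall (0 : ℂ) 1 := by rw [← (Φ.div s).cover]; exact Or.inl hx
    have h1 := (tendsto_add_atTop_iff_nat 1).2 (hF s x hx')
    simp only [Φ.approx_body _ s hx] at h1
    exact tendsto_nhds_unique h1 tendsto_const_nhds
  have Fsphere : ∀ s, ∀ z ∈ sphere (0 : ℂ) 1, F s z = Φ.loop s z := fun s z hz => by
    rw [Fbody s z ((Φ.div s).sphere_subset hz), Φ.map_eq s z hz]
  have Fchart : ∀ s i, ∀ y ∈ closedBall (0 : ℂ) 1,
      F s ((Φ.div s).chart i y) = F (Φ.child s i) y := by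
    intro s i y hy
    rw [← ball_union_sphere] at hy
    rcases hy with hy | hy
    · have hx' : (Φ.div s).chart i y ∈ closedBall (0 : ℂ) 1 := by
        rw [← (Φ.div s).cover]; exact Or.inr (mem_iUnion.2 ⟨i, y, hy, rfl⟩)
      have h1 := (tendsto_add_atTop_iff_nat 1).2 (hF s _ hx')
      simp only [Φ.approx_chart _ s i hy] at h1
      exact tendsto_nhds_unique h1 (hF _ y (ball_subset_closedBall hy))
    · rw [Fsphere _ y hy, Φ.child_eq s i y hy, Fbody]
      exact (Φ.div s).chart_sphere i ⟨y, hy, rfl⟩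
  -- The approximations are discontinuous, being constant on the holes, so uniform convergence alone
  -- does not give continuity. The oscillation of the limit is bounded instead, by induction on
  -- `Fine`, testing separately the body and the finitely many closed holes that cover the disc.
  have osc : ∀ δ > 0, ∀ s, Φ.Fine δ s → ∀ x ∈ closedBall (0 : ℂ) 1,
      ∀ᶠ y in 𝓝[closedBall 0 1] x, dist (F s y) (F s x) ≤ δ := by
    intro δ hδ s hs
    induction hs with
    | small s h =>
      intro x hx
      filter_upwards [self_mem_nhdsWithin] with y hy
      exact h _ (Fmem s y hy) _ (Fmem s x hx)
    | step s _ ih =>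
      intro x hx
      rw [Φ.cover_closed s, nhdsWithin_union, nhdsWithin_iUnion, eventually_sup,
        eventually_iSup]
      constructor
      · by_cases hxb : x ∈ (Φ.div s).body
        · have hc := (Φ.div s).continuousOn_map x hxb
          filter_upwards [hc.eventually (Metric.closedBall_mem_nhds _ hδ),
            self_mem_nhdsWithin] with y hy hyb
          rw [Fbody s y hyb, Fbody s x hxb]; exact hy
        · have : (𝓝[(Φ.div s).body] x) = ⊥ := by
            rw [← not_neBot, ← mem_closure_iff_nhdsWithin_neBot,
              (Φ.div s).isClosed_body.closure_eq]
            exact hxb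
          simp [this]
      · intro i
        have hcl : IsClosed ((Φ.div s).chart i '' closedBall 0 1) :=
          ((isCompact_closedBall 0 1).image_of_continuousOn
            ((Φ.div s).continuousOn_chart i)).isClosed
        by_cases hxi : x ∈ (Φ.div s).chart i '' closedBall 0 1
        · obtain ⟨x', hx', rfl⟩ := hxi
          apply Φ.nhdsWithin_chart s i hx'
          rw [mem_map]
          filter_upwards [ih i x' hx', self_mem_nhdsWithin] with y hy hyb
          simp only [mem_preimage, mem_ofPred_eq]
          rw [Fchart s i y hyb, Fchart s i x' hx']
          exact hy
        · have : (𝓝[(Φ.div s).chart i '' closedBall 0 1] x) = ⊥ := by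
            rw [← not_neBot, ← mem_closure_iff_nhdsWithin_neBot, hcl.closure_eq]
            exact hxi
          simp [this]
  refine ⟨F s, fun x hx => ?_, Fsphere s, Fmem s⟩
  rw [ContinuousWithinAt, Metric.tendsto_nhds]
  intro ε hε
  filter_upwards [osc (ε / 2) (half_pos hε) s (h _ (half_pos hε) s) x hx] with y hy
  exact hy.trans_lt (half_lt_self hε)

end FillSystem

end

noncomputable section

/-! ### Division of the disc into lenses and an inner disc -/

/-- The point of the unit circle at angle `t`. -/
def circlePt (t : ℝ) : ℂ := (Circle.exp t : ℂ)

theorem continuous_circlePt : Continuous circlePt :=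
  continuous_subtype_val.comp Circle.exp.continuous

@[simp] theorem norm_circlePt (t : ℝ) : ‖circlePt t‖ = 1 := by simp [circlePt]

theorem circlePt_mem_sphere (t : ℝ) : circlePt t ∈ sphere (0 : ℂ) 1 := by simp

theorem circlePt_eq_iff {s t : ℝ} : circlePt s = circlePt t ↔ Circle.exp s = Circle.exp t :=
  ⟨fun h => Subtype.ext h, fun h => congrArg (fun z : Circle => (z : ℂ)) h⟩

theorem circlePt_zero : circlePt 0 = 1 := by simp [circlePt]

theorem circlePt_re (t : ℝ) : (circlePt t).re = Real.cos t := by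
  simp [circlePt, Circle.coe_exp, Complex.exp_ofReal_mul_I_re]

theorem circlePt_im (t : ℝ) : (circlePt t).im = Real.sin t := by
  simp [circlePt, Circle.coe_exp, Complex.exp_ofReal_mul_I_im]

theorem circlePt_add_two_pi (t : ℝ) : circlePt (t + 2 * Real.pi) = circlePt t := by
  rw [circlePt_eq_iff]; exact Circle.periodic_exp t

theorem circlePt_injOn (a : ℝ) : InjOn circlePt (Ico a (a + 2 * Real.pi)) := by
  intro s hs t ht h
  obtain ⟨m, hm⟩ := Circle.exp_eq_exp.1 (circlePt_eq_iff.1 h)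
  have hpi := Real.pi_pos
  have h1 : (m : ℝ) < 1 := by
    by_contra hc; push Not at hc
    have : 2 * Real.pi ≤ m * (2 * Real.pi) := le_mul_of_one_le_left (by positivity) hc
    linarith [hs.2, ht.1]
  have h2 : (-1 : ℝ) < m := by
    by_contra hc; push Not at hc
    have : (m : ℝ) * (2 * Real.pi) ≤ -1 * (2 * Real.pi) :=
      mul_le_mul_of_nonneg_right hc (by positivity)
    linarith [hs.1, ht.2]
  have : m = 0 := by
    have h1' : m < 1 := by exact_mod_cast h1
    have h2' : -1 < m := by exact_mod_cast h2
    omega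
  rw [hm, this]; simp

theorem exists_circlePt_eq (a : ℝ) {z : ℂ} (hz : ‖z‖ = 1) :
    ∃ t ∈ Ico a (a + 2 * Real.pi), circlePt t = z := by
  refine ⟨toIcoMod Real.two_pi_pos a (Complex.arg z), toIcoMod_mem_Ico _ _ _, ?_⟩
  have : Circle.exp (toIcoMod Real.two_pi_pos a (Complex.arg z)) = Circle.exp (Complex.arg z) := by
    rw [toIcoMod]
    exact Circle.periodic_exp.sub_zsmul_eq _
  rw [circlePt, this, Circle.coe_exp]
  have := Complex.norm_mul_exp_arg_mul_I z
  rwa [hz, Complex.ofReal_one, one_mul] at this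

/-! ### Explicit charts in polar coordinates -/

namespace Lens

/-- The polar radius of the inner curve, equal to `1` exactly at the `N`-th roots of unity. -/
def radius (N : ℕ) (w : ℂ) : ℝ := 1 - ‖w ^ N - 1‖ / 4

theorem continuous_radius (N : ℕ) : Continuous (radius N) := by unfold radius; fun_prop

theorem half_le_radius (N : ℕ) {w : ℂ} (hw : ‖w‖ ≤ 1) : 1 / 2 ≤ radius N w := by
  have h1 : ‖w ^ N - 1‖ ≤ ‖w ^ N‖ + ‖(1 : ℂ)‖ := norm_sub_le _ _
  have h2 : ‖w ^ N‖ ≤ 1 := by rw [norm_pow]; exact pow_le_one₀ (norm_nonneg _) hw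
  simp only [norm_one] at h1
  unfold radius; linarith

theorem radius_le_one (N : ℕ) (w : ℂ) : radius N w ≤ 1 := by
  unfold radius; linarith [norm_nonneg (w ^ N - 1)]

theorem pow_eq_one_of_radius {N : ℕ} {w : ℂ} (h : radius N w = 1) : w ^ N = 1 := by
  unfold radius at h
  have : ‖w ^ N - 1‖ = 0 := by linarith
  exact sub_eq_zero.1 (norm_eq_zero.1 this)

theorem norm_circlePt_sub_one (t : ℝ) : ‖circlePt t - 1‖ = 2 * |Real.sin (t / 2)| := by
  rw [← sq_eq_sq₀ (norm_nonneg _) (by positivity), ← Complex.normSq_eq_norm_sq,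
    Complex.normSq_apply, mul_pow, sq_abs]
  simp only [Complex.sub_re, Complex.sub_im, circlePt_re, circlePt_im, Complex.one_re,
    Complex.one_im]
  have h1 := Real.cos_sq_add_sin_sq t
  have h2 : Real.cos t = 1 - 2 * Real.sin (t / 2) ^ 2 := by
    have := Real.cos_two_mul' (t / 2)
    rw [mul_div_cancel₀ t two_ne_zero] at this
    rw [this]; linarith [Real.cos_sq_add_sin_sq (t / 2)]
  nlinarith

theorem circlePt_pow (t : ℝ) (N : ℕ) : circlePt t ^ N = circlePt (N * t) := by
  rw [circlePt, circlePt, ← Circle.coe_pow, ← Circle.exp_natCast_mul]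

/-- The angle at parameter `τ ∈ [0, π]` of the `j`-th arc. -/
def angle (N j : ℕ) (τ : ℝ) : ℝ := 2 * Real.pi * j / N + 2 * τ / N

/-- Here `w ^ N` has argument `2 * τ` modulo a full turn, so `‖w ^ N - 1‖ = 2 * sin τ`: the inner
curve stays inside the circle and touches it only at the two ends of each arc. -/
theorem radius_angle {N : ℕ} (hN : 0 < N) (j : ℕ) {τ : ℝ} (h0 : 0 ≤ τ) (h1 : τ ≤ Real.pi) :
    radius N (circlePt (angle N j τ)) = 1 - Real.sin τ / 2 := by
  have hN' : (N : ℝ) ≠ 0 := by positivity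
  have e : (N : ℝ) * angle N j τ / 2 = τ + j * Real.pi := by unfold angle; field_simp; ring
  rw [radius, circlePt_pow, norm_circlePt_sub_one, e]
  have : |Real.sin (τ + j * Real.pi)| = Real.sin τ := by
    rw [Real.sin_add_nat_mul_pi, abs_mul, abs_pow]
    simp [abs_of_nonneg (Real.sin_nonneg_of_nonneg_of_le_pi h0 h1)]
  rw [this]; ring

/-- The chart of the inner disc. -/
def inner (N : ℕ) (z : ℂ) : ℂ := (radius N (z / ‖z‖) : ℂ) * z

/-- The chart of the `j`-th lens. -/
def lens (N j : ℕ) (z : ℂ) : ℂ :=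
  ((1 - (√(1 - z.re ^ 2) - z.im) / 4 : ℝ) : ℂ) * circlePt (angle N j (Real.arccos z.re))

theorem norm_div_norm_le (z : ℂ) : ‖z / ‖z‖‖ ≤ 1 := by
  rw [norm_div, Complex.norm_real, norm_norm]; exact div_self_le_one _

theorem norm_inner (N : ℕ) (z : ℂ) : ‖inner N z‖ = radius N (z / ‖z‖) * ‖z‖ := by
  rw [inner, norm_mul, Complex.norm_real, Real.norm_of_nonneg]
  linarith [half_le_radius N (norm_div_norm_le z)]

/-- The chart rescales along rays. At the origin both quotients are `0 / 0 = 0`. -/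
theorem inner_div_norm (N : ℕ) (z : ℂ) : inner N z / ‖inner N z‖ = z / ‖z‖ := by
  rw [norm_inner, inner]
  have : (radius N (z / ‖z‖) : ℂ) ≠ 0 := by
    have := half_le_radius N (norm_div_norm_le z)
    exact_mod_cast (by linarith : radius N (z / ‖z‖) ≠ 0)
  push_cast
  rw [mul_div_mul_left _ _ this]

theorem inner_circlePt (N : ℕ) (t : ℝ) :
    inner N (circlePt t) = (radius N (circlePt t) : ℂ) * circlePt t := by simp [inner]

/-- Only the origin needs care: the direction jumps there, but the radial factor is at most 1. -/
theorem continuous_inner (N : ℕ) : Continuous (inner N) := by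
  rw [continuous_iff_continuousAt]
  intro z
  by_cases hz : z = 0
  · subst hz
    rw [ContinuousAt, show inner N 0 = 0 by simp [inner], tendsto_zero_iff_norm_tendsto_zero]
    refine squeeze_zero (fun _ => norm_nonneg _) (g := fun z => ‖z‖) (fun z => ?_) ?_
    · rw [norm_inner]
      exact mul_le_of_le_one_left (norm_nonneg _) (radius_le_one _ _)
    · simpa using (continuous_norm (E := ℂ)).tendsto 0
  · have hz' : (‖z‖ : ℂ) ≠ 0 := by simpa using hz
    unfold inner
    refine ContinuousAt.mul ?_ continuousAt_id
    refine (Complex.continuous_ofReal.comp (continuous_radius N)).continuousAt.comp ?_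
    exact continuousAt_id.div (Complex.continuous_ofReal.comp continuous_norm).continuousAt hz'

theorem inner_injective (N : ℕ) : Function.Injective (inner N) := by
  intro u v h
  have hd : u / ‖u‖ = v / ‖v‖ := by rw [← inner_div_norm N u, ← inner_div_norm N v, h]
  have hn : ‖u‖ = ‖v‖ := by
    have h1 := norm_inner N u
    have h2 := norm_inner N v
    rw [h, h2, hd] at h1
    have := half_le_radius N (norm_div_norm_le v)
    exact (mul_left_cancel₀ (by linarith) h1).symm
  by_cases hu : u = 0
  · subst hu; simp only [norm_zero] at hn; exact (norm_eq_zero.1 hn.symm).symm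
  · have : (‖u‖ : ℂ) ≠ 0 := by simpa using hu
    rw [← hn, div_left_inj' this] at hd
    exact hd

theorem abs_im_le {z : ℂ} (hz : ‖z‖ ≤ 1) : |z.im| ≤ √(1 - z.re ^ 2) := by
  apply Real.abs_le_sqrt
  have : Complex.normSq z ≤ 1 := by
    rw [Complex.normSq_eq_norm_sq]; exact pow_le_one₀ (norm_nonneg _) hz
  rw [Complex.normSq_apply] at this
  nlinarith

theorem abs_im_lt {z : ℂ} (hz : ‖z‖ < 1) : |z.im| < √(1 - z.re ^ 2) := by
  rw [← Real.sqrt_sq_eq_abs]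
  apply Real.sqrt_lt_sqrt (sq_nonneg _)
  have : Complex.normSq z < 1 := by
    rw [Complex.normSq_eq_norm_sq]; exact pow_lt_one₀ (norm_nonneg _) hz two_ne_zero
  rw [Complex.normSq_apply] at this
  nlinarith

theorem abs_re_le {z : ℂ} (hz : ‖z‖ ≤ 1) : -1 ≤ z.re ∧ z.re ≤ 1 :=
  abs_le.1 ((Complex.abs_re_le_norm z).trans hz)

theorem sqrt_le_one (x : ℝ) : √(1 - x ^ 2) ≤ 1 := by
  rw [Real.sqrt_le_one]; nlinarith [sq_nonneg x]

/-- The vertical chord over `re = cos τ` is carried to the radial segment at `angle N j τ`,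
affinely, from radius `1 - sin τ / 2` on the lower half circle to radius 1 on the upper one. -/
theorem norm_lens {N j : ℕ} {z : ℂ} (hz : ‖z‖ ≤ 1) :
    ‖lens N j z‖ = 1 - (√(1 - z.re ^ 2) - z.im) / 4 := by
  rw [lens, norm_mul, norm_circlePt, mul_one, Complex.norm_real, Real.norm_of_nonneg]
  have h1 := abs_le.1 (abs_im_le hz)
  have h2 := sqrt_le_one z.re
  linarith [h1.1, h1.2]

theorem lens_radius_pos {z : ℂ} (hz : ‖z‖ ≤ 1) : 0 < 1 - (√(1 - z.re ^ 2) - z.im) / 4 := by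
  have h1 := abs_le.1 (abs_im_le hz)
  have h2 := sqrt_le_one z.re
  linarith [h1.1, h1.2]

theorem lens_div_norm {N j : ℕ} {z : ℂ} (hz : ‖z‖ ≤ 1) :
    lens N j z / ‖lens N j z‖ = circlePt (angle N j (Real.arccos z.re)) := by
  rw [norm_lens hz, lens]
  have := lens_radius_pos hz
  exact mul_div_cancel_left₀ _ (by exact_mod_cast this.ne')

theorem radius_lens {N : ℕ} (hN : 0 < N) (j : ℕ) {z : ℂ} (hz : ‖z‖ ≤ 1) :
    radius N (lens N j z / ‖lens N j z‖) = 1 - √(1 - z.re ^ 2) / 2 := by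
  rw [lens_div_norm hz, radius_angle hN j (Real.arccos_nonneg _) (Real.arccos_le_pi _),
    Real.sin_arccos]

theorem continuous_lens (N j : ℕ) : Continuous (lens N j) := by
  unfold lens angle
  refine Continuous.mul (by fun_prop) (continuous_circlePt.comp ?_)
  have := Real.continuous_arccos
  fun_prop

theorem angle_mem {N : ℕ} (hN : 0 < N) {j : ℕ} (hj : j < N) {τ : ℝ} (h0 : 0 ≤ τ)
    (h1 : τ < Real.pi) : angle N j τ ∈ Ico 0 (0 + 2 * Real.pi) := by
  have hN' : (0 : ℝ) < N := by positivity
  have hj' : (j : ℝ) + 1 ≤ N := by exact_mod_cast hj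
  have := Real.pi_pos
  constructor
  · unfold angle; positivity
  · have : angle N j τ = (2 * Real.pi * j + 2 * τ) / N := by unfold angle; ring
    rw [this, div_lt_iff₀ hN']
    nlinarith

theorem angle_injective {N : ℕ} (hN : 0 < N) (j : ℕ) : Function.Injective (angle N j) := by
  intro s t h
  have hN' : (N : ℝ) ≠ 0 := by positivity
  unfold angle at h
  field_simp at h
  linarith

/-- The closed sector has opening `2π / N`; for `N = 1` it would close up and identify the two tips
of the lens. -/
theorem lens_injOn {N : ℕ} (hN : 2 ≤ N) (j : ℕ) :
    InjOn (lens N j) (closedBall 0 1) := by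
  intro u hu v hv h
  rw [mem_closedBall_zero_iff] at hu hv
  have hN' : (2 : ℝ) ≤ N := by exact_mod_cast hN
  have hd := lens_div_norm (N := N) (j := j) hu
  rw [h, lens_div_norm hv] at hd
  have mem : ∀ x : ℝ, angle N j (Real.arccos x) ∈
      Ico (2 * Real.pi * j / N) (2 * Real.pi * j / N + 2 * Real.pi) := by
    intro x
    unfold angle
    have h1 := Real.arccos_nonneg x
    have h2 := Real.arccos_le_pi x
    have h3 : 0 ≤ 2 * Real.arccos x / N := by positivity
    have h4 : 2 * Real.arccos x / N < 2 * Real.pi := by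
      rw [div_lt_iff₀ (by linarith)]; nlinarith [Real.pi_pos]
    constructor <;> linarith
  have ha := angle_injective (by omega) j (circlePt_injOn _ (mem _) (mem _) hd)
  have hre : u.re = v.re :=
    Real.arccos_injOn ⟨(abs_re_le hu).1, (abs_re_le hu).2⟩
      ⟨(abs_re_le hv).1, (abs_re_le hv).2⟩ ha.symm
  have hn := norm_lens (N := N) (j := j) hu
  rw [h, norm_lens hv, hre] at hn
  exact Complex.ext hre (by linarith)

/-- Open lenses lie in disjoint open sectors, since `arccos` of the real part is strictly between 0
and `π` on the open disc. -/
theorem lens_disjoint {N : ℕ} (hN : 0 < N) {i j : ℕ} (hi : i < N) (hj : j < N) (hij : i ≠ j) :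
    Disjoint (lens N i '' ball 0 1) (lens N j '' ball 0 1) := by
  rw [Set.disjoint_left]
  rintro _ ⟨u, hu, rfl⟩ ⟨v, hv, h⟩
  rw [mem_ball_zero_iff] at hu hv
  have hN' : (0 : ℝ) < N := by positivity
  have pos : ∀ {z : ℂ}, ‖z‖ < 1 → 0 < Real.arccos z.re ∧ Real.arccos z.re < Real.pi := by
    intro z hz
    have hlt := (Complex.abs_re_le_norm z).trans_lt hz
    rw [abs_lt] at hlt
    exact ⟨Real.arccos_pos.2 hlt.2, Real.arccos_lt_pi.2 hlt.1⟩
  have hd := lens_div_norm (N := N) (j := i) hu.le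
  rw [← h, lens_div_norm hv.le] at hd
  have he := circlePt_injOn 0 (angle_mem hN hj (pos hv).1.le (pos hv).2)
    (angle_mem hN hi (pos hu).1.le (pos hu).2) hd
  unfold angle at he
  have h1 := pos hu
  have h2 := pos hv
  field_simp at he
  rcases lt_or_gt_of_ne hij with hlt | hlt
  · have : (i : ℝ) + 1 ≤ j := by exact_mod_cast hlt
    nlinarith [Real.pi_pos]
  · have : (j : ℝ) + 1 ≤ i := by exact_mod_cast hlt
    nlinarith [Real.pi_pos]

theorem lens_circlePt {N : ℕ} {j : ℕ} {τ : ℝ} (h0 : 0 ≤ τ) (h1 : τ ≤ Real.pi) :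
    lens N j (circlePt τ) = circlePt (angle N j τ) := by
  have hs := Real.sin_nonneg_of_nonneg_of_le_pi h0 h1
  have : √(1 - Real.cos τ ^ 2) = Real.sin τ := by
    rw [← Real.sin_sq, Real.sqrt_sq hs]
  rw [lens, circlePt_re, circlePt_im, Real.arccos_cos h0 h1, this]; simp

theorem lens_circlePt_neg {N : ℕ} (hN : 0 < N) {j : ℕ} {τ : ℝ} (h0 : 0 ≤ τ) (h1 : τ ≤ Real.pi) :
    lens N j (circlePt (-τ)) = inner N (circlePt (angle N j τ)) := by
  have hs := Real.sin_nonneg_of_nonneg_of_le_pi h0 h1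
  have : √(1 - Real.cos τ ^ 2) = Real.sin τ := by
    rw [← Real.sin_sq, Real.sqrt_sq hs]
  rw [lens, circlePt_re, circlePt_im, Real.cos_neg, Real.sin_neg, Real.arccos_cos h0 h1, this,
    inner_circlePt, radius_angle hN j h0 h1]
  congr 2; ring

theorem norm_le_radius_of_mem_inner {N : ℕ} {z : ℂ} (hz : z ∈ inner N '' closedBall 0 1) :
    ‖z‖ ≤ radius N (z / ‖z‖) := by
  obtain ⟨u, hu, rfl⟩ := hz
  rw [inner_div_norm, norm_inner]
  rw [mem_closedBall_zero_iff] at hu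
  have := half_le_radius N (norm_div_norm_le u)
  exact mul_le_of_le_one_right (by linarith) hu

theorem radius_lt_norm_lens {N : ℕ} (hN : 0 < N) {j : ℕ} {z : ℂ} (hz : z ∈ ball (0 : ℂ) 1) :
    radius N (lens N j z / ‖lens N j z‖) < ‖lens N j z‖ ∧ ‖lens N j z‖ < 1 := by
  rw [mem_ball_zero_iff] at hz
  rw [radius_lens hN j hz.le, norm_lens hz.le]
  have h1 := abs_lt.1 (abs_im_lt hz)
  constructor <;> linarith [h1.1, h1.2]

theorem mem_lens {N : ℕ} (hN : 0 < N) {z : ℂ} (h1 : radius N (z / ‖z‖) < ‖z‖) (h2 : ‖z‖ < 1) :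
    ∃ j < N, z ∈ lens N j '' ball 0 1 := by
  have hN' : (0 : ℝ) < N := by positivity
  have hpi := Real.pi_pos
  have hz0 : 0 < ‖z‖ := by linarith [half_le_radius N (norm_div_norm_le z)]
  have hzn : ‖z / ‖z‖‖ = 1 := by
    rw [norm_div, Complex.norm_real, norm_norm, div_self hz0.ne']
  obtain ⟨θ, hθ, hθz⟩ := exists_circlePt_eq 0 hzn
  set j := ⌊N * θ / (2 * Real.pi)⌋₊ with hj
  have hnn : 0 ≤ N * θ / (2 * Real.pi) := by have := hθ.1; positivity
  have hj1 : (j : ℝ) ≤ N * θ / (2 * Real.pi) := Nat.floor_le hnn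
  have hj2 : N * θ / (2 * Real.pi) < j + 1 := Nat.lt_floor_add_one _
  rw [le_div_iff₀ (by positivity)] at hj1
  rw [div_lt_iff₀ (by positivity)] at hj2
  have hjN : j < N := by
    have : (j : ℝ) * (2 * Real.pi) < N * (2 * Real.pi) := by
      refine hj1.trans_lt (mul_lt_mul_of_pos_left (by linarith [hθ.2]) hN')
    exact_mod_cast lt_of_mul_lt_mul_right this (by positivity)
  set τ := N * θ / 2 - Real.pi * j with hτ
  have hτ0 : 0 ≤ τ := by rw [hτ]; linarith
  have hτ1 : τ ≤ Real.pi := by rw [hτ]; linarith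
  have hang : angle N j τ = θ := by unfold angle; rw [hτ]; field_simp; ring
  have hs := Real.sin_nonneg_of_nonneg_of_le_pi hτ0 hτ1
  rw [← hθz, ← hang, radius_angle hN j hτ0 hτ1] at h1
  have hsq : √(1 - Real.cos τ ^ 2) = Real.sin τ := by
    rw [← Real.sin_sq, Real.sqrt_sq hs]
  -- The imaginary part solves `1 - (sin τ - im) / 4 = ‖z‖`; the two bounds on `‖z‖` place it
  -- strictly between `-sin τ` and `sin τ`.
  refine ⟨j, hjN, ⟨Real.cos τ, Real.sin τ - 4 * (1 - ‖z‖)⟩, ?_, ?_⟩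
  · rw [mem_ball_zero_iff, ← sq_lt_one_iff₀ (norm_nonneg _), ← Complex.normSq_eq_norm_sq,
      Complex.normSq_apply]
    dsimp only
    have := Real.cos_sq_add_sin_sq τ
    nlinarith
  · rw [lens]
    dsimp only
    rw [hsq, Real.arccos_cos hτ0 hτ1, hang, hθz]
    have : ((1 - (Real.sin τ - (Real.sin τ - 4 * (1 - ‖z‖))) / 4 : ℝ) : ℂ) = ‖z‖ := by
      congr 1; ring
    rw [this]
    exact mul_div_cancel₀ z (by exact_mod_cast hz0.ne')

theorem mem_inner_ball {N : ℕ} {z : ℂ} (h : ‖z‖ < radius N (z / ‖z‖)) :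
    z ∈ inner N '' ball 0 1 := by
  set ρ := radius N (z / ‖z‖) with hρ
  have hρ0 : 0 < ρ := lt_of_le_of_lt (norm_nonneg _) h
  have hn : ‖z / ρ‖ = ‖z‖ / ρ := by
    rw [norm_div, Complex.norm_real, Real.norm_of_nonneg hρ0.le]
  refine ⟨z / ρ, ?_, ?_⟩
  · rw [mem_ball_zero_iff, hn, div_lt_one hρ0]; exact h
  · have hc : (ρ : ℂ) ≠ 0 := by exact_mod_cast hρ0.ne'
    have : z / ρ / ‖z / ρ‖ = z / ‖z‖ := by
      rw [hn]; push_cast; rw [div_div_div_cancel_right₀ hc]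
    rw [inner, this, ← hρ, mul_div_cancel₀ z hc]

open Classical in
/-- A map with prescribed values on the unit circle and on the inner curve. -/
def glue {C : Type*} (α g : ℂ → C) (z : ℂ) : C := if ‖z‖ = 1 then α z else g (z / ‖z‖)

theorem glue_sphere {C : Type*} (α g : ℂ → C) {z : ℂ} (hz : z ∈ sphere (0 : ℂ) 1) :
    glue α g z = α z := if_pos (by simpa using hz)

/-- Where the inner curve touches the circle its radius is 1, hence `z ^ N = 1`, and there the two
prescriptions agree by hypothesis. -/
theorem glue_inner {C : Type*} {N : ℕ} {α g : ℂ → C} (h : ∀ z, z ^ N = 1 → α z = g z)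
    {z : ℂ} (hz : z ∈ sphere (0 : ℂ) 1) : glue α g (inner N z) = g z := by
  have hz' : ‖z‖ = 1 := by simpa using hz
  unfold glue
  split_ifs with h1
  · rw [norm_inner, hz', mul_one, Complex.ofReal_one, div_one] at h1
    rw [inner, hz', Complex.ofReal_one, div_one, h1, Complex.ofReal_one, one_mul]
    exact h z (pow_eq_one_of_radius h1)
  · rw [inner_div_norm, hz', Complex.ofReal_one, div_one]

/-- The division of the disc into an inner disc and `N` lenses. -/
def division {C : Type*} [TopologicalSpace C] {N : ℕ} (hN : 2 ≤ N) {α g : ℂ → C}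
    (hα : ContinuousOn α (sphere 0 1)) (hg : ContinuousOn g (sphere 0 1))
    (h : ∀ z, z ^ N = 1 → α z = g z) : Division C (N + 1) where
  chart := Fin.cons (inner N) fun j : Fin N => lens N j
  body := sphere 0 1 ∪ inner N '' sphere 0 1
  map := glue α g
  continuousOn_chart i := by
    refine Fin.cases ?_ (fun j => ?_) i
    · exact (continuous_inner N).continuousOn
    · exact (continuous_lens N j).continuousOn
  injOn_chart i := by
    refine Fin.cases ?_ (fun j => ?_) i
    · exact (inner_injective N).injOn
    · exact lens_injOn hN j
  isClosed_body := isClosed_sphere.union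
    ((isCompact_sphere 0 1).image (continuous_inner N)).isClosed
  sphere_subset := subset_union_left
  chart_sphere i := by
    refine Fin.cases ?_ (fun j => ?_) i
    · exact subset_union_right
    · rintro _ ⟨z, hz, rfl⟩
      have hz' : ‖z‖ = 1 := by simpa using hz
      obtain ⟨t, ht, rfl⟩ := exists_circlePt_eq (-Real.pi) hz'
      rcases le_total 0 t with h0 | h0
      · left
        rw [Fin.cons_succ, lens_circlePt h0 (by linarith [ht.2])]
        exact circlePt_mem_sphere _
      · right
        have := lens_circlePt_neg (N := N) (by omega) (j := j) (τ := -t) (by linarith)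
          (by linarith [ht.1])
        rw [neg_neg] at this
        rw [Fin.cons_succ, this]
        exact ⟨_, circlePt_mem_sphere _, rfl⟩
  disjoint_body i := by
    refine Fin.cases ?_ (fun j => ?_) i
    · rw [Set.disjoint_left]
      rintro _ ⟨u, hu, rfl⟩ hb
      rw [Fin.cons_zero] at hb
      rw [mem_ball_zero_iff] at hu
      rcases hb with hb | ⟨v, hv, hb⟩
      · rw [mem_sphere_zero_iff_norm, norm_inner] at hb
        have h1 := radius_le_one N (u / ‖u‖)
        have h2 := half_le_radius N (norm_div_norm_le u)
        nlinarith [norm_nonneg u]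
      · rw [inner_injective N hb] at hv
        rw [mem_sphere_zero_iff_norm] at hv; linarith
    · rw [Set.disjoint_left]
      rintro _ ⟨u, hu, rfl⟩ hb
      rw [Fin.cons_succ] at hb
      obtain ⟨h1, h2⟩ := radius_lt_norm_lens (N := N) (by omega) (j := j) hu
      rcases hb with hb | hb
      · rw [mem_sphere_zero_iff_norm] at hb; linarith
      · linarith [norm_le_radius_of_mem_inner (image_mono sphere_subset_closedBall hb)]
  disjoint_ball := by
    have key : ∀ j : Fin N, Disjoint (inner N '' ball 0 1) (lens N j '' ball 0 1) := by
      intro j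
      rw [Set.disjoint_right]
      rintro _ ⟨u, hu, rfl⟩ hb
      obtain ⟨h1, h2⟩ := radius_lt_norm_lens (N := N) (by omega) (j := j) hu
      linarith [norm_le_radius_of_mem_inner (image_mono ball_subset_closedBall hb)]
    intro i
    refine Fin.cases ?_ (fun i => ?_) i <;> intro j <;> refine Fin.cases ?_ (fun j => ?_) j
    · intro h; exact absurd rfl h
    · intro _; exact key j
    · intro _; exact (key i).symm
    · intro hij
      exact lens_disjoint (by omega) i.2 j.2 fun h => hij (congrArg Fin.succ (Fin.ext h))
  cover := by
    apply Subset.antisymm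
    · refine union_subset (union_subset sphere_subset_closedBall ?_) (iUnion_subset fun i => ?_)
      · rintro _ ⟨u, hu, rfl⟩
        rw [mem_closedBall_zero_iff]
        exact (norm_le_radius_of_mem_inner ⟨u, sphere_subset_closedBall hu, rfl⟩).trans
          (radius_le_one _ _)
      · refine Fin.cases ?_ (fun j => ?_) i
        · rintro _ ⟨u, hu, rfl⟩
          rw [mem_closedBall_zero_iff]
          exact (norm_le_radius_of_mem_inner ⟨u, ball_subset_closedBall hu, rfl⟩).trans
            (radius_le_one _ _)
        · rintro _ ⟨u, hu, rfl⟩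
          rw [mem_closedBall_zero_iff]
          exact (radius_lt_norm_lens (N := N) (by omega) (j := j) hu).2.le
    · intro z hz
      rw [mem_closedBall_zero_iff] at hz
      rcases hz.lt_or_eq with hz | hz
      · rcases lt_trichotomy ‖z‖ (radius N (z / ‖z‖)) with h1 | h1 | h1
        · exact Or.inr (mem_iUnion.2 ⟨0, mem_inner_ball h1⟩)
        · have hz0 : 0 < ‖z‖ := by rw [h1]; linarith [half_le_radius N (norm_div_norm_le z)]
          have hu : ‖z / ‖z‖‖ = 1 := by
            rw [norm_div, Complex.norm_real, norm_norm, div_self hz0.ne']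
          refine Or.inl (Or.inr ⟨z / ‖z‖, by simpa using hu, ?_⟩)
          rw [inner, hu, Complex.ofReal_one, div_one, ← h1]
          exact mul_div_cancel₀ z (by exact_mod_cast hz0.ne')
        · obtain ⟨j, hj, hm⟩ := mem_lens (by omega) h1 hz
          exact Or.inr (mem_iUnion.2 ⟨Fin.succ ⟨j, hj⟩, hm⟩)
      · exact Or.inl (Or.inl (by simpa using hz))
  continuousOn_map := by
    refine ContinuousOn.union_of_isClosed ?_ ?_ isClosed_sphere
      ((isCompact_sphere 0 1).image (continuous_inner N)).isClosed
    · exact hα.congr fun z hz => glue_sphere α g hz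
    · have : EqOn (glue α g) (fun z => g (z / ‖z‖)) (inner N '' sphere 0 1) := by
        rintro _ ⟨z, hz, rfl⟩
        have hz' : ‖z‖ = 1 := by simpa using hz
        simp only [glue_inner h hz, inner_div_norm, hz', Complex.ofReal_one, div_one]
      refine ContinuousOn.congr ?_ this
      refine hg.comp ?_ ?_
      · refine continuousOn_id.div (Complex.continuous_ofReal.comp continuous_norm).continuousOn ?_
        rintro _ ⟨z, hz, rfl⟩
        have hz' : ‖z‖ = 1 := by simpa using hz
        have := half_le_radius N (norm_div_norm_le z)
        rw [hz', Complex.ofReal_one, div_one] at this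
        show ((‖inner N z‖ : ℝ) : ℂ) ≠ 0
        rw [norm_inner, hz', mul_one, Complex.ofReal_ne_zero, Complex.ofReal_one, div_one]
        linarith
      · rintro _ ⟨z, hz, rfl⟩
        have hz' : ‖z‖ = 1 := by simpa using hz
        show inner N z / ‖inner N z‖ ∈ sphere (0 : ℂ) 1
        rw [inner_div_norm, hz', Complex.ofReal_one, div_one]
        exact hz

end Lens

end

noncomputable section

/-! ### Planar sets that are one-dimensional manifolds off a finite set -/

/-- A continuous map of a compact space onto a Hausdorff space is a quotient map. This is the tool
for gluing maps along arcs and over tiles. -/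
theorem ContinuousOn.of_comp_image {α β Y : Type*} [TopologicalSpace α] [TopologicalSpace β]
    [T2Space β] [TopologicalSpace Y] {K : Set α} (hK : IsCompact K) {c : α → β}
    (hc : ContinuousOn c K) {f : β → Y} (hf : ContinuousOn (f ∘ c) K) :
    ContinuousOn f (c '' K) := by
  have : CompactSpace K := isCompact_iff_compactSpace.1 hK
  let c' : K → c '' K := fun x => ⟨c x, x, x.2, rfl⟩
  have hc' : Continuous c' := (continuousOn_iff_continuous_domRestrict.1 hc).subtype_mk _
  have hq : IsQuotientMap c' :=
    hc'.isClosedMap.isQuotientMap hc' (by rintro ⟨_, x, hx, rfl⟩; exact ⟨⟨x, hx⟩, rfl⟩)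
  rw [continuousOn_iff_continuous_domRestrict, hq.continuous_iff]
  exact continuousOn_iff_continuous_domRestrict.1 hf

/-- Every point of `S` off `U` has a neighbourhood in `S` homeomorphic to an open interval. -/
def LocallyLine (S U : Set ℂ) : Prop :=
  ∀ p ∈ S, p ∉ U → ∃ O : Set ℂ, IsOpen O ∧ p ∈ O ∧ Nonempty (↥(O ∩ S) ≃ₜ ℝ)

/-- An injective arc in a set locally homeomorphic to a line is relatively open. -/
theorem LocallyLine.exists_isOpen {S U : Set ℂ} (h : LocallyLine S U) {ψ : ℝ → ℂ} {a b t : ℝ}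
    (ht : t ∈ Ioo a b) (hc : ContinuousOn ψ (Ioo a b)) (hi : InjOn ψ (Ioo a b))
    (hS : MapsTo ψ (Ioo a b) S) (hU : ψ t ∉ U) :
    ∃ O : Set ℂ, IsOpen O ∧ ψ t ∈ O ∧ O ∩ S ⊆ ψ '' Ioo a b := by
  classical
  obtain ⟨O, hO, hpO, ⟨e⟩⟩ := h (ψ t) (hS ht) hU
  let e' : ℂ → ℝ := fun q => if hq : q ∈ O ∩ S then e ⟨q, hq⟩ else 0
  have he' : ∀ q (hq : q ∈ O ∩ S), e' q = e ⟨q, hq⟩ := fun q hq => dif_pos hq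
  have hce : ContinuousOn e' (O ∩ S) := by
    rw [continuousOn_iff_continuous_domRestrict]
    convert e.continuous using 1
    ext ⟨q, hq⟩
    exact he' q hq
  have hie : InjOn e' (O ∩ S) := by
    intro p hp q hq hpq
    rw [he' p hp, he' q hq] at hpq
    simpa using e.injective hpq
  have hnear : ∀ᶠ s in 𝓝 t, s ∈ Ioo a b ∧ ψ s ∈ O :=
    (show ∀ᶠ s in 𝓝 t, s ∈ Ioo a b from Ioo_mem_nhds ht.1 ht.2).and
      ((hc.continuousAt (Ioo_mem_nhds ht.1 ht.2)).eventually (hO.mem_nhds hpO))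
  obtain ⟨δ, hδ, hball⟩ := Metric.eventually_nhds_iff_ball.1 hnear
  rw [Real.ball_eq_Ioo] at hball
  have hcg : ContinuousOn (e' ∘ ψ) (Ioo (t - δ) (t + δ)) :=
    hce.comp (hc.mono fun s hs => (hball s hs).1) fun s hs =>
      ⟨(hball s hs).2, hS (hball s hs).1⟩
  have hig : InjOn (e' ∘ ψ) (Ioo (t - δ) (t + δ)) :=
    hie.comp (hi.mono fun s hs => (hball s hs).1) fun s hs =>
      ⟨(hball s hs).2, hS (hball s hs).1⟩
  have ht1 : t - δ / 2 ∈ Ioo (t - δ) (t + δ) := ⟨by linarith, by linarith⟩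
  have ht2 : t + δ / 2 ∈ Ioo (t - δ) (t + δ) := ⟨by linarith, by linarith⟩
  have ht0 : t ∈ Ioo (t - δ) (t + δ) := ⟨by linarith, by linarith⟩
  have hsub : uIcc (t - δ / 2) (t + δ / 2) ⊆ Ioo (t - δ) (t + δ) := by
    rw [uIcc_of_le (by linarith)]
    exact fun s hs => ⟨by linarith [hs.1], by linarith [hs.2]⟩
  -- In the coordinate `e` the arc becomes an injective continuous real function, so it is strictly
  -- monotone and covers an interval around its value at `t`. The preimage of that interval is the
  -- neighbourhood sought.
  have hivt := intermediate_value_uIcc (hcg.mono hsub)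
  have hint : e' (ψ t) ∈ interior (uIcc ((e' ∘ ψ) (t - δ / 2)) ((e' ∘ ψ) (t + δ / 2))) := by
    rcases hcg.strictMonoOn_of_injOn_Ioo (by linarith) hig with hm | hm
    · have h1 := hm ht1 ht0 (by linarith)
      have h2 := hm ht0 ht2 (by linarith)
      rw [uIcc_of_le (h1.trans h2).le, interior_Icc]
      exact ⟨h1, h2⟩
    · have h1 := hm ht1 ht0 (by linarith)
      have h2 := hm ht0 ht2 (by linarith)
      rw [uIcc_of_ge (h2.trans h1).le, interior_Icc]
      exact ⟨h2, h1⟩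
  set I := interior (uIcc ((e' ∘ ψ) (t - δ / 2)) ((e' ∘ ψ) (t + δ / 2)))
  obtain ⟨O', hO', hOI⟩ := continuousOn_iff'.1 hce I isOpen_interior
  refine ⟨O' ∩ O, hO'.inter hO, ⟨?_, hpO⟩, ?_⟩
  · have : ψ t ∈ e' ⁻¹' I ∩ (O ∩ S) := ⟨hint, hpO, hS ht⟩
    rw [hOI] at this; exact this.1
  · rintro q ⟨⟨hq1, hq2⟩, hq3⟩
    have : q ∈ O' ∩ (O ∩ S) := ⟨hq1, hq2, hq3⟩
    rw [← hOI] at this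
    obtain ⟨s, hs, hsq⟩ := hivt (interior_subset this.1)
    have hs' := hball s (hsub hs)
    exact ⟨s, hs'.1, hie ⟨hs'.2, hS hs'.1⟩ ⟨hq2, hq3⟩ hsq⟩

/-- An arc or a closed curve in `S` with end points in `U`. -/
structure Strand (S U : Set ℂ) (ψ : ℝ → ℂ) (a b : ℝ) : Prop where
  lt : a < b
  cont : ContinuousOn ψ (Icc a b)
  inj : InjOn ψ (Ico a b)
  maps : MapsTo ψ (Icc a b) S
  left : ψ a ∈ U
  right : ψ b ∈ U

/-- A strand that avoids `U` except at its end points. -/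
structure Gap (S U : Set ℂ) (ψ : ℝ → ℂ) (a b : ℝ) : Prop extends Strand S U ψ a b where
  avoid : ∀ t ∈ Ioo a b, ψ t ∉ U

/-- The open arcs into which `U` cuts `S`. -/
def IsEdge (S U e : Set ℂ) : Prop := ∃ ψ a b, Gap S U ψ a b ∧ e = ψ '' Ioo a b

theorem Strand.mono {S U U' : Set ℂ} {ψ : ℝ → ℂ} {a b : ℝ} (h : Strand S U ψ a b) (hU : U ⊆ U') :
    Strand S U' ψ a b := ⟨h.lt, h.cont, h.inj, h.maps, hU h.left, hU h.right⟩

theorem Strand.split_left {S U : Set ℂ} {ψ : ℝ → ℂ} {a b c : ℝ} (h : Strand S U ψ a b)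
    (hc : c ∈ Ioo a b) (hU : ψ c ∈ U) : Strand S U ψ a c :=
  ⟨hc.1, h.cont.mono (Icc_subset_Icc_right hc.2.le), h.inj.mono (Ico_subset_Ico_right hc.2.le),
    h.maps.mono_left (Icc_subset_Icc_right hc.2.le), h.left, hU⟩

theorem Strand.split_right {S U : Set ℂ} {ψ : ℝ → ℂ} {a b c : ℝ} (h : Strand S U ψ a b)
    (hc : c ∈ Ioo a b) (hU : ψ c ∈ U) : Strand S U ψ c b :=
  ⟨hc.2, h.cont.mono (Icc_subset_Icc_left hc.1.le), h.inj.mono (Ico_subset_Ico_left hc.1.le),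
    h.maps.mono_left (Icc_subset_Icc_left hc.1.le), hU, h.right⟩

/-- Induction on the number of interior parameters sent into `U`, finite because the strand is
injective. It reduces every additive statement about strands to gaps. -/
theorem Strand.induction {S U : Set ℂ} (hU : U.Finite) {ψ : ℝ → ℂ} {M : ℝ → ℝ → Prop}
    (gap : ∀ a b, Gap S U ψ a b → M a b)
    (split : ∀ a c b, Strand S U ψ a b → c ∈ Ioo a b → ψ c ∈ U → M a c → M c b → M a b)
    {a b : ℝ} (h : Strand S U ψ a b) : M a b := by
  have fin : ∀ {a b}, Strand S U ψ a b → (Ioo a b ∩ ψ ⁻¹' U).Finite := fun h =>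
    Finite.of_finite_image (hU.subset (by rintro _ ⟨t, ht, rfl⟩; exact ht.2))
      (h.inj.mono (inter_subset_left.trans Ioo_subset_Ico_self))
  induction hn : (Ioo a b ∩ ψ ⁻¹' U).ncard using Nat.strong_induction_on generalizing a b with
  | _ n ih =>
    subst hn
    by_cases hex : ∃ c ∈ Ioo a b, ψ c ∈ U
    · obtain ⟨c, hc, hcU⟩ := hex
      refine split a c b h hc hcU (ih _ ?_ (h.split_left hc hcU) rfl)
        (ih _ ?_ (h.split_right hc hcU) rfl)
      · refine ncard_lt_ncard ⟨?_, fun hs => ?_⟩ (fin h)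
        · exact fun t ht => ⟨⟨ht.1.1, ht.1.2.trans hc.2⟩, ht.2⟩
        · exact lt_irrefl _ (hs ⟨hc, hcU⟩).1.2
      · refine ncard_lt_ncard ⟨?_, fun hs => ?_⟩ (fin h)
        · exact fun t ht => ⟨⟨hc.1.trans ht.1.1, ht.1.2⟩, ht.2⟩
        · exact lt_irrefl _ (hs ⟨hc, hcU⟩).1.1
    · push Not at hex
      exact gap a b ⟨h, hex⟩

theorem Strand.exists_gap {S U : Set ℂ} (hU : U.Finite) {ψ : ℝ → ℂ} {a b : ℝ}
    (h : Strand S U ψ a b) : ∀ t ∈ Icc a b, ψ t ∉ U →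
      ∃ a' b', Gap S U ψ a' b' ∧ t ∈ Ioo a' b' ∧ a ≤ a' ∧ b' ≤ b := by
  refine Strand.induction hU (M := fun a b => ∀ t ∈ Icc a b, ψ t ∉ U →
      ∃ a' b', Gap S U ψ a' b' ∧ t ∈ Ioo a' b' ∧ a ≤ a' ∧ b' ≤ b) ?_ ?_ h
  · intro a b h t ht htU
    refine ⟨a, b, h, ⟨ht.1.lt_of_ne ?_, ht.2.lt_of_ne ?_⟩, le_rfl, le_rfl⟩
    · rintro rfl; exact htU h.left
    · rintro rfl; exact htU h.right
  · intro a c b h hc hcU h1 h2 t ht htU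
    rcases le_total t c with htc | htc
    · obtain ⟨a', b', hg, hm, h3, h4⟩ := h1 t ⟨ht.1, htc⟩ htU
      exact ⟨a', b', hg, hm, h3, h4.trans hc.2.le⟩
    · obtain ⟨a', b', hg, hm, h3, h4⟩ := h2 t ⟨htc, ht.2⟩ htU
      exact ⟨a', b', hg, hm, hc.1.le.trans h3, h4⟩

/-! ### Edges cut out by a finite set, their weights, and gluing along them -/

section Edges

variable {S U : Set ℂ}

theorem Gap.image_Icc {ψ : ℝ → ℂ} {a b : ℝ} (h : Gap S U ψ a b) :
    ψ '' Icc a b = ψ '' Ioo a b ∪ {ψ a, ψ b} := by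
  rw [← image_pair, ← image_union, Ioo_union_both h.lt.le]

theorem Gap.closure_image {ψ : ℝ → ℂ} {a b : ℝ} (h : Gap S U ψ a b) :
    closure (ψ '' Ioo a b) = ψ '' Icc a b := by
  apply Subset.antisymm
  · exact closure_minimal (image_mono Ioo_subset_Icc_self)
      (isCompact_Icc.image_of_continuousOn h.cont).isClosed
  · have := h.cont
    rw [← closure_Ioo h.lt.ne] at this ⊢
    exact this.image_closure

/-- This recovers the end points from the edge as a set, so that its length does not depend on the
parametrization. -/
theorem Gap.closure_inter {ψ : ℝ → ℂ} {a b : ℝ} (h : Gap S U ψ a b) :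
    closure (ψ '' Ioo a b) ∩ U = {ψ a, ψ b} := by
  rw [h.closure_image, h.image_Icc, union_inter_distrib_right]
  have h1 : ψ '' Ioo a b ∩ U = ∅ := by
    rw [eq_empty_iff_forall_notMem]
    rintro _ ⟨⟨t, ht, rfl⟩, h'⟩
    exact h.avoid t ht h'
  rw [h1, empty_union]
  apply inter_eq_left.2
  rintro _ (rfl | rfl)
  exacts [h.left, h.right]

theorem IsEdge.subset {e : Set ℂ} (he : IsEdge S U e) : e ⊆ S \ U := by
  obtain ⟨ψ, a, b, h, rfl⟩ := he
  rintro _ ⟨t, ht, rfl⟩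
  exact ⟨h.maps (Ioo_subset_Icc_self ht), h.avoid t ht⟩

theorem IsEdge.isPreconnected {e : Set ℂ} (he : IsEdge S U e) : IsPreconnected e := by
  obtain ⟨ψ, a, b, h, rfl⟩ := he
  exact isPreconnected_Ioo.image ψ (h.cont.mono Ioo_subset_Icc_self)

theorem IsEdge.nonempty {e : Set ℂ} (he : IsEdge S U e) : e.Nonempty := by
  obtain ⟨ψ, a, b, h, rfl⟩ := he
  exact (nonempty_Ioo.2 h.lt).image ψ

theorem IsEdge.closure_subset {e : Set ℂ} (he : IsEdge S U e) : closure e ⊆ e ∪ U := by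
  obtain ⟨ψ, a, b, h, rfl⟩ := he
  rw [h.closure_image, h.image_Icc]
  refine union_subset_union_right _ ?_
  rintro _ (rfl | rfl)
  exacts [h.left, h.right]

theorem IsEdge.exists_isOpen (hl : LocallyLine S U) {e : Set ℂ} (he : IsEdge S U e) {p : ℂ}
    (hp : p ∈ e) : ∃ O : Set ℂ, IsOpen O ∧ p ∈ O ∧ O ∩ S ⊆ e := by
  obtain ⟨ψ, a, b, h, rfl⟩ := he
  obtain ⟨t, ht, rfl⟩ := hp
  exact hl.exists_isOpen ht (h.cont.mono Ioo_subset_Icc_self) (h.inj.mono Ioo_subset_Ico_self)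
    (h.maps.mono_left Ioo_subset_Icc_self) (h.avoid t ht)

/-- A connected subset of `S` that meets a relatively clopen subset lies in it. -/
theorem IsPreconnected.subset_of_open_of_closed {A B S : Set ℂ} (hA : IsPreconnected A)
    (hAS : A ⊆ S) (hne : (A ∩ B).Nonempty)
    (hopen : ∀ p ∈ A ∩ B, ∃ O : Set ℂ, IsOpen O ∧ p ∈ O ∧ O ∩ S ⊆ B)
    (hcl : A ∩ closure B ⊆ B) : A ⊆ B := by
  set u : Set ℂ := ⋃₀ {O | IsOpen O ∧ O ∩ S ⊆ B}
  have hu : IsOpen u := isOpen_sUnion fun O hO => hO.1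
  have huS : u ∩ S ⊆ B := by
    rintro x ⟨⟨O, hO, hx⟩, hxS⟩
    exact hO.2 ⟨hx, hxS⟩
  have hBu : ∀ p ∈ A, p ∈ B → p ∈ u := fun p hp hpB => by
    obtain ⟨O, hO, hpO, hOS⟩ := hopen p ⟨hp, hpB⟩
    exact ⟨O, ⟨hO, hOS⟩, hpO⟩
  intro x hx
  by_contra hxB
  obtain ⟨p, hp, hpB⟩ := hne
  obtain ⟨y, hy, hyu, hyv⟩ := hA u (closure B)ᶜ hu isClosed_closure.isOpen_compl
    (fun z hz => by
      by_cases hzB : z ∈ B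
      · exact Or.inl (hBu z hz hzB)
      · exact Or.inr fun h => hzB (hcl ⟨hz, h⟩))
    ⟨p, hp, hBu p hp hpB⟩ ⟨x, hx, fun h => hxB (hcl ⟨hx, h⟩)⟩
  exact hyv (subset_closure (huS ⟨hyu, hAS hy⟩))

/-- An edge is relatively open because `S` is locally a line off `U`, and its closure adds only
points of `U`; it is thus clopen in `S \ U`. -/
theorem IsEdge.subset_of_meets (hl : LocallyLine S U) {e A : Set ℂ} (he : IsEdge S U e)
    (hA : IsPreconnected A) (hAS : A ⊆ S \ U) (hne : (A ∩ e).Nonempty) : A ⊆ e := by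
  refine hA.subset_of_open_of_closed (hAS.trans sdiff_subset) hne
    (fun p hp => he.exists_isOpen hl hp.2) ?_
  rintro x ⟨hx, hxe⟩
  exact (he.closure_subset hxe).resolve_right (hAS hx).2

theorem IsEdge.eq_of_meets (hl : LocallyLine S U) {e e' : Set ℂ} (he : IsEdge S U e)
    (he' : IsEdge S U e') (hne : (e ∩ e').Nonempty) : e = e' :=
  Subset.antisymm (he'.subset_of_meets hl he.isPreconnected he.subset hne)
    (he.subset_of_meets hl he'.isPreconnected he'.subset (by rwa [inter_comm]))

theorem Gap.isEdge {ψ : ℝ → ℂ} {a b : ℝ} (h : Gap S U ψ a b) : IsEdge S U (ψ '' Ioo a b) :=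
  ⟨ψ, a, b, h, rfl⟩

/-- The edges contained in a set. -/
def edgesIn (S U A : Set ℂ) : Set (Set ℂ) := {e | IsEdge S U e ∧ e ⊆ A}

theorem Gap.edgesIn_eq (hl : LocallyLine S U) {ψ : ℝ → ℂ} {a b : ℝ} (h : Gap S U ψ a b) :
    edgesIn S U (ψ '' Ioo a b) = {ψ '' Ioo a b} := by
  ext e
  constructor
  · rintro ⟨he, hsub⟩
    exact he.eq_of_meets hl h.isEdge (by rw [inter_eq_left.2 hsub]; exact he.nonempty)
  · rintro rfl
    exact ⟨h.isEdge, le_rfl⟩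

theorem Strand.edgesIn_subset (hl : LocallyLine S U) (hU : U.Finite) {ψ : ℝ → ℂ} {a b : ℝ}
    (h : Strand S U ψ a b) {e : Set ℂ} (he : IsEdge S U e) (hm : (e ∩ ψ '' Icc a b).Nonempty) :
    ∃ a' b', Gap S U ψ a' b' ∧ e = ψ '' Ioo a' b' ∧ a ≤ a' ∧ b' ≤ b := by
  obtain ⟨_, hp, t, ht, rfl⟩ := hm
  obtain ⟨a', b', hg, hm, h1, h2⟩ := h.exists_gap hU t ht (he.subset hp).2
  exact ⟨a', b', hg, he.eq_of_meets hl hg.isEdge ⟨_, hp, t, hm, rfl⟩, h1, h2⟩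

theorem Strand.edgesIn_split (hl : LocallyLine S U) (hU : U.Finite) {ψ : ℝ → ℂ} {a b c : ℝ}
    (h : Strand S U ψ a b) (hc : c ∈ Ioo a b) (hcU : ψ c ∈ U) :
    edgesIn S U (ψ '' Ioo a b) = edgesIn S U (ψ '' Ioo a c) ∪ edgesIn S U (ψ '' Ioo c b) ∧
      Disjoint (edgesIn S U (ψ '' Ioo a c)) (edgesIn S U (ψ '' Ioo c b)) := by
  constructor
  · ext e
    constructor
    · rintro ⟨he, hsub⟩
      obtain ⟨p, hp⟩ := he.nonempty
      obtain ⟨t, ht, rfl⟩ := hsub hp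
      rcases le_total t c with htc | htc
      · obtain ⟨a', b', hg, rfl, h1, h2⟩ := (h.split_left hc hcU).edgesIn_subset hl hU he
          ⟨_, hp, t, ⟨ht.1.le, htc⟩, rfl⟩
        exact Or.inl ⟨he, image_mono (Ioo_subset_Ioo h1 h2)⟩
      · obtain ⟨a', b', hg, rfl, h1, h2⟩ := (h.split_right hc hcU).edgesIn_subset hl hU he
          ⟨_, hp, t, ⟨htc, ht.2.le⟩, rfl⟩
        exact Or.inr ⟨he, image_mono (Ioo_subset_Ioo h1 h2)⟩
    · rintro (⟨he, hsub⟩ | ⟨he, hsub⟩)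
      · exact ⟨he, hsub.trans (image_mono (Ioo_subset_Ioo_right hc.2.le))⟩
      · exact ⟨he, hsub.trans (image_mono (Ioo_subset_Ioo_left hc.1.le))⟩
  · rw [Set.disjoint_left]
    rintro e ⟨he, h1⟩ ⟨-, h2⟩
    obtain ⟨p, hp⟩ := he.nonempty
    obtain ⟨t, ht, rfl⟩ := h1 hp
    obtain ⟨s, hs, hst⟩ := h2 hp
    have := h.inj ⟨hc.1.le.trans hs.1.le, hs.2⟩ ⟨ht.1.le, ht.2.trans hc.2⟩ hst
    linarith [hs.1, ht.2]

/-- The total weight of the edges contained in a set. -/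
def edgeSum (S U : Set ℂ) (w : Set ℂ → ℝ≥0∞) (A : Set ℂ) : ℝ≥0∞ := ∑' e : edgesIn S U A, w e

theorem Gap.edgeSum_eq (hl : LocallyLine S U) {ψ : ℝ → ℂ} {a b : ℝ} (h : Gap S U ψ a b)
    (w : Set ℂ → ℝ≥0∞) : edgeSum S U w (ψ '' Ioo a b) = w (ψ '' Ioo a b) := by
  rw [edgeSum, h.edgesIn_eq hl, tsum_singleton]

theorem Strand.edgeSum_split (hl : LocallyLine S U) (hU : U.Finite) {ψ : ℝ → ℂ} {a b c : ℝ}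
    (h : Strand S U ψ a b) (hc : c ∈ Ioo a b) (hcU : ψ c ∈ U) (w : Set ℂ → ℝ≥0∞) :
    edgeSum S U w (ψ '' Ioo a b) =
      edgeSum S U w (ψ '' Ioo a c) + edgeSum S U w (ψ '' Ioo c b) := by
  obtain ⟨h1, h2⟩ := h.edgesIn_split hl hU hc hcU
  rw [edgeSum, h1]
  exact ENNReal.summable.tsum_union_disjoint h2 ENNReal.summable

/-- Edge sums and variations are both additive at points of `U`, so a comparison on gaps suffices.
-/
theorem Strand.edgeSum_le {Y : Type*} [PseudoMetricSpace Y] (hl : LocallyLine S U)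
    (hU : U.Finite) {ψ : ℝ → ℂ} {g : ℝ → Y} {w : Set ℂ → ℝ≥0∞}
    (hw : ∀ a b, Gap S U ψ a b → w (ψ '' Ioo a b) ≤ eVariationOn g (Icc a b)) {a b : ℝ}
    (h : Strand S U ψ a b) : edgeSum S U w (ψ '' Ioo a b) ≤ eVariationOn g (Icc a b) := by
  refine Strand.induction hU (M := fun a b =>
    edgeSum S U w (ψ '' Ioo a b) ≤ eVariationOn g (Icc a b)) ?_ ?_ h
  · intro a b h; rw [h.edgeSum_eq hl]; exact hw a b h
  · intro a c b h hc hcU h1 h2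
    rw [h.edgeSum_split hl hU hc hcU]
    have := eVariationOn.Icc_add_Icc g (s := univ) hc.1.le hc.2.le (mem_univ c)
    simp only [univ_inter] at this
    rw [← this]
    exact add_le_add h1 h2

theorem Strand.le_edgeSum {Y : Type*} [PseudoMetricSpace Y] (hl : LocallyLine S U)
    (hU : U.Finite) {ψ : ℝ → ℂ} {g : ℝ → Y} {w : Set ℂ → ℝ≥0∞}
    (hw : ∀ a b, Gap S U ψ a b → eVariationOn g (Icc a b) ≤ w (ψ '' Ioo a b)) {a b : ℝ}
    (h : Strand S U ψ a b) : eVariationOn g (Icc a b) ≤ edgeSum S U w (ψ '' Ioo a b) := by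
  refine Strand.induction hU (M := fun a b =>
    eVariationOn g (Icc a b) ≤ edgeSum S U w (ψ '' Ioo a b)) ?_ ?_ h
  · intro a b h; rw [h.edgeSum_eq hl]; exact hw a b h
  · intro a c b h hc hcU h1 h2
    rw [h.edgeSum_split hl hU hc hcU]
    have := eVariationOn.Icc_add_Icc g (s := univ) hc.1.le hc.2.le (mem_univ c)
    simp only [univ_inter] at this
    rw [← this]
    exact add_le_add h1 h2

theorem Strand.finite_edgesIn (hl : LocallyLine S U) (hU : U.Finite) {ψ : ℝ → ℂ} {a b : ℝ}
    (h : Strand S U ψ a b) : (edgesIn S U (ψ '' Ioo a b)).Finite := by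
  refine Strand.induction hU (M := fun a b => (edgesIn S U (ψ '' Ioo a b)).Finite) ?_ ?_ h
  · intro a b h; rw [h.edgesIn_eq hl]; exact finite_singleton _
  · intro a c b h hc hcU h1 h2
    rw [(h.edgesIn_split hl hU hc hcU).1]
    exact h1.union h2

/-- A parametrization of an edge by the unit interval. -/
theorem IsEdge.exists_param {e : Set ℂ} (he : IsEdge S U e) :
    ∃ c : ℝ → ℂ, Gap S U c 0 1 ∧ e = c '' Ioo 0 1 := by
  obtain ⟨ψ, a, b, h, rfl⟩ := he
  have hab : 0 < b - a := sub_pos.2 h.lt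
  have him : ∀ t, (b - a) * t + a = t * (b - a) + a := fun t => by ring
  have m1 : MapsTo (fun t : ℝ => (b - a) * t + a) (Icc 0 1) (Icc a b) := fun t ht =>
    ⟨by nlinarith [ht.1], by nlinarith [ht.2]⟩
  have m2 : MapsTo (fun t : ℝ => (b - a) * t + a) (Ico 0 1) (Ico a b) := fun t ht =>
    ⟨by nlinarith [ht.1], by nlinarith [ht.2]⟩
  have m3 : (fun t : ℝ => (b - a) * t + a) '' (Ioo 0 1) = Ioo a b := by
    rw [image_affine_Ioo hab]; simp
  have hinj : Function.Injective (fun t : ℝ => (b - a) * t + a) := fun s t hst => by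
    simp only [add_left_inj] at hst
    exact mul_left_cancel₀ hab.ne' hst
  refine ⟨ψ ∘ fun t => (b - a) * t + a, ⟨⟨one_pos, ?_, ?_, ?_, ?_, ?_⟩, ?_⟩, ?_⟩
  · exact h.cont.comp (by fun_prop) m1
  · exact h.inj.comp hinj.injOn m2
  · exact h.maps.comp m1
  · simpa using h.left
  · simpa using h.right
  · intro t ht
    exact h.avoid _ (m3.subset ⟨t, ht, rfl⟩)
  · rw [image_comp, m3]

open Classical in
/-- A chosen parametrization of an edge by the unit interval. -/
def param (S U e : Set ℂ) : ℝ → ℂ :=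
  if h : IsEdge S U e then h.exists_param.choose else fun _ => 0

theorem IsEdge.gap_param {e : Set ℂ} (he : IsEdge S U e) : Gap S U (param S U e) 0 1 := by
  rw [param, dif_pos he]; exact he.exists_param.choose_spec.1

theorem IsEdge.eq_param {e : Set ℂ} (he : IsEdge S U e) : e = param S U e '' Ioo 0 1 := by
  conv_lhs => rw [he.exists_param.choose_spec.2]
  rw [param, dif_pos he]

/-- The length of an edge when its end points are mapped by `q`. -/
def endDist {Y : Type*} [PseudoMetricSpace Y] (S U : Set ℂ) (q : ℂ → Y) (e : Set ℂ) : ℝ≥0∞ :=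
  edist (q (param S U e 0)) (q (param S U e 1))

theorem Gap.pair_eq {ψ : ℝ → ℂ} {a b : ℝ} (h : Gap S U ψ a b) :
    ({param S U (ψ '' Ioo a b) 0, param S U (ψ '' Ioo a b) 1} : Set ℂ) = {ψ a, ψ b} := by
  have h1 := h.isEdge.gap_param.closure_inter
  rw [← h.isEdge.eq_param] at h1
  rw [← h1, h.closure_inter]

theorem Gap.endDist_eq {Y : Type*} [PseudoMetricSpace Y] {ψ : ℝ → ℂ} {a b : ℝ}
    (h : Gap S U ψ a b) (q : ℂ → Y) :
    endDist S U q (ψ '' Ioo a b) = edist (q (ψ a)) (q (ψ b)) := by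
  rcases Set.pair_eq_pair_iff.1 h.pair_eq with ⟨h1, h2⟩ | ⟨h1, h2⟩
  · rw [endDist, h1, h2]
  · rw [endDist, h1, h2, edist_comm]

/-- Distinct edges are disjoint and end in `U`, so the prescriptions are compatible. Continuity is
pasted over finitely many closed sets: the arcs and `U` itself. -/
theorem exists_glue {Y : Type*} [TopologicalSpace Y] (hl : LocallyLine S U) (hU : U.Finite)
    (hE : {e | IsEdge S U e}.Finite) (hcov : ∀ p ∈ S, p ∉ U → ∃ e, IsEdge S U e ∧ p ∈ e)
    (q : ℂ → Y) (γ : Set ℂ → ℝ → Y)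
    (hγ : ∀ e, IsEdge S U e → ContinuousOn (γ e) (Icc 0 1) ∧ γ e 0 = q (param S U e 0) ∧
      γ e 1 = q (param S U e 1)) :
    ∃ f : ℂ → Y, ContinuousOn f S ∧ (∀ p ∈ U, f p = q p) ∧
      ∀ e, IsEdge S U e → ∀ t ∈ Icc (0 : ℝ) 1, f (param S U e t) = γ e t := by
  classical
  have key : ∀ p, ∃ y : Y, (p ∈ U → y = q p) ∧
      (∀ e, IsEdge S U e → ∀ t ∈ Ioo (0 : ℝ) 1, param S U e t = p → y = γ e t) := by
    intro p
    by_cases hp : p ∈ U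
    · refine ⟨q p, fun _ => rfl, fun e he t ht hpt => ?_⟩
      exact absurd (hpt ▸ hp) (he.gap_param.avoid t ht)
    · by_cases h : ∃ e, IsEdge S U e ∧ ∃ t ∈ Ioo (0 : ℝ) 1, param S U e t = p
      · obtain ⟨e, he, t, ht, rfl⟩ := h
        refine ⟨γ e t, fun h => absurd h hp, fun e' he' t' ht' hpt => ?_⟩
        have : e = e' := he.eq_of_meets hl he' ⟨param S U e t,
          he.eq_param.symm.subset ⟨t, ht, rfl⟩, he'.eq_param.symm.subset ⟨t', ht', hpt⟩⟩
        subst this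
        rw [he.gap_param.inj (Ioo_subset_Ico_self ht') (Ioo_subset_Ico_self ht) hpt]
      · exact ⟨q p, fun _ => rfl, fun e he t ht hpt => absurd ⟨e, he, t, ht, hpt⟩ h⟩
  choose f hf1 hf2 using key
  have hfp : ∀ e, IsEdge S U e → ∀ t ∈ Icc (0 : ℝ) 1, f (param S U e t) = γ e t := by
    intro e he t ht
    rcases eq_endpoints_or_mem_Ioo_of_mem_Icc ht with rfl | rfl | ht
    · rw [hf1 _ he.gap_param.left, (hγ e he).2.1]
    · rw [hf1 _ he.gap_param.right, (hγ e he).2.2]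
    · exact hf2 _ e he t ht rfl
  refine ⟨f, ?_, fun p hp => hf1 p hp, hfp⟩
  have hsub : S ⊆ U ∪ ⋃ e : {e | IsEdge S U e}, param S U e '' Icc 0 1 := by
    intro p hp
    by_cases hpU : p ∈ U
    · exact Or.inl hpU
    · obtain ⟨e, he, hpe⟩ := hcov p hp hpU
      refine Or.inr (mem_iUnion.2 ⟨⟨e, he⟩, ?_⟩)
      rw [he.eq_param] at hpe
      exact image_mono Ioo_subset_Icc_self hpe
  have := hE.to_subtype
  have hcl : ∀ e : {e | IsEdge S U e}, IsClosed (param S U e '' Icc 0 1) := fun e =>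
    (isCompact_Icc.image_of_continuousOn e.2.gap_param.cont).isClosed
  refine ContinuousOn.mono ?_ hsub
  refine ContinuousOn.union_of_isClosed (hU.continuousOn _)
    ((locallyFinite_of_finite _).continuousOn_iUnion hcl fun e => ?_) hU.isClosed
    (isClosed_iUnion_of_finite hcl)
  exact ContinuousOn.of_comp_image isCompact_Icc e.2.gap_param.cont
    ((hγ e e.2).1.congr fun t ht => hfp e e.2 t ht)

end Edges

end

noncomputable section

/-! ### Geodesics and periodic curves -/

theorem eVariationOn_le_of_dist_eq {Y : Type*} [PseudoMetricSpace Y] {γ : ℝ → Y} {D : ℝ}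
    (hD : 0 ≤ D) (h : ∀ s ∈ Icc (0 : ℝ) 1, ∀ t ∈ Icc (0 : ℝ) 1, dist (γ s) (γ t) = |s - t| * D) :
    eVariationOn γ (Icc 0 1) ≤ ENNReal.ofReal D := by
  have hL : LipschitzOnWith D.toNNReal γ (Icc 0 1) := by
    apply LipschitzOnWith.of_dist_le_mul
    intro s hs t ht
    rw [h s hs t ht, Real.coe_toNNReal D hD, Real.dist_eq, mul_comm]
  have h1 := hL.comp_eVariationOn_le (g := id) (s := Icc (0 : ℝ) 1) (mapsTo_id _)
  have h2 := (monotoneOn_id (s := Icc (0 : ℝ) 1)).eVariationOn_eq (a := 0) (b := 1)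
    (by simp) (by simp)
  simp only [inter_self, id, sub_zero, ENNReal.ofReal_one] at h2
  calc _ ≤ (D.toNNReal : ℝ≥0∞) * eVariationOn id (Icc (0 : ℝ) 1) := h1
    _ = D.toNNReal * 1 := by rw [← h2]
    _ = ENNReal.ofReal D := by rw [mul_one]; rfl

theorem IsGeodesicSpace.exists_segment {Y : Type*} [MetricSpace Y] (hY : IsGeodesicSpace Y)
    (x y : Y) : ∃ γ : ℝ → Y, γ 0 = x ∧ γ 1 = y ∧
      ∀ s ∈ Icc (0 : ℝ) 1, ∀ t ∈ Icc (0 : ℝ) 1, dist (γ s) (γ t) = |s - t| * dist x y := by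
  obtain ⟨c, h0, h1, h⟩ := hY x y
  have hm : ∀ s ∈ Icc (0 : ℝ) 1, s * dist x y ∈ Icc 0 (dist x y) := fun s hs =>
    ⟨mul_nonneg hs.1 dist_nonneg, mul_le_of_le_one_left dist_nonneg hs.2⟩
  refine ⟨fun s => c (s * dist x y), by simpa using h0, by simpa using h1, fun s hs t ht => ?_⟩
  rw [h _ (hm s hs) _ (hm t ht), ← sub_mul, abs_mul, abs_of_nonneg (dist_nonneg (x := x))]

theorem continuousOn_of_dist_eq {Y : Type*} [PseudoMetricSpace Y] {γ : ℝ → Y} {D : ℝ}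
    (hD : 0 ≤ D) (h : ∀ s ∈ Icc (0 : ℝ) 1, ∀ t ∈ Icc (0 : ℝ) 1, dist (γ s) (γ t) = |s - t| * D) :
    ContinuousOn γ (Icc 0 1) := by
  have hL : LipschitzOnWith D.toNNReal γ (Icc 0 1) := by
    apply LipschitzOnWith.of_dist_le_mul
    intro s hs t ht
    rw [h s hs t ht, Real.coe_toNNReal D hD, Real.dist_eq, mul_comm]
  exact hL.continuousOn

theorem eVariationOn_translate {Y : Type*} [PseudoMetricSpace Y] {g : ℝ → Y} {T : ℝ}
    (hg : Function.Periodic g T) (a b : ℝ) :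
    eVariationOn g (Icc (a + T) (b + T)) = eVariationOn g (Icc a b) := by
  have h := eVariationOn.comp_eq_of_monotoneOn g (t := Icc a b) (fun t => t + T)
    (fun s _ t _ hst => by simpa using hst)
  rw [image_add_const_Icc] at h
  rw [← h]
  congr 1
  exact funext fun t => hg t

/-- Used to open a closed curve at a point of a net rather than at parameter 0. -/
theorem eVariationOn_period {Y : Type*} [PseudoMetricSpace Y] {g : ℝ → Y} {T a : ℝ}
    (hg : Function.Periodic g T) (ha : a ∈ Ico 0 T) :
    eVariationOn g (Icc 0 T) = eVariationOn g (Icc a (a + T)) := by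
  have h1 := eVariationOn.Icc_add_Icc g (s := univ) ha.1 ha.2.le (mem_univ a)
  have h2 := eVariationOn.Icc_add_Icc g (s := univ) ha.2.le
    (show T ≤ a + T by linarith [ha.1]) (mem_univ T)
  have h3 := eVariationOn_translate hg 0 a
  simp only [univ_inter] at h1 h2
  rw [zero_add] at h3
  rw [← h1, ← h2, h3, add_comm]

/-! ### The skeleton of a tiling -/

namespace DiscTiling

variable {k : ℕ} (P : DiscTiling k)

/-- The unit circle and the boundary circles of the tiles, as periodic curves. -/
def circ : Option (Fin k) → ℝ → ℂ
  | none => circlePt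
  | some i => P.chart i ∘ circlePt

theorem continuous_circ (i : Option (Fin k)) : Continuous (P.circ i) := by
  cases i with
  | none => exact continuous_circlePt
  | some i =>
    exact (P.continuousOn i).comp_continuous continuous_circlePt fun t =>
      sphere_subset_closedBall (circlePt_mem_sphere t)

theorem periodic_circ (i : Option (Fin k)) : Function.Periodic (P.circ i) (2 * Real.pi) := by
  intro t
  cases i with
  | none => exact circlePt_add_two_pi t
  | some i => simp only [circ, Function.comp_apply, circlePt_add_two_pi]

theorem injOn_circ (i : Option (Fin k)) (a : ℝ) : InjOn (P.circ i) (Ico a (a + 2 * Real.pi)) := by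
  cases i with
  | none => exact circlePt_injOn a
  | some i =>
    exact (P.injOn i).comp (circlePt_injOn a) fun t _ =>
      sphere_subset_closedBall (circlePt_mem_sphere t)

/-- The image of a boundary circle. -/
def circle (i : Option (Fin k)) : Set ℂ := range (P.circ i)

theorem range_circlePt : range circlePt = sphere (0 : ℂ) 1 := by
  apply Subset.antisymm
  · rintro _ ⟨t, rfl⟩; exact circlePt_mem_sphere t
  · intro z hz
    obtain ⟨t, -, h⟩ := exists_circlePt_eq 0 (z := z) (by simpa using hz)
    exact ⟨t, h⟩

theorem circle_none : P.circle none = sphere 0 1 := range_circlePt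

theorem circle_some (i : Fin k) : P.circle (some i) = P.bdry i := by
  rw [circle, circ, range_comp, range_circlePt, bdry]

theorem circle_subset (i : Option (Fin k)) : P.circle i ⊆ P.skeleton := by
  cases i with
  | none => rw [circle_none]; exact P.sphere_subset
  | some i => rw [circle_some]; exact subset_iUnion P.bdry i

theorem circle_eq_image (i : Option (Fin k)) (a : ℝ) :
    P.circle i = P.circ i '' Icc a (a + 2 * Real.pi) :=
  ((P.periodic_circ i).image_Icc Real.two_pi_pos a).symm

theorem isCompact_circle (i : Option (Fin k)) : IsCompact (P.circle i) := by
  rw [P.circle_eq_image i 0]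
  exact isCompact_Icc.image (P.continuous_circ i)

theorem isPreconnected_circle (i : Option (Fin k)) : IsPreconnected (P.circle i) :=
  isPreconnected_range (P.continuous_circ i)

theorem isCompact_skeleton : IsCompact P.skeleton :=
  isCompact_iUnion fun i => P.circle_some i ▸ P.isCompact_circle _

theorem locallyLine {U : Set ℂ} (hU : P.vertices ⊆ U) : LocallyLine P.skeleton U := by
  intro p hp hpU
  by_contra h
  push Not at h
  exact hpU (hU ⟨hp, fun O hO hpO => h O hO hpO⟩)

theorem exists_isOpen_circle {i : Option (Fin k)} {p : ℂ} (hp : p ∈ P.circle i)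
    (hpV : p ∉ P.vertices) : ∃ O : Set ℂ, IsOpen O ∧ p ∈ O ∧ O ∩ P.skeleton ⊆ P.circle i := by
  obtain ⟨t, rfl⟩ := hp
  have hpi := Real.pi_pos
  have hsub : Ioo (t - Real.pi) (t + Real.pi) ⊆ Ico (t - Real.pi) (t - Real.pi + 2 * Real.pi) :=
    fun s hs => ⟨hs.1.le, by linarith [hs.2]⟩
  obtain ⟨O, hO, hpO, h⟩ := (P.locallyLine le_rfl).exists_isOpen (ψ := P.circ i)
    (a := t - Real.pi) (b := t + Real.pi) ⟨by linarith, by linarith⟩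
    (P.continuous_circ i).continuousOn ((P.injOn_circ i _).mono hsub)
    (fun s _ => P.circle_subset i ⟨s, rfl⟩) hpV
  exact ⟨O, hO, hpO, h.trans (image_subset_range _ _)⟩

/-- Each circle is closed and, off the vertices, relatively open in the skeleton, so a connected set
avoiding the vertices cannot leave it. -/
theorem subset_circle {A : Set ℂ} (hA : IsPreconnected A) (hAS : A ⊆ P.skeleton \ P.vertices)
    {i : Option (Fin k)} (hne : (A ∩ P.circle i).Nonempty) : A ⊆ P.circle i := by
  refine hA.subset_of_open_of_closed (hAS.trans sdiff_subset) hne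
    (fun p hp => P.exists_isOpen_circle hp.2 (hAS hp.1).2) ?_
  rw [(P.isCompact_circle i).isClosed.closure_eq]
  exact inter_subset_right

theorem isClosed_tile (i : Fin k) : IsClosed (P.chart i '' closedBall 0 1) :=
  ((isCompact_closedBall 0 1).image_of_continuousOn (P.continuousOn i)).isClosed

/-- If some tile were unreachable, the reachable and the unreachable tiles would form two nonempty
closed sets covering the connected disc. A common point lies on the boundaries of one tile of each
kind, which makes the second reachable. -/
theorem reflTransGen (i j : Fin k) :
    Relation.ReflTransGen (fun i j => (P.bdry i ∩ P.bdry j).Nonempty) i j := by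
  by_contra hj
  set R : Fin k → Prop :=
    fun j => Relation.ReflTransGen (fun i j => (P.bdry i ∩ P.bdry j).Nonempty) i j
  have hR : ∀ j : Fin k, P.chart j 0 ∈ P.chart j '' closedBall 0 1 := fun j =>
    ⟨0, by simp, rfl⟩
  have hsub : ∀ j : Fin k, P.chart j '' closedBall 0 1 ⊆ closedBall 0 1 := fun j => by
    refine Subset.trans ?_ P.cover.subset
    exact subset_iUnion (fun i => P.chart i '' closedBall 0 1) j
  obtain ⟨p, -, hpA, hpB⟩ := isPreconnected_closed_iff.1
    (convex_closedBall (0 : ℂ) 1).isPreconnected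
    (⋃ j : {j // R j}, P.chart j '' closedBall 0 1)
    (⋃ j : {j // ¬ R j}, P.chart j '' closedBall 0 1)
    (isClosed_iUnion_of_finite fun j => P.isClosed_tile j)
    (isClosed_iUnion_of_finite fun j => P.isClosed_tile j)
    (by
      intro z hz
      rw [← P.cover] at hz
      obtain ⟨j, hj⟩ := mem_iUnion.1 hz
      by_cases h : R j
      · exact Or.inl (mem_iUnion.2 ⟨⟨j, h⟩, hj⟩)
      · exact Or.inr (mem_iUnion.2 ⟨⟨j, h⟩, hj⟩))
    ⟨_, hsub i (hR i), mem_iUnion.2 ⟨⟨i, Relation.ReflTransGen.refl⟩, hR i⟩⟩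
    ⟨_, hsub j (hR j), mem_iUnion.2 ⟨⟨j, hj⟩, hR j⟩⟩
  obtain ⟨⟨l, hl⟩, hpl⟩ := mem_iUnion.1 hpA
  obtain ⟨⟨m, hm⟩, hpm⟩ := mem_iUnion.1 hpB
  have hlm : l ≠ m := fun h => hm (h ▸ hl)
  have hp : p ∈ P.bdry l ∩ P.bdry m := by
    have := (P.inter_eq l m hlm).subset ⟨hpl, hpm⟩
    exact this
  exact hm (Relation.ReflTransGen.tail hl ⟨p, hp⟩)

theorem isPreconnected_skeleton : IsPreconnected P.skeleton :=
  IsPreconnected.iUnion_of_reflTransGen (fun i => P.circle_some i ▸ P.isPreconnected_circle _)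
    P.reflTransGen

/-- A path without repetition in the adjacency graph of the tiles visits at most `k` of them, and
the image moves by at most `δ` along each. -/
theorem dist_le_of_bdry {Y : Type*} [PseudoMetricSpace Y] {f : ℂ → Y} {δ : ℝ}
    (h : ∀ i, ∀ p ∈ P.bdry i, ∀ q ∈ P.bdry i, dist (f p) (f q) ≤ δ) :
    ∀ p ∈ P.skeleton, ∀ q ∈ P.skeleton, dist (f p) (f q) ≤ k * δ := by
  classical
  intro p hp q hq
  obtain ⟨i, hi⟩ := mem_iUnion.1 hp
  obtain ⟨j, hj⟩ := mem_iUnion.1 hq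
  have hδ : 0 ≤ δ := dist_nonneg.trans (h i p hi p hi)
  let G : SimpleGraph (Fin k) :=
    SimpleGraph.fromRel fun i j => (P.bdry i ∩ P.bdry j).Nonempty
  have hreach : ∀ {j}, Relation.ReflTransGen (fun i j => (P.bdry i ∩ P.bdry j).Nonempty) i j →
      G.Reachable i j := by
    intro j h
    induction h with
    | refl => exact SimpleGraph.Reachable.refl _
    | @tail l m _ hlm ih =>
      by_cases hne : l = m
      · exact hne ▸ ih
      · exact ih.trans (SimpleGraph.Adj.reachable
          ((SimpleGraph.fromRel_adj _ _ _).2 ⟨hne, Or.inl hlm⟩))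
  obtain ⟨w⟩ := hreach (P.reflTransGen i j)
  have key : ∀ {i j : Fin k} (w : G.Walk i j), ∀ p ∈ P.bdry i, ∀ q ∈ P.bdry j,
      dist (f p) (f q) ≤ (w.length + 1 : ℕ) * δ := by
    intro i j w
    induction w with
    | nil => intro p hp q hq; simpa using h _ p hp q hq
    | cons hadj w ih =>
      intro p hp q hq
      obtain ⟨-, hne⟩ := (SimpleGraph.fromRel_adj _ _ _).1 hadj
      obtain ⟨x, hx1, hx2⟩ : (P.bdry _ ∩ P.bdry _).Nonempty := by
        rcases hne with hne | hne
        · exact hne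
        · rwa [inter_comm]
      have h1 := h _ p hp x hx1
      have h2 := ih x hx2 q hq
      have h3 := dist_triangle (f p) (f x) (f q)
      rw [SimpleGraph.Walk.length_cons]
      push_cast at h2 ⊢
      linarith
  have hlen := w.bypass_isPath.length_lt
  rw [Fintype.card_fin] at hlen
  refine (key w.bypass p hi q hj).trans (mul_le_mul_of_nonneg_right ?_ hδ)
  exact_mod_cast hlen

/-! ### Nets of points on the skeleton -/

section Net

variable {P} {U : Set ℂ}

/-- A finite set of points of the skeleton that contains the vertices and the point `1`. -/
structure IsNet (P : DiscTiling k) (U : Set ℂ) : Prop where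
  finite : U.Finite
  subset : U ⊆ P.skeleton
  vertices_subset : P.vertices ⊆ U
  one_mem : 1 ∈ U

namespace IsNet

theorem locallyLine (hU : P.IsNet U) : LocallyLine P.skeleton U :=
  P.locallyLine hU.vertices_subset

/-- A circle missing `U` would contain no vertex, hence be clopen in the connected skeleton and
equal to it; but the skeleton contains the point 1 of `U`. This is why a net is required to contain
1. -/
theorem circle_meets (hU : P.IsNet U) (i : Option (Fin k)) : ∃ t, P.circ i t ∈ U := by
  by_contra h
  push Not at h
  have hsub : P.skeleton ⊆ P.circle i := by
    refine P.isPreconnected_skeleton.subset_of_open_of_closed le_rfl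
      ⟨P.circ i 0, P.circle_subset i ⟨0, rfl⟩, 0, rfl⟩ (fun p hp => ?_) ?_
    · obtain ⟨t, rfl⟩ := hp.2
      exact P.exists_isOpen_circle ⟨t, rfl⟩ fun hv => h t (hU.vertices_subset hv)
    · rw [(P.isCompact_circle i).isClosed.closure_eq]
      exact inter_subset_right
  obtain ⟨t, ht⟩ := hsub (hU.subset hU.one_mem)
  exact h t (ht ▸ hU.one_mem)

theorem exists_strand (hU : P.IsNet U) (i : Option (Fin k)) :
    ∃ a ∈ Ico 0 (2 * Real.pi), Strand P.skeleton U (P.circ i) a (a + 2 * Real.pi) := by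
  obtain ⟨t, ht⟩ := hU.circle_meets i
  obtain ⟨a, ha, hta⟩ := (P.periodic_circ i).exists_mem_Ico₀ Real.two_pi_pos t
  refine ⟨a, ha, by linarith [Real.two_pi_pos], (P.continuous_circ i).continuousOn,
    P.injOn_circ i a, fun t _ => P.circle_subset i ⟨t, rfl⟩, hta ▸ ht, ?_⟩
  rw [P.periodic_circ i a, ← hta]; exact ht

theorem edgesIn_circle {i : Option (Fin k)} {a : ℝ}
    (h : Strand P.skeleton U (P.circ i) a (a + 2 * Real.pi)) :
    edgesIn P.skeleton U (P.circle i) =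
      edgesIn P.skeleton U (P.circ i '' Ioo a (a + 2 * Real.pi)) := by
  ext e
  refine and_congr_right fun he => ⟨fun hs x hx => ?_, fun hs => hs.trans (image_subset_range _ _)⟩
  have hx' := hs hx
  rw [P.circle_eq_image i a] at hx'
  obtain ⟨t, ht, rfl⟩ := hx'
  rcases eq_endpoints_or_mem_Ioo_of_mem_Icc ht with rfl | rfl | ht
  · exact absurd h.left (he.subset hx).2
  · exact absurd h.right (he.subset hx).2
  · exact ⟨t, ht, rfl⟩

theorem edgeSum_circle {i : Option (Fin k)} {a : ℝ}
    (h : Strand P.skeleton U (P.circ i) a (a + 2 * Real.pi)) (w : Set ℂ → ℝ≥0∞) :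
    edgeSum P.skeleton U w (P.circle i) =
      edgeSum P.skeleton U w (P.circ i '' Ioo a (a + 2 * Real.pi)) := by
  rw [edgeSum, edgesIn_circle h, edgeSum]

theorem exists_edge (hU : P.IsNet U) {p : ℂ} (hp : p ∈ P.skeleton) (hpU : p ∉ U) :
    ∃ e, IsEdge P.skeleton U e ∧ p ∈ e := by
  obtain ⟨i, hi⟩ := mem_iUnion.1 hp
  rw [← P.circle_some] at hi
  obtain ⟨a, -, h⟩ := hU.exists_strand (some i)
  rw [P.circle_eq_image _ a] at hi
  obtain ⟨t, ht, rfl⟩ := hi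
  obtain ⟨a', b', hg, hm, -, -⟩ := h.exists_gap hU.finite t ht hpU
  exact ⟨_, hg.isEdge, t, hm, rfl⟩

theorem finite_edges (hU : P.IsNet U) : {e | IsEdge P.skeleton U e}.Finite := by
  have : ∀ i : Fin k, (edgesIn P.skeleton U (P.circle (some i))).Finite := by
    intro i
    obtain ⟨a, -, h⟩ := hU.exists_strand (some i)
    rw [edgesIn_circle h]
    exact h.finite_edgesIn hU.locallyLine hU.finite
  refine (finite_iUnion this).subset fun e he => ?_
  obtain ⟨p, hp⟩ := IsEdge.nonempty he
  obtain ⟨i, hi⟩ := mem_iUnion.1 (IsEdge.subset he hp).1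
  refine mem_iUnion.2 ⟨i, he, P.subset_circle (IsEdge.isPreconnected he) ?_ ⟨p, hp, ?_⟩⟩
  · exact (IsEdge.subset he).trans (sdiff_subset_sdiff_right hU.vertices_subset)
  · rw [circle_some]; exact hi

end IsNet

end Net

end DiscTiling

/-! ### Geodesic maps on the skeleton -/

/-- The change of parameter is `c⁻¹ ∘ ψ`, continuous because small subarcs of `c` are relatively
open in `S`. -/
theorem Gap.exists_continuousOn_reparam {S U : Set ℂ} (hl : LocallyLine S U) {ψ c : ℝ → ℂ}
    {a b a' b' : ℝ} (h : Gap S U ψ a b) (hc : Gap S U c a' b')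
    (he : ψ '' Ioo a b = c '' Ioo a' b') :
    ∃ τ : ℝ → ℝ, ContinuousOn τ (Ioo a b) ∧ InjOn τ (Ioo a b) ∧ MapsTo τ (Ioo a b) (Ioo a' b') ∧
      ∀ t ∈ Ioo a b, c (τ t) = ψ t := by
  have key : ∀ t ∈ Ioo a b, ∃ s ∈ Ioo a' b', c s = ψ t := fun t ht => he.subset ⟨t, ht, rfl⟩
  choose! τ hτ hcτ using key
  have hci : InjOn c (Ioo a' b') := hc.inj.mono Ioo_subset_Ico_self
  refine ⟨τ, ?_, ?_, hτ, hcτ⟩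
  · intro t ht
    rw [ContinuousWithinAt, Metric.tendsto_nhds]
    intro ε hε
    have hτt := hτ t ht
    have hsub : Ioo (max a' (τ t - ε)) (min b' (τ t + ε)) ⊆ Ioo a' b' := fun s hs =>
      ⟨(le_max_left _ _).trans_lt hs.1, hs.2.trans_le (min_le_left _ _)⟩
    obtain ⟨O, hO, htO, hOS⟩ := hl.exists_isOpen (ψ := c)
      (a := max a' (τ t - ε)) (b := min b' (τ t + ε)) (t := τ t)
      ⟨max_lt hτt.1 (by linarith), lt_min hτt.2 (by linarith)⟩
      (hc.cont.mono (hsub.trans Ioo_subset_Icc_self)) (hci.mono hsub)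
      (hc.maps.mono_left (hsub.trans Ioo_subset_Icc_self)) (hc.avoid _ hτt)
    rw [hcτ t ht] at htO
    have hcw : ContinuousWithinAt ψ (Ioo a b) t :=
      (h.cont t (Ioo_subset_Icc_self ht)).mono Ioo_subset_Icc_self
    filter_upwards [hcw.eventually (hO.mem_nhds htO), self_mem_nhdsWithin] with s hs hs'
    obtain ⟨r, hr, hrs⟩ := hOS ⟨hs, h.maps (Ioo_subset_Icc_self hs')⟩
    have : τ s = r := hci (hτ s hs') (hsub hr) (by rw [hcτ s hs', hrs])
    rw [this, Real.dist_eq, abs_lt]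
    have h1 := (le_max_right a' (τ t - ε)).trans_lt hr.1
    have h2 := hr.2.trans_le (min_le_right b' (τ t + ε))
    constructor <;> linarith
  · intro s hs t ht hst
    have := hcτ s hs
    rw [hst, hcτ t ht] at this
    exact h.inj (Ioo_subset_Ico_self hs) (Ioo_subset_Ico_self ht) this.symm

/-- Each edge is sent to a geodesic through its chosen parametrization. Any other parametrization
differs by a monotone change of variable, which does not increase variation; additivity then gives
strands, and every circle is a strand once opened at a point of the net. -/
theorem DiscTiling.IsNet.exists_geodesic_map {k : ℕ} {P : DiscTiling k} {U : Set ℂ}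
    (hU : P.IsNet U) {Y : Type*} [MetricSpace Y] (hY : IsGeodesicSpace Y) (q : ℂ → Y) :
    ∃ f : ℂ → Y, ContinuousOn f P.skeleton ∧ (∀ p ∈ U, f p = q p) ∧
      (∀ ψ a b, Strand P.skeleton U ψ a b → eVariationOn (f ∘ ψ) (Icc a b) ≤
        edgeSum P.skeleton U (endDist P.skeleton U q) (ψ '' Ioo a b)) ∧
      ∀ i, eVariationOn (f ∘ P.circ i) (Icc 0 (2 * Real.pi)) ≤
        edgeSum P.skeleton U (endDist P.skeleton U q) (P.circle i) := by
  set S := P.skeleton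
  choose γ hγ0 hγ1 hγ using fun e : Set ℂ => hY.exists_segment (q (param S U e 0)) (q (param S U e 1))
  obtain ⟨f, hf, hfU, hfe⟩ := exists_glue hU.locallyLine hU.finite hU.finite_edges
    (fun p hp hpU => hU.exists_edge hp hpU) q γ
    fun e _ => ⟨continuousOn_of_dist_eq dist_nonneg (hγ e), hγ0 e, hγ1 e⟩
  have hstrand : ∀ ψ a b, Strand S U ψ a b → eVariationOn (f ∘ ψ) (Icc a b) ≤
      edgeSum S U (endDist S U q) (ψ '' Ioo a b) := by
    intro ψ a b h
    refine h.le_edgeSum hU.locallyLine hU.finite (fun a b h => ?_)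
    -- The change of parameter exists only on the open interval; by continuity the end points do not
    -- affect the variation.
    rw [← eVariationOn_Ioo_eq_Icc h.lt (hf.comp h.cont h.maps)]
    set e := ψ '' Ioo a b with he
    obtain ⟨τ, hτc, hτi, hτm, hτ⟩ := h.exists_continuousOn_reparam hU.locallyLine
      h.isEdge.gap_param h.isEdge.eq_param
    have heq : EqOn (f ∘ ψ) (γ e ∘ τ) (Ioo a b) := by
      intro t ht
      simp only [Function.comp_apply]
      rw [← hτ t ht, hfe e h.isEdge _ (Ioo_subset_Icc_self (hτm ht))]
    rw [eVariationOn.congr heq, endDist, edist_dist]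
    refine le_trans ?_ (eVariationOn_le_of_dist_eq dist_nonneg (hγ e))
    have hτm' : MapsTo τ (Ioo a b) (Icc 0 1) := fun t ht => Ioo_subset_Icc_self (hτm ht)
    rcases hτc.strictMonoOn_of_injOn_Ioo h.lt hτi with hm | hm
    · exact eVariationOn.comp_le_of_monotoneOn _ _ hm.monotoneOn hτm'
    · exact eVariationOn.comp_le_of_antitoneOn _ _ hm.antitoneOn hτm'
  refine ⟨f, hf, hfU, hstrand, fun i => ?_⟩
  obtain ⟨a, ha, h⟩ := hU.exists_strand i
  rw [eVariationOn_period ((P.periodic_circ i).comp f) ha, DiscTiling.IsNet.edgeSum_circle h]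
  exact hstrand _ _ _ h

end

noncomputable section

/-! ### Lifting circle-valued maps -/

theorem exists_lift_circle {A : Type*} [TopologicalSpace A] [SimplyConnectedSpace A]
    [LocallyPathConnectedSpace A] {g : A → Circle} (hg : Continuous g) :
    ∃ θ : A → ℝ, Continuous θ ∧ ∀ t, Circle.exp (θ t) = g t := by
  obtain ⟨a⟩ : Nonempty A := inferInstance
  obtain ⟨F, ⟨-, hF⟩, -⟩ := Circle.isCoveringMap_exp.existsUnique_continuousMap_lifts
    ⟨g, hg⟩ a (Complex.arg (g a)) (Circle.exp_arg (g a))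
  exact ⟨F, F.continuous, fun t => congrFun hF t⟩

/-- The radial retraction makes the map global, so that the lifting criterion can be applied to the
whole plane. -/
theorem exists_lift_closedBall {g : ℂ → Circle} (hg : ContinuousOn g (closedBall 0 1)) :
    ∃ θ : ℂ → ℝ, ContinuousOn θ (closedBall 0 1) ∧
      ∀ z ∈ closedBall (0 : ℂ) 1, Circle.exp (θ z) = g z := by
  let r : ℂ → ℂ := fun z => z / (max 1 ‖z‖ : ℝ)
  have hpos : ∀ z : ℂ, 0 < max 1 ‖z‖ := fun z => lt_max_of_lt_left one_pos
  have hr : Continuous r := by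
    refine continuous_id.div (Complex.continuous_ofReal.comp (by fun_prop)) fun z => ?_
    exact Complex.ofReal_ne_zero.2 (hpos z).ne'
  have hrm : ∀ z, r z ∈ closedBall (0 : ℂ) 1 := fun z => by
    rw [mem_closedBall_zero_iff]
    show ‖z / (max 1 ‖z‖ : ℝ)‖ ≤ 1
    rw [norm_div, Complex.norm_real, Real.norm_of_nonneg (hpos z).le, div_le_one (hpos z)]
    exact le_max_right _ _
  obtain ⟨θ, hθ, h⟩ := exists_lift_circle (hg.comp_continuous hr hrm)
  refine ⟨θ, hθ.continuousOn, fun z hz => ?_⟩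
  rw [mem_closedBall_zero_iff] at hz
  rw [h, Function.comp_apply, show r z = z by simp [r, max_eq_left hz]]

theorem Circle.exp_finset_sum {ι : Type*} (s : Finset ι) (f : ι → ℝ) :
    Circle.exp (∑ i ∈ s, f i) = ∏ i ∈ s, Circle.exp (f i) := by
  classical
  induction s using Finset.induction_on with
  | empty => simp
  | insert a s ha ih => rw [Finset.sum_insert ha, Finset.prod_insert ha, Circle.exp_add, ih]

theorem exists_continuousOn_sphere {Y : Type*} [TopologicalSpace Y] {η : ℝ → Y}
    (hη : ContinuousOn η (Icc 0 (2 * Real.pi))) (h : η 0 = η (2 * Real.pi)) :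
    ∃ H : ℂ → Y, ContinuousOn H (sphere 0 1) ∧
      ∀ t ∈ Icc 0 (2 * Real.pi), H (circlePt t) = η t := by
  have key : ∀ z : ℂ, ∃ y : Y, ∀ t ∈ Icc 0 (2 * Real.pi), circlePt t = z → y = η t := by
    intro z
    by_cases hz : ∃ t ∈ Ico 0 (2 * Real.pi), circlePt t = z
    · obtain ⟨t, ht, rfl⟩ := hz
      refine ⟨η t, fun s hs hst => ?_⟩
      have inj := circlePt_injOn 0
      rw [zero_add] at inj
      rcases hs.2.lt_or_eq with hs' | hs'
      · rw [inj ⟨hs.1, hs'⟩ ht hst]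
      · have h0 : (0 : ℝ) ∈ Ico 0 (2 * Real.pi) := ⟨le_rfl, Real.two_pi_pos⟩
        have := inj h0 ht (by rw [← hst, hs', ← circlePt_add_two_pi 0, zero_add])
        rw [← this, hs', h]
    · refine ⟨η 0, fun s hs hst => ?_⟩
      rcases hs.2.lt_or_eq with hs' | hs'
      · exact absurd ⟨s, ⟨hs.1, hs'⟩, hst⟩ hz
      · rw [hs', h]
  choose H hH using key
  refine ⟨H, ?_, fun t ht => hH _ t ht rfl⟩
  have := (DiscTiling.range_circlePt ▸
    (Function.Periodic.image_Icc (f := circlePt) circlePt_add_two_pi Real.two_pi_pos 0) :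
    circlePt '' Icc 0 (0 + 2 * Real.pi) = sphere 0 1)
  rw [zero_add] at this
  rw [← this]
  exact ContinuousOn.of_comp_image isCompact_Icc continuous_circlePt.continuousOn
    (hη.congr fun t ht => hH _ t ht rfl)

/-! ### The cycle rank of the skeleton -/

namespace DiscTiling

variable {k : ℕ} (P : DiscTiling k)

/-- The interior of a tile misses the skeleton, so an extension over a tile never conflicts with
values given on the skeleton. -/
theorem mem_sphere_of_chart_mem {i : Fin k} {z : ℂ} (hz : z ∈ closedBall (0 : ℂ) 1)
    (h : P.chart i z ∈ P.skeleton) : z ∈ sphere (0 : ℂ) 1 := by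
  have hb : P.chart i z ∈ P.bdry i := by
    obtain ⟨j, hj⟩ := mem_iUnion.1 h
    by_cases hij : i = j
    · exact hij ▸ hj
    · have := (P.inter_eq i j hij).subset ⟨⟨z, hz, rfl⟩, image_mono sphere_subset_closedBall hj⟩
      exact this.1
  obtain ⟨w, hw, hwz⟩ := hb
  rwa [← P.injOn i (sphere_subset_closedBall hw) hz hwz]

/-- A circle-valued map on the skeleton that lifts to the reals on each boundary circle lifts. -/
theorem exists_lift_skeleton {f : ℂ → Circle} 
    (h : ∀ i, ∃ η : ℝ → ℝ, Continuous η ∧ η 0 = η (2 * Real.pi) ∧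
      ∀ t, Circle.exp (η t) = f (P.circ (some i) t)) :
    ∃ Θ : ℂ → ℝ, ContinuousOn Θ P.skeleton ∧ ∀ p ∈ P.skeleton, Circle.exp (Θ p) = f p := by
  classical
  have hH : ∀ i : Fin k, ∃ H : C(ℂ, ℝ), ∀ z ∈ sphere (0 : ℂ) 1,
      Circle.exp (H z) = f (P.chart i z) := by
    intro i
    obtain ⟨η, hη, hp, hηf⟩ := h i
    obtain ⟨H, hH, hHη⟩ := exists_continuousOn_sphere hη.continuousOn hp
    -- Tietze's theorem extends the real lift from the boundary circle over the tile.
    obtain ⟨g, hg⟩ := ContinuousMap.exists_restrict_eq (isClosed_sphere (x := (0 : ℂ)) (ε := 1))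
      ⟨_, continuousOn_iff_continuous_domRestrict.1 hH⟩
    refine ⟨g, fun z hz => ?_⟩
    have h1 : g z = H z := congrFun (congrArg DFunLike.coe hg) ⟨z, hz⟩
    obtain ⟨t, ht, rfl⟩ := exists_circlePt_eq 0 (z := z) (by simpa using hz)
    rw [h1, hHη t ⟨ht.1, by linarith [ht.2]⟩, hηf t]; rfl
  choose H hH using hH
  -- The exponentials of these extensions fit together to a circle-valued extension of `f` to the
  -- disc, where every such map lifts.
  have key : ∀ x : ℂ, ∃ y : Circle, (x ∈ P.skeleton → y = f x) ∧
      ∀ i, ∀ z ∈ closedBall (0 : ℂ) 1, P.chart i z = x → y = Circle.exp (H i z) := by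
    intro x
    by_cases hx : x ∈ P.skeleton
    · refine ⟨f x, fun _ => rfl, ?_⟩
      rintro i z hz rfl
      exact (hH i z (P.mem_sphere_of_chart_mem hz hx)).symm
    · by_cases hex : ∃ i, ∃ z ∈ closedBall (0 : ℂ) 1, P.chart i z = x
      · obtain ⟨i, z, hz, rfl⟩ := hex
        refine ⟨Circle.exp (H i z), fun h => absurd h hx, fun j w hw hwz => ?_⟩
        by_cases hij : i = j
        · subst hij; rw [P.injOn i hw hz hwz]
        · exfalso
          have := (P.inter_eq i j hij).subset ⟨⟨z, hz, rfl⟩, w, hw, hwz⟩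
          exact hx (mem_iUnion.2 ⟨i, this.1⟩)
      · exact ⟨f x, fun _ => rfl, fun i z hz hzx => absurd ⟨i, z, hz, hzx⟩ hex⟩
  choose G hG1 hG2 using key
  have hG : ContinuousOn G (closedBall 0 1) := by
    rw [← P.cover]
    refine (locallyFinite_of_finite _).continuousOn_iUnion (fun i => P.isClosed_tile i) fun i => ?_
    refine ContinuousOn.of_comp_image (isCompact_closedBall 0 1) (P.continuousOn i) ?_
    exact (Circle.exp.continuous.comp (H i).continuous).continuousOn.congr
      fun z hz => hG2 _ i z hz rfl
  obtain ⟨Θ, hΘ, h⟩ := exists_lift_closedBall hG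
  have hsub : P.skeleton ⊆ closedBall 0 1 := by
    rw [← P.cover]
    exact iUnion_mono fun i => image_mono sphere_subset_closedBall
  exact ⟨Θ, hΘ.mono hsub, fun p hp => by rw [h p (hsub hp), hG1 p hp]⟩

theorem finrank_ker_ge {α β : Type*} [Fintype α] [Fintype β] (D : (α → ℤ) →ₗ[ℤ] (β → ℤ)) :
    Fintype.card α ≤ Module.finrank ℤ D.ker + Fintype.card β := by
  have h1 := Submodule.finrank_quotient_add_finrank D.ker
  have h2 := D.quotKerEquivRange.finrank_eq
  have h3 := Submodule.finrank_le D.range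
  rw [Module.finrank_fintype_fun_eq_card] at h1 h3
  omega

/-! ### Euler's inequality for the edges of a net -/

namespace IsNet

variable {P} {U : Set ℂ}

/-- A cohomological proof of Euler's inequality. Integer weights on the edges have winding numbers
around the `k` tiles, which gives `D : ℤ^E → ℤ^k`. A weight in the kernel comes from a circle-valued
map that lifts on every tile boundary, hence on the skeleton; the values of the lift on `U` exhibit
the weight as a coboundary from `ℤ^U`. Hence `|E| - k ≤ rank (ker D) ≤ |U|`. -/
theorem edges_le (hU : P.IsNet U) :
    {e | IsEdge P.skeleton U e}.ncard ≤ U.ncard + k := by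
  classical
  set S := P.skeleton with hS
  have := hU.finite_edges.fintype
  have := hU.finite.fintype
  let E := {e | IsEdge S U e}
  -- The map attached to `e` winds once along `e` and equals 1 on the rest of the skeleton.
  have hf : ∀ e : E, ∃ f : ℂ → Circle, ContinuousOn f S ∧ (∀ p ∈ U, f p = 1) ∧
      ∀ e', IsEdge S U e' → ∀ t ∈ Icc (0 : ℝ) 1, f (param S U e' t) =
        if e' = e then Circle.exp (2 * Real.pi * t) else 1 := by
    intro e
    refine exists_glue hU.locallyLine hU.finite hU.finite_edges
      (fun p hp hpU => hU.exists_edge hp hpU) (fun _ => 1)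
      (fun e' t => if e' = e then Circle.exp (2 * Real.pi * t) else 1) fun e' he' => ?_
    by_cases h : e' = e
    · simp only [h, if_true]
      refine ⟨(Circle.exp.continuous.comp (by fun_prop)).continuousOn, by simp, by simp⟩
    · simp only [h, if_false]
      exact ⟨continuousOn_const, trivial, trivial⟩
  choose f hfc hfU hfe using hf
  have hlift : ∀ (e : E) (i : Fin k), ∃ θ : ℝ → ℝ, Continuous θ ∧
      ∀ t, Circle.exp (θ t) = f e (P.circ (some i) t) := fun e i =>
    exists_lift_circle ((hfc e).comp_continuous (P.continuous_circ _)
      fun t => P.circle_subset _ ⟨t, rfl⟩)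
  choose θ hθc hθ using hlift
  have hm : ∀ (e : E) (i : Fin k), ∃ m : ℤ,
      θ e i (2 * Real.pi) = θ e i 0 + m * (2 * Real.pi) := by
    intro e i
    apply Circle.exp_eq_exp.1
    rw [hθ, hθ]
    have := P.periodic_circ (some i) 0
    rw [zero_add] at this
    rw [this]
  choose m hm using hm
  -- Here `m e i` is the winding number of `f e` around the `i`-th tile.
  let D : (E → ℤ) →ₗ[ℤ] (Fin k → ℤ) :=
    LinearMap.pi fun i => ∑ e : E, m e i • LinearMap.proj e
  have hD : ∀ a i, D a i = ∑ e, m e i * a e := by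
    intro a i; simp [D]
  have endU : ∀ e : E, param S U e 0 ∈ U ∧ param S U e 1 ∈ U := fun e =>
    ⟨e.2.gap_param.left, e.2.gap_param.right⟩
  let δ : (U → ℤ) →ₗ[ℤ] (E → ℤ) := LinearMap.pi fun e =>
    (LinearMap.proj (R := ℤ) (φ := fun _ : U => ℤ) ⟨_, (endU e).2⟩) -
      LinearMap.proj (R := ℤ) (φ := fun _ : U => ℤ) ⟨_, (endU e).1⟩
  have hker : D.ker ≤ δ.range := by
    intro a ha
    rw [LinearMap.mem_ker] at ha
    let F : ℂ → Circle := fun x => ∏ e : E, f e x ^ a e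
    obtain ⟨Θ, hΘc, hΘ⟩ := P.exists_lift_skeleton (f := F) (by
      intro i
      -- This lift of `F` along the boundary closes up precisely because the `i`-th coordinate of `D
      -- a` vanishes.
      refine ⟨fun t => ∑ e : E, (a e : ℝ) * θ e i t,
        continuous_finsetSum _ fun e _ => continuous_const.mul (hθc e i), ?_, fun t => ?_⟩
      · have h0 : ∑ e : E, (m e i : ℝ) * a e = 0 := by
          have := congrFun ha i
          rw [hD] at this
          exact_mod_cast this
        simp only [hm, mul_add, Finset.sum_add_distrib]
        have : ∑ e : E, (a e : ℝ) * (m e i * (2 * Real.pi)) =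
            (∑ e : E, (m e i : ℝ) * a e) * (2 * Real.pi) := by
          rw [Finset.sum_mul]
          exact Finset.sum_congr rfl fun e _ => by ring
        rw [this, h0]; ring
      · rw [Circle.exp_finset_sum]
        exact Finset.prod_congr rfl fun e _ => by rw [Circle.exp_intCast_mul, hθ])
    have hΘU : ∀ u : U, ∃ n : ℤ, Θ u = n * (2 * Real.pi) := by
      intro u
      apply Circle.exp_eq_one.1
      rw [hΘ _ (hU.subset u.2)]
      exact Finset.prod_eq_one fun e _ => by rw [hfU e _ u.2, one_zpow]
    choose n hn using hΘU
    refine ⟨n, funext fun e => ?_⟩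
    have hF : ∀ t ∈ Icc (0 : ℝ) 1, F (param S U e t) = Circle.exp (a e * (2 * Real.pi * t)) := by
      intro t ht
      show ∏ e' : E, f e' (param S U e t) ^ a e' = _
      rw [Finset.prod_eq_single e]
      · rw [hfe e e e.2 t ht, if_pos rfl, Circle.exp_intCast_mul]
      · intro e' _ hne
        rw [hfe e' e e.2 t ht, if_neg (fun h => hne (Subtype.ext h.symm)), one_zpow]
      · intro h; exact absurd (Finset.mem_univ _) h
    -- Along `e` only the factor `f e` varies, so both functions lift `F` with the same start. At `t
    -- = 1` this says that `a e` is the difference of the potential `n` at the two ends.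
    have heq := Circle.isCoveringMap_exp.eqOn_of_comp_eqOn (s := Icc (0 : ℝ) 1)
      (g₁ := fun t => Θ (param S U e t))
      (g₂ := fun t => Θ (param S U e 0) + a e * (2 * Real.pi * t)) isPreconnected_Icc
      (hΘc.comp e.2.gap_param.cont e.2.gap_param.maps) (by fun_prop)
      (by
        intro t ht
        have h0 : (0 : ℝ) ∈ Icc (0 : ℝ) 1 := ⟨le_rfl, zero_le_one⟩
        simp only [Function.comp_apply]
        rw [Circle.exp_add, hΘ _ (e.2.gap_param.maps ht), hΘ _ (e.2.gap_param.maps h0),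
          hF t ht, hF 0 h0]
        simp)
      (a := 0) ⟨le_rfl, zero_le_one⟩ (by simp)
    have h1 := heq (show (1 : ℝ) ∈ Icc (0 : ℝ) 1 from ⟨zero_le_one, le_rfl⟩)
    have e0 := hn ⟨_, (endU e).1⟩
    have e1 := hn ⟨_, (endU e).2⟩
    simp only at h1 e0 e1
    rw [e0, e1, mul_one, ← add_mul] at h1
    have h2 := mul_right_cancel₀ Real.two_pi_pos.ne' h1
    have h3 : n ⟨_, (endU e).2⟩ = n ⟨_, (endU e).1⟩ + a e := by exact_mod_cast h2
    show n ⟨_, (endU e).2⟩ - n ⟨_, (endU e).1⟩ = a e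
    rw [h3]; ring
  have h1 := finrank_ker_ge D
  have h2 := Submodule.finrank_mono hker
  have h3 := LinearMap.finrank_range_le δ
  rw [Module.finrank_fintype_fun_eq_card] at h3
  rw [Set.ncard_eq_toFinset_card', Set.ncard_eq_toFinset_card', Set.toFinset_card,
    Set.toFinset_card]
  rw [Fintype.card_fin] at h1
  calc Fintype.card E ≤ _ := h1
    _ ≤ _ := by gcongr; exact h2.trans h3

end IsNet

end DiscTiling

end

noncomputable section

/-! ### Counting the ends of edges -/

theorem exists_continuousOn_factor {α Y : Type*} [TopologicalSpace α] [TopologicalSpace Y]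
    [T2Space Y] {K : Set α} (hK : IsCompact K) {c : α → Y} (hc : ContinuousOn c K)
    (hi : InjOn c K) {J : Set ℝ} {ψ : ℝ → Y} (hψ : ContinuousOn ψ J) (hm : MapsTo ψ J (c '' K))
    (hne : K.Nonempty) :
    ∃ τ : ℝ → α, ContinuousOn τ J ∧ MapsTo τ J K ∧ ∀ t ∈ J, c (τ t) = ψ t := by
  have : Nonempty α := ⟨hne.some⟩
  have hinv : ContinuousOn (Function.invFunOn c K) (c '' K) :=
    ContinuousOn.of_comp_image hK hc (continuousOn_id.congr fun x hx => hi.leftInvOn_invFunOn hx)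
  refine ⟨Function.invFunOn c K ∘ ψ, hinv.comp hψ hm, fun t ht => ?_, fun t ht => ?_⟩
  · exact Function.invFunOn_mem (hm ht)
  · exact Function.invFunOn_eq (hm ht)

/-- An edge parametrized from one of its two ends. -/
def germ (S U e : Set ℂ) (b : Bool) (s : ℝ) : ℂ := param S U e (if b then 1 - s else s)

/-! ### Half-edges and the star of a point -/

section Germ

variable {S U : Set ℂ}

/-- Since `1 / 3 < 1 / 2`, the two half-edges of one edge stay disjoint, even when the edge closes
up at a single point of `U`. -/
theorem germ_inj (hl : LocallyLine S U) {e e' : Set ℂ} (he : IsEdge S U e) (he' : IsEdge S U e')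
    {b b' : Bool} {s s' : ℝ} (hs : s ∈ Ioc (0 : ℝ) (1 / 3)) (hs' : s' ∈ Ioc (0 : ℝ) (1 / 3))
    (h : germ S U e b s = germ S U e' b' s') : e = e' ∧ b = b' ∧ s = s' := by
  have m : ∀ {b : Bool} {s : ℝ}, s ∈ Ioc (0 : ℝ) (1 / 3) →
      (if b then 1 - s else s) ∈ Ioo (0 : ℝ) 1 := by
    intro b s hs
    cases b <;> simp only [Bool.false_eq_true, if_true, if_false, mem_Ioo] <;>
      constructor <;> linarith [hs.1, hs.2]
  have hee : e = e' := he.eq_of_meets hl he' ⟨germ S U e b s,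
    he.eq_param.symm.subset ⟨_, m hs, rfl⟩, he'.eq_param.symm.subset ⟨_, m hs', h.symm⟩⟩
  subst hee
  have := he.gap_param.inj (Ioo_subset_Ico_self (m hs)) (Ioo_subset_Ico_self (m hs')) h
  refine ⟨rfl, ?_⟩
  cases b <;> cases b' <;> simp only [Bool.false_eq_true, if_true, if_false] at this
  · exact ⟨rfl, this⟩
  · linarith [hs.2, hs'.2]
  · linarith [hs.2, hs'.2]
  · exact ⟨rfl, by linarith⟩

theorem germ_mem {e : Set ℂ} (he : IsEdge S U e) {b : Bool} {s : ℝ}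
    (hs : s ∈ Ioc (0 : ℝ) (1 / 3)) : germ S U e b s ∈ e := by
  have : (if b then 1 - s else s) ∈ Ioo (0 : ℝ) 1 := by
    cases b <;> simp only [Bool.false_eq_true, if_true, if_false, mem_Ioo] <;>
      constructor <;> linarith [hs.1, hs.2]
  exact he.eq_param.symm.subset ⟨_, this, rfl⟩

theorem continuousOn_germ {e : Set ℂ} (he : IsEdge S U e) (b : Bool) :
    ContinuousOn (germ S U e b) (Icc 0 (1 / 3)) := by
  refine he.gap_param.cont.comp (f := fun s => if b then 1 - s else s) ?_ ?_
  · cases b <;> simp only [Bool.false_eq_true, if_true, if_false] <;> fun_prop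
  · intro s hs
    cases b <;> simp only [Bool.false_eq_true, if_true, if_false, mem_Icc] <;>
      constructor <;> linarith [hs.1, hs.2]

/-- The half-edges at a point. -/
def halfEdges (S U : Set ℂ) (v : ℂ) : Set (Set ℂ × Bool) :=
  {h | IsEdge S U h.1 ∧ germ S U h.1 h.2 0 = v}

/-- From the plane one removes the other points of `U` and, on each edge, everything except the open
third next to an end at `v`. The removed set is a finite union of compact sets that avoids `v`; of
`S`, only `v` and its half-edges survive. -/
theorem exists_star (hl : LocallyLine S U) (hU : U.Finite) (hE : {e | IsEdge S U e}.Finite)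
    (hcov : ∀ p ∈ S, p ∉ U → ∃ e, IsEdge S U e ∧ p ∈ e) {v : ℂ} (hv : v ∈ U) :
    ∃ O : Set ℂ, IsOpen O ∧ v ∈ O ∧
      (∀ p ∈ O ∩ S, p ≠ v →
        ∃ h ∈ halfEdges S U v, ∃ s ∈ Ioo (0 : ℝ) (1 / 3), germ S U h.1 h.2 s = p) ∧
      ∀ h ∈ halfEdges S U v, ∀ s ∈ Ioo (0 : ℝ) (1 / 3), germ S U h.1 h.2 s ∈ O := by
  classical
  let K : Set ℂ → Set ℝ := fun e =>
    Icc (if param S U e 0 = v then 1 / 3 else 0) (if param S U e 1 = v then 2 / 3 else 1)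
  have hK : ∀ e, K e ⊆ Icc 0 1 := fun e =>
    Icc_subset_Icc (by split_ifs <;> norm_num) (by split_ifs <;> norm_num)
  let B : Set ℂ := (⋃ e ∈ {e | IsEdge S U e}, param S U e '' K e) ∪ (U \ {v})
  have hB : IsClosed B := by
    refine IsClosed.union ?_ (hU.subset sdiff_subset).isClosed
    refine hE.isClosed_biUnion fun e he => ?_
    exact (isCompact_Icc.image_of_continuousOn
      ((IsEdge.gap_param he).cont.mono (hK e))).isClosed
  refine ⟨Bᶜ, hB.isOpen_compl, ?_, ?_, ?_⟩
  · rintro (h | h)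
    · obtain ⟨e, he, t, ht, htv⟩ := mem_iUnion₂.1 h
      rcases eq_endpoints_or_mem_Ioo_of_mem_Icc (hK e ht) with rfl | rfl | ht'
      · have := ht.1; rw [if_pos htv] at this; norm_num at this
      · have := ht.2; rw [if_pos htv] at this; norm_num at this
      · exact (IsEdge.gap_param he).avoid t ht' (htv ▸ hv)
    · exact h.2 rfl
  · rintro p ⟨hpB, hpS⟩ hpv
    have hpU : p ∉ U := fun h => hpB (Or.inr ⟨h, hpv⟩)
    obtain ⟨e, he, hpe⟩ := hcov p hpS hpU
    rw [he.eq_param] at hpe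
    obtain ⟨t, ht, rfl⟩ := hpe
    have htK : t ∉ K e := fun h => hpB (Or.inl (mem_iUnion₂.2 ⟨e, he, t, h, rfl⟩))
    by_cases h0 : param S U e 0 = v ∧ t < 1 / 3
    · exact ⟨(e, false), ⟨he, by simpa [germ] using h0.1⟩, t, ⟨ht.1, h0.2⟩, by simp [germ]⟩
    · by_cases h1 : param S U e 1 = v ∧ 2 / 3 < t
      · exact ⟨(e, true), ⟨he, by simpa [germ] using h1.1⟩, 1 - t,
          ⟨by linarith [ht.2], by linarith [h1.2]⟩, by simp [germ]⟩
      · exfalso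
        apply htK
        constructor
        · split_ifs with h
          · by_contra hlt; exact h0 ⟨h, not_le.1 hlt⟩
          · exact ht.1.le
        · split_ifs with h
          · by_contra hlt; exact h1 ⟨h, not_le.1 hlt⟩
          · exact ht.2.le
  · rintro ⟨e, b⟩ ⟨he, hev⟩ s hs hsB
    have hs' : s ∈ Ioc (0 : ℝ) (1 / 3) := Ioo_subset_Ioc_self hs
    have hm := germ_mem he (b := b) hs'
    rcases hsB with h | h
    · obtain ⟨e', he', t, ht, hte⟩ := mem_iUnion₂.1 h
      have ht' : t ∈ Ioo (0 : ℝ) 1 := by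
        rcases eq_endpoints_or_mem_Ioo_of_mem_Icc (hK e' ht) with rfl | rfl | ht'
        · exact absurd (hte ▸ (IsEdge.gap_param he').left) (he.subset hm).2
        · exact absurd (hte ▸ (IsEdge.gap_param he').right) (he.subset hm).2
        · exact ht'
      have hee : e' = e := IsEdge.eq_of_meets hl he' he
        ⟨_, (IsEdge.eq_param he').symm.subset ⟨t, ht', rfl⟩, by rw [hte]; exact hm⟩
      subst hee
      have ms : (if b then 1 - s else s) ∈ Ioo (0 : ℝ) 1 := by
        cases b <;> simp only [Bool.false_eq_true, if_true, if_false, mem_Ioo] <;>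
          constructor <;> linarith [hs.1, hs.2]
      have hts := he.gap_param.inj (Ioo_subset_Ico_self ht') (Ioo_subset_Ico_self ms) hte
      cases b
      · simp only [germ, Bool.false_eq_true, if_false] at hts hev
        have := ht.1
        rw [if_pos hev] at this
        linarith [hs.2]
      · simp only [germ, if_true, sub_zero] at hts hev
        have := ht.2
        rw [if_pos hev] at this
        linarith [hs.2]
    · exact (he.subset hm).2 h.1

theorem nonempty_homeomorph_Ioo_real : Nonempty (↥(Ioo (-(1 / 3) : ℝ) (1 / 3)) ≃ₜ ℝ) := by
  have hpi := Real.pi_pos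
  have hc : (3 * Real.pi / 2 : ℝ) ≠ 0 := by positivity
  have himg : Homeomorph.mulLeft₀ (3 * Real.pi / 2) hc '' Ioo (-(1 / 3) : ℝ) (1 / 3) =
      Ioo (-(Real.pi / 2)) (Real.pi / 2) := by
    ext x
    simp only [mem_image, mem_Ioo, Homeomorph.coe_mulLeft₀]
    constructor
    · rintro ⟨y, hy, rfl⟩
      constructor <;> nlinarith [hy.1, hy.2]
    · intro hx
      refine ⟨x / (3 * Real.pi / 2), ⟨?_, ?_⟩, mul_div_cancel₀ x hc⟩
      · rw [lt_div_iff₀ (by positivity)]; linarith [hx.1]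
      · rw [div_lt_iff₀ (by positivity)]; linarith [hx.2]
  exact ⟨((Homeomorph.mulLeft₀ (3 * Real.pi / 2) hc).image _).trans
    ((Homeomorph.setCongr himg).trans Real.tanOrderIso.toHomeomorph)⟩

/-- A point with exactly two half-edges has a neighbourhood homeomorphic to a line. -/
theorem exists_homeomorph_of_two (hl : LocallyLine S U) (hU : U.Finite)
    (hE : {e | IsEdge S U e}.Finite) (hcov : ∀ p ∈ S, p ∉ U → ∃ e, IsEdge S U e ∧ p ∈ e)
    {v : ℂ} (hv : v ∈ U) (hvS : v ∈ S) {h₁ h₂ : Set ℂ × Bool} (hne : h₁ ≠ h₂)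
    (heq : halfEdges S U v = {h₁, h₂}) :
    ∃ O : Set ℂ, IsOpen O ∧ v ∈ O ∧ Nonempty (↥(O ∩ S) ≃ₜ ℝ) := by
  obtain ⟨O, hO, hvO, hO1, hO2⟩ := exists_star hl hU hE hcov hv
  have m1 : h₁ ∈ halfEdges S U v := by rw [heq]; exact Or.inl rfl
  have m2 : h₂ ∈ halfEdges S U v := by rw [heq]; exact Or.inr rfl
  have gS : ∀ h ∈ halfEdges S U v, ∀ s ∈ Ioc (0 : ℝ) (1 / 3), germ S U h.1 h.2 s ∈ S \ U :=
    fun h hh s hs => hh.1.subset (germ_mem hh.1 hs)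
  -- The line through `v`: inwards along the first half-edge, outwards along the second.
  let φ : ℝ → ℂ := fun s => if s ≤ 0 then germ S U h₁.1 h₁.2 (-s) else germ S U h₂.1 h₂.2 s
  have φneg : ∀ s, s ≤ 0 → φ s = germ S U h₁.1 h₁.2 (-s) := fun s hs => if_pos hs
  have φpos : ∀ s, 0 < s → φ s = germ S U h₂.1 h₂.2 s := fun s hs => if_neg hs.not_ge
  have φ0 : φ 0 = v := by rw [φneg 0 le_rfl, neg_zero]; exact m1.2
  have hφc : ContinuousOn φ (Icc (-(1 / 3)) (1 / 3)) := by
    have hsplit : Icc (-(1 / 3) : ℝ) (1 / 3) = Icc (-(1 / 3)) 0 ∪ Icc 0 (1 / 3) :=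
      (Icc_union_Icc_eq_Icc (by norm_num) (by norm_num)).symm
    rw [hsplit]
    refine ContinuousOn.union_of_isClosed ?_ ?_ isClosed_Icc isClosed_Icc
    · refine ContinuousOn.congr ((continuousOn_germ m1.1 h₁.2).comp (f := fun s => -s)
        (by fun_prop) fun s hs => ⟨by linarith [hs.2], by linarith [hs.1]⟩)
        fun s hs => φneg s hs.2
    · refine (continuousOn_germ m2.1 h₂.2).congr fun s hs => ?_
      rcases hs.1.eq_or_lt with rfl | h
      · rw [φ0, m2.2]
      · exact φpos s h
  have hφi : InjOn φ (Icc (-(1 / 3)) (1 / 3)) := by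
    have key : ∀ s ∈ Icc (-(1 / 3) : ℝ) (1 / 3), s ≠ 0 → ∃ h : Set ℂ × Bool,
        h ∈ halfEdges S U v ∧ |s| ∈ Ioc (0 : ℝ) (1 / 3) ∧ φ s = germ S U h.1 h.2 |s| ∧
        ((s < 0 ∧ h = h₁) ∨ (0 < s ∧ h = h₂)) := by
      intro s hs hs0
      have habs : |s| ∈ Ioc (0 : ℝ) (1 / 3) := ⟨abs_pos.2 hs0, abs_le.2 hs⟩
      rcases lt_or_gt_of_ne hs0 with h | h
      · exact ⟨h₁, m1, habs, by rw [φneg s h.le, abs_of_neg h], Or.inl ⟨h, rfl⟩⟩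
      · exact ⟨h₂, m2, habs, by rw [φpos s h, abs_of_pos h], Or.inr ⟨h, rfl⟩⟩
    have hz : ∀ s ∈ Icc (-(1 / 3) : ℝ) (1 / 3), φ s = v → s = 0 := by
      intro s hs hsv
      by_contra hs0
      obtain ⟨h, hh, habs, hφ, -⟩ := key s hs hs0
      have := gS h hh _ habs
      rw [← hφ, hsv] at this
      exact this.2 hv
    intro s hs t ht hst
    by_cases hs0 : s = 0
    · subst hs0; rw [φ0] at hst; exact (hz t ht hst.symm).symm
    by_cases ht0 : t = 0
    · subst ht0; rw [φ0] at hst; exact hz s hs hst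
    obtain ⟨h, hh, habs, hφ, hc⟩ := key s hs hs0
    obtain ⟨h', hh', habs', hφ', hc'⟩ := key t ht ht0
    rw [hφ, hφ'] at hst
    obtain ⟨e1, e2, e3⟩ := germ_inj hl hh.1 hh'.1 habs habs' hst
    have hhh : h = h' := Prod.ext e1 e2
    rcases hc with ⟨hc, rfl⟩ | ⟨hc, rfl⟩ <;> rcases hc' with ⟨hc', rfl⟩ | ⟨hc', rfl⟩
    · rw [abs_of_neg hc, abs_of_neg hc'] at e3; linarith
    · exact absurd hhh hne
    · exact absurd hhh.symm hne
    · rw [abs_of_pos hc, abs_of_pos hc'] at e3; linarith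
  have himg : φ '' Ioo (-(1 / 3)) (1 / 3) = O ∩ S := by
    apply Subset.antisymm
    · rintro _ ⟨s, hs, rfl⟩
      rcases lt_trichotomy s 0 with h | rfl | h
      · rw [φneg s h.le]
        exact ⟨hO2 _ m1 _ ⟨by linarith, by linarith [hs.1]⟩,
          (gS _ m1 _ ⟨by linarith, by linarith [hs.1]⟩).1⟩
      · rw [φ0]; exact ⟨hvO, hvS⟩
      · rw [φpos s h]
        exact ⟨hO2 _ m2 _ ⟨h, hs.2⟩, (gS _ m2 _ ⟨h, hs.2.le⟩).1⟩
    · intro p hp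
      by_cases hpv : p = v
      · exact ⟨0, by norm_num, by rw [hpv, φ0]⟩
      · obtain ⟨h, hh, s, hs, rfl⟩ := hO1 p hp hpv
        rw [heq] at hh
        rcases hh with rfl | rfl
        · exact ⟨-s, ⟨by linarith [hs.2], by linarith [hs.1]⟩, by
            rw [φneg _ (by linarith [hs.1]), neg_neg]⟩
        · exact ⟨s, ⟨by linarith [hs.1], hs.2⟩, φpos s hs.1⟩
  -- Compactness of the closed interval turns the continuous injection into an embedding, which is
  -- then restricted to the open interval.
  have hemb : IsClosedEmbedding ((Icc (-(1 / 3) : ℝ) (1 / 3)).domRestrict φ) :=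
    (continuousOn_iff_continuous_domRestrict.1 hφc).isClosedEmbedding
      (injOn_iff_injective.1 hφi)
  have hemb' : IsEmbedding ((Ioo (-(1 / 3) : ℝ) (1 / 3)).domRestrict φ) :=
    hemb.isEmbedding.comp (IsEmbedding.inclusion Ioo_subset_Icc_self)
  obtain ⟨τ⟩ := nonempty_homeomorph_Ioo_real
  refine ⟨O, hO, hvO, ⟨(Homeomorph.setCongr ?_).trans (hemb'.toHomeomorph.symm.trans τ)⟩⟩
  rw [← himg, range_domRestrict]

/-- A point on a circle in `S` has at least two half-edges. -/
theorem two_le_halfEdges (hl : LocallyLine S U) (hU : U.Finite)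
    (hE : {e | IsEdge S U e}.Finite) (hcov : ∀ p ∈ S, p ∉ U → ∃ e, IsEdge S U e ∧ p ∈ e)
    {v : ℂ} (hv : v ∈ U) {ψ : ℝ → ℂ} {a b t : ℝ} (ht : t ∈ Ioo a b)
    (hψ : ContinuousOn ψ (Ioo a b)) (hi : InjOn ψ (Ioo a b)) (hS : MapsTo ψ (Ioo a b) S)
    (htv : ψ t = v) {h₀ : Set ℂ × Bool} (hsub : halfEdges S U v ⊆ {h₀}) : False := by
  obtain ⟨O, hO, hvO, hO1, -⟩ := exists_star hl hU hE hcov hv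
  have hnear : ∀ᶠ s in 𝓝 t, s ∈ Ioo a b ∧ ψ s ∈ O :=
    (show ∀ᶠ s in 𝓝 t, s ∈ Ioo a b from Ioo_mem_nhds ht.1 ht.2).and
      ((hψ.continuousAt (Ioo_mem_nhds ht.1 ht.2)).eventually (hO.mem_nhds (htv ▸ hvO)))
  obtain ⟨δ, hδ, hball⟩ := Metric.eventually_nhds_iff_ball.1 hnear
  rw [Real.ball_eq_Ioo] at hball
  have hgerm : ∀ s ∈ Ioo (t - δ) (t + δ), s ≠ t → h₀ ∈ halfEdges S U v ∧
      ∃ r ∈ Ioo (0 : ℝ) (1 / 3), germ S U h₀.1 h₀.2 r = ψ s := by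
    intro s hs hst
    obtain ⟨h, hh, r, hr, hrs⟩ := hO1 (ψ s) ⟨(hball s hs).2, hS (hball s hs).1⟩ fun h =>
      hst (hi (hball s hs).1 ht (h.trans htv.symm))
    have : h = h₀ := hsub hh
    subst this
    exact ⟨hh, r, hr, hrs⟩
  have hm : t - δ / 2 ∈ Ioo (t - δ) (t + δ) := ⟨by linarith, by linarith⟩
  have hp : t + δ / 2 ∈ Ioo (t - δ) (t + δ) := ⟨by linarith, by linarith⟩
  have h0 : t ∈ Ioo (t - δ) (t + δ) := ⟨by linarith, by linarith⟩
  have hh₀ := (hgerm _ hm (by linarith)).1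
  have hgi : InjOn (germ S U h₀.1 h₀.2) (Icc 0 (1 / 3)) := by
    have hz : ∀ r ∈ Ioc (0 : ℝ) (1 / 3), germ S U h₀.1 h₀.2 r ≠ v := fun r hr h =>
      (hh₀.1.subset (germ_mem hh₀.1 (b := h₀.2) hr)).2 (h ▸ hv)
    intro r hr r' hr' hrr
    rcases hr.1.eq_or_lt with rfl | h1 <;> rcases hr'.1.eq_or_lt with rfl | h2
    · rfl
    · exact absurd (hrr.symm.trans hh₀.2) (hz r' ⟨h2, hr'.2⟩)
    · exact absurd (hrr.trans hh₀.2) (hz r ⟨h1, hr.2⟩)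
    · exact (germ_inj hl hh₀.1 hh₀.1 ⟨h1, hr.2⟩ ⟨h2, hr'.2⟩ hrr).2.2
  obtain ⟨τ, hτc, hτm, hτ⟩ := exists_continuousOn_factor isCompact_Icc
    (continuousOn_germ hh₀.1 h₀.2) hgi (J := Ioo (t - δ) (t + δ)) (ψ := ψ)
    (hψ.mono fun s hs => (hball s hs).1) (by
      intro s hs
      by_cases hst : s = t
      · exact ⟨0, ⟨le_rfl, by norm_num⟩, by rw [hst, htv, hh₀.2]⟩
      · obtain ⟨-, r, hr, hrs⟩ := hgerm s hs hst
        exact ⟨r, Ioo_subset_Icc_self hr, hrs⟩) ⟨0, le_rfl, by norm_num⟩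
  have hτi : InjOn τ (Ioo (t - δ) (t + δ)) := by
    intro r hr s hs hrs
    have := hτ r hr
    rw [hrs, hτ s hs] at this
    exact hi (hball r hr).1 (hball s hs).1 this.symm
  -- Inside a single half-edge, `v` is the extreme parameter 0, so `τ` has an interior minimum at
  -- `t`; an injective continuous real function is strictly monotone and has none.
  have hτ0 : τ t = 0 := by
    refine hgi (hτm h0) ⟨le_rfl, by norm_num⟩ ?_
    rw [hτ t h0, htv, hh₀.2]
  rcases hτc.strictMonoOn_of_injOn_Ioo (by linarith) hτi with h | h
  · have := h hm h0 (by linarith)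
    linarith [(hτm hm).1]
  · have := h h0 hp (by linarith)
    linarith [(hτm hp).1]

end Germ

/-! ### Degrees and the number of vertices -/

namespace DiscTiling.IsNet

variable {k : ℕ} {P : DiscTiling k} {U : Set ℂ}

theorem two_le_ncard_halfEdges (hU : P.IsNet U) {v : ℂ} (hv : v ∈ U)
    (hfin : (halfEdges P.skeleton U v).Finite) : 2 ≤ (halfEdges P.skeleton U v).ncard := by
  by_contra hlt
  have h1 : (halfEdges P.skeleton U v).ncard ≤ 1 := by omega
  obtain ⟨h₀, hsub⟩ : ∃ h₀, halfEdges P.skeleton U v ⊆ {h₀} := by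
    rcases (Set.ncard_le_one_iff_subset_singleton hfin).1 h1 with ⟨h₀, h⟩
    exact ⟨h₀, h⟩
  obtain ⟨i, hi⟩ := mem_iUnion.1 (hU.subset hv)
  rw [← P.circle_some] at hi
  obtain ⟨t, ht⟩ := hi
  have hpi := Real.pi_pos
  have hs : Ioo (t - Real.pi) (t + Real.pi) ⊆ Ico (t - Real.pi) (t - Real.pi + 2 * Real.pi) :=
    fun s hs => ⟨hs.1.le, by linarith [hs.2]⟩
  exact two_le_halfEdges hU.locallyLine hU.finite hU.finite_edges
    (fun p hp hpU => hU.exists_edge hp hpU) hv (a := t - Real.pi) (b := t + Real.pi) (t := t)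
    ⟨by linarith, by linarith⟩ (P.continuous_circ (some i)).continuousOn
    ((P.injOn_circ _ _).mono hs) (fun s _ => P.circle_subset _ ⟨s, rfl⟩) ht hsub

/-- With exactly two half-edges the skeleton would be a line near `v`, against the definition of a
vertex. -/
theorem three_le_ncard_halfEdges (hU : P.IsNet U) {v : ℂ} (hv : v ∈ P.vertices)
    (hfin : (halfEdges P.skeleton U v).Finite) : 3 ≤ (halfEdges P.skeleton U v).ncard := by
  have h2 := hU.two_le_ncard_halfEdges (hU.vertices_subset hv) hfin
  by_contra hlt
  obtain ⟨h₁, h₂, hne, heq⟩ := Set.ncard_eq_two.1 (show (halfEdges P.skeleton U v).ncard = 2 by omega)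
  obtain ⟨O, hO, hvO, hn⟩ := exists_homeomorph_of_two hU.locallyLine hU.finite hU.finite_edges
    (fun p hp hpU => hU.exists_edge hp hpU) (hU.vertices_subset hv) hv.1 hne heq
  exact not_nonempty_iff.2 (hv.2 O hO hvO) hn

/-- Counting half-edges by their end points gives `2|U| + |V| ≤ 2|E|`, and `|E| ≤ |U| + k` by
`edges_le`. The size of the net cancels. -/
theorem vertices_le (hU : P.IsNet U) : P.vertices.ncard ≤ 2 * k := by
  classical
  have hE := hU.edges_le
  have hEfin := hU.finite_edges
  set E := hEfin.toFinset with hEdef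
  set UF := hU.finite.toFinset with hUF
  let H : Finset (Set ℂ × Bool) := E ×ˢ Finset.univ
  let end' : Set ℂ × Bool → ℂ := fun h => germ P.skeleton U h.1 h.2 0
  have hmaps : Set.MapsTo end' (H : Set (Set ℂ × Bool)) (UF : Set ℂ) := by
    rintro ⟨e, b⟩ hh
    have he : IsEdge P.skeleton U e := by simpa [H, hEdef] using hh
    rw [hUF, Finite.coe_toFinset]
    show param _ _ _ _ ∈ U
    cases b
    · simpa using he.gap_param.left
    · simpa using he.gap_param.right
  have hsum := Finset.card_eq_sum_card_fiberwise hmaps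
  have hfib : ∀ v, halfEdges P.skeleton U v = ({h ∈ H | end' h = v} : Finset _) := by
    intro v
    ext ⟨e, b⟩
    simp [halfEdges, H, hEdef, end']
  have hfinite : ∀ v, (halfEdges P.skeleton U v).Finite := fun v => by
    rw [hfib v]; exact Finset.finite_toSet _
  have hVfin : P.vertices.Finite := hU.finite.subset hU.vertices_subset
  have hle : ∀ v ∈ UF, 2 + (if v ∈ P.vertices then 1 else 0) ≤ {h ∈ H | end' h = v}.card := by
    intro v hv
    have hv' : v ∈ U := by simpa [hUF] using hv
    rw [← Set.ncard_coe_finset, ← hfib v]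
    split_ifs with h
    · exact hU.three_le_ncard_halfEdges h (hfinite v)
    · exact hU.two_le_ncard_halfEdges hv' (hfinite v)
  have h1 := Finset.sum_le_sum hle
  rw [← hsum, Finset.sum_add_distrib, Finset.sum_const, Finset.sum_ite, Finset.sum_const,
    Finset.sum_const_zero, add_zero, smul_eq_mul, smul_eq_mul, mul_one] at h1
  have h2 : (UF.filter fun v => v ∈ P.vertices).card = P.vertices.ncard := by
    rw [← Set.ncard_coe_finset]
    congr 1
    ext v
    simp only [hUF, Finset.coe_filter, Finite.mem_toFinset, Set.mem_ofPred_eq, and_iff_right_iff_imp]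
    exact fun h => hU.vertices_subset h
  have h3 : H.card = 2 * E.card := by
    simp [H, mul_comm]
  have h4 : E.card = {e | IsEdge P.skeleton U e}.ncard := by
    rw [hEdef, Set.ncard_eq_toFinset_card _ hEfin]
  have h5 : UF.card = U.ncard := by rw [hUF, Set.ncard_eq_toFinset_card _ hU.finite]
  omega

end DiscTiling.IsNet

end

noncomputable section

/-! ### Lengths of pieces -/

theorem edgeSum_mono {S U A B : Set ℂ} (w : Set ℂ → ℝ≥0∞) (h : A ⊆ B) :
    edgeSum S U w A ≤ edgeSum S U w B :=
  ENNReal.tsum_comp_le_tsum_of_injective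
    (f := fun e : edgesIn S U A => (⟨e, e.2.1, e.2.2.trans h⟩ : edgesIn S U B))
    (fun _ _ hee => Subtype.ext (congrArg (fun x : edgesIn S U B => (x : Set ℂ)) hee)) fun e => w e

theorem eVariationOn_Ioo_le {C : Type*} [PseudoEMetricSpace C] {f : ℝ → C} {a b : ℝ} {D : ℝ≥0∞}
    (h : ∀ c d, c ≤ d → Icc c d ⊆ Ioo a b → eVariationOn f (Icc c d) ≤ D) :
    eVariationOn f (Ioo a b) ≤ D := by
  rw [eVariationOn.eq_biSup_inter_Icc]
  refine iSup₂_le ?_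
  rintro ⟨c, d⟩ ⟨hc, hd, hcd⟩
  refine (eVariationOn.mono f inter_subset_right).trans (h c d hcd fun x hx => ?_)
  exact ⟨hc.1.trans_le hx.1, hx.2.trans_lt hd.2⟩

theorem continuous_comp_exp {X : Type*} [MetricSpace X] (γ : C(Circle, X)) :
    Continuous fun t : ℝ => γ (Circle.exp t) :=
  γ.continuous.comp Circle.exp.continuous

theorem le_arcLength {X : Type*} [MetricSpace X] (γ : C(Circle, X)) {s : Set ℂ} {a b : ℝ}
    (hab : a ≤ b) (hb : b ≤ a + 2 * Real.pi) (h : ∀ t ∈ Icc a b, circlePt t ∈ s) :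
    eVariationOn (fun t : ℝ => γ (Circle.exp t)) (Icc a b) ≤ arcLength γ s :=
  le_iSup_of_le a (le_iSup_of_le b (le_iSup_of_le hab (le_iSup_of_le hb (le_iSup_of_le h le_rfl))))

/-- Edges do not contain their end points; by continuity these contribute nothing to the variation.
-/
theorem le_arcLength_of_Ioo {X : Type*} [MetricSpace X] (γ : C(Circle, X)) {s : Set ℂ} {a b : ℝ}
    (hab : a < b) (hb : b ≤ a + 2 * Real.pi) (h : ∀ t ∈ Ioo a b, circlePt t ∈ s) :
    eVariationOn (fun t : ℝ => γ (Circle.exp t)) (Icc a b) ≤ arcLength γ s := by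
  rw [← eVariationOn_Ioo_eq_Icc hab (continuous_comp_exp γ).continuousOn]
  refine eVariationOn_Ioo_le fun c d hcd hsub => le_arcLength γ hcd ?_ fun t ht => h t (hsub ht)
  have h1 := hsub (left_mem_Icc.2 hcd)
  have h2 := hsub (right_mem_Icc.2 hcd)
  linarith [h1.1, h2.2]

namespace LoopPartition

variable {X : Type*} [MetricSpace X] {k : ℕ} {P : DiscPartition k} {γ : C(Circle, X)}
  (Q : LoopPartition P γ)

open Classical in
/-- The common extension of the vertex map and the loop. -/
def extend (p : ℂ) : X :=
  if h : p ∈ P.vertices then Q.toFun ⟨p, h⟩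
  else if h : p ∈ sphere (0 : ℂ) 1 then γ ⟨p, h⟩ else γ 1

theorem extend_vertex {p : ℂ} (h : p ∈ P.vertices) : Q.extend p = Q.toFun ⟨p, h⟩ := dif_pos h

theorem extend_circle (z : Circle) : Q.extend z = γ z := by
  unfold extend
  split_ifs with h h'
  · exact Q.eq_loop z h
  · rfl
  · exact absurd z.2 h'

theorem extend_circlePt (t : ℝ) : Q.extend (circlePt t) = γ (Circle.exp t) := Q.extend_circle _

variable {W : Set ℂ}

theorem isNet (P : DiscPartition k) (hW : W.Finite) (hWs : W ⊆ sphere 0 1) (h1 : 1 ∈ W) :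
    P.IsNet (P.vertices ∪ W) where
  finite := P.finite_vertices.union hW
  subset := union_subset (fun _ h => h.1) (hWs.trans P.sphere_subset)
  vertices_subset := subset_union_left
  one_mem := Or.inr h1

theorem edgeSum_arc_le {U : Set ℂ} (hU : P.IsNet U) {a b : ℝ}
    (h : Strand P.skeleton U circlePt a b) :
    edgeSum P.skeleton U (endDist P.skeleton U Q.extend) (circlePt '' Ioo a b) ≤
      eVariationOn (fun t : ℝ => γ (Circle.exp t)) (Icc a b) := by
  refine h.edgeSum_le hU.locallyLine hU.finite fun a b h => ?_
  rw [h.endDist_eq, Q.extend_circlePt, Q.extend_circlePt]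
  exact eVariationOn.edist_le (fun t : ℝ => γ (Circle.exp t)) (left_mem_Icc.2 h.lt.le)
    (right_mem_Icc.2 h.lt.le)

/-- Chords are at most arcs, so only the shape of `s` matters. If the circle carries a vertex, `s`
is an open arc between consecutive vertices; otherwise `s` contains the whole circle, which is why
`arcLength` admits a full turn. -/
theorem edgeSum_le_arcLength {U : Set ℂ} (hU : P.IsNet U) {s : Set ℂ} {p : ℂ} (hp : p ∈ s)
    (hs : s = connectedComponentIn (P.skeleton \ P.vertices) p) (hsub : s ⊆ sphere 0 1) :
    edgeSum P.skeleton U (endDist P.skeleton U Q.extend) s ≤ arcLength γ s := by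
  have hsV : s ⊆ P.skeleton \ P.vertices := hs ▸ connectedComponentIn_subset _ _
  have hsc : IsPreconnected s := hs ▸ isPreconnected_connectedComponentIn
  have hmax : ∀ {A : Set ℂ}, IsPreconnected A → p ∈ A → A ⊆ P.skeleton \ P.vertices → A ⊆ s :=
    fun hA hpA hAS => hs ▸ hA.subset_connectedComponentIn hpA hAS
  by_cases hV : ∃ t, circlePt t ∈ P.vertices
  · obtain ⟨a, ha⟩ := hV
    have hstr : Strand P.skeleton P.vertices circlePt a (a + 2 * Real.pi) :=
      ⟨by linarith [Real.two_pi_pos], continuous_circlePt.continuousOn, circlePt_injOn a,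
        fun t _ => P.circle_subset none ⟨t, rfl⟩, ha, by rw [circlePt_add_two_pi]; exact ha⟩
    obtain ⟨t, ht, rfl⟩ := exists_circlePt_eq a (z := p) (by simpa using hsub hp)
    obtain ⟨a', b', hg, hm, h1, h2⟩ := hstr.exists_gap P.finite_vertices t
      (Ico_subset_Icc_self ht) (hsV hp).2
    have hse : s ⊆ circlePt '' Ioo a' b' :=
      hg.isEdge.subset_of_meets (P.locallyLine le_rfl) hsc hsV ⟨_, hp, t, hm, rfl⟩
    have hes : circlePt '' Ioo a' b' ⊆ s :=
      hmax hg.isEdge.isPreconnected ⟨t, hm, rfl⟩ hg.isEdge.subset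
    refine (edgeSum_mono _ hse).trans ((Q.edgeSum_arc_le hU
      (hg.toStrand.mono hU.vertices_subset)).trans ?_)
    exact le_arcLength_of_Ioo γ hg.lt (by linarith) fun t ht => hes ⟨t, ht, rfl⟩
  · push Not at hV
    have hsph : sphere (0 : ℂ) 1 ⊆ s := by
      refine hmax ?_ (hsub hp) fun z hz => ⟨P.sphere_subset hz, ?_⟩
      · rw [← P.circle_none]; exact P.isPreconnected_circle none
      · rw [← DiscTiling.range_circlePt] at hz
        obtain ⟨t, rfl⟩ := hz
        exact hV t
    obtain ⟨a, -, h⟩ := hU.exists_strand none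
    have h1 := DiscTiling.IsNet.edgeSum_circle h (endDist P.skeleton U Q.extend)
    rw [P.circle_none] at h1
    refine (edgeSum_mono _ hsub).trans (h1.trans_le ((Q.edgeSum_arc_le hU h).trans ?_))
    exact le_arcLength γ h.lt.le le_rfl fun t _ => hsph (circlePt_mem_sphere t)

/-- Adding corners on the unit circle and replacing arcs by chords does not lengthen a piece. The
refined edges are grouped by the edge of the partition containing them: on the circle a group is
bounded by the arc length, and off the circle no corner subdivides an edge, so a group has at most
one member. -/
theorem edgeSum_bdry_le (hW : W.Finite) (hWs : W ⊆ sphere 0 1) (h1 : 1 ∈ W) (i : Fin k) :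
    edgeSum P.skeleton (P.vertices ∪ W) (endDist P.skeleton (P.vertices ∪ W) Q.extend)
      (P.bdry i) ≤ Q.pieceLength i := by
  have hU := isNet P hW hWs h1
  set S := P.skeleton
  set U := P.vertices ∪ W with hUdef
  set w := endDist S U Q.extend
  have hcomp : ∀ e : edgesIn S U (P.bdry i),
      ∃ s : {s : Set ℂ // s ∈ P.edges ∧ s ⊆ P.bdry i}, (e : Set ℂ) ⊆ s := by
    rintro ⟨e, he, hei⟩
    obtain ⟨p, hp⟩ := he.nonempty
    have heV : e ⊆ S \ P.vertices := he.subset.trans (sdiff_subset_sdiff_right hU.vertices_subset)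
    refine ⟨⟨connectedComponentIn (S \ P.vertices) p, ⟨p, heV hp, rfl⟩, ?_⟩, ?_⟩
    · rw [← P.circle_some]
      refine P.subset_circle isPreconnected_connectedComponentIn
        (connectedComponentIn_subset _ _) ⟨p, mem_connectedComponentIn (heV hp), ?_⟩
      rw [P.circle_some]; exact hei hp
    · exact he.isPreconnected.subset_connectedComponentIn hp heV
  choose F hF using hcomp
  rw [edgeSum, ← (Equiv.sigmaFiberEquiv F).tsum_eq, ENNReal.tsum_sigma', pieceLength]
  refine ENNReal.tsum_le_tsum fun s => ?_
  obtain ⟨p, hp, hs⟩ := s.2.1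
  have hps : p ∈ (s : Set ℂ) := by rw [hs]; exact mem_connectedComponentIn hp
  have hsV : (s : Set ℂ) ⊆ S \ P.vertices := hs ▸ connectedComponentIn_subset _ _
  have hsc : IsPreconnected (s : Set ℂ) := hs ▸ isPreconnected_connectedComponentIn
  show ∑' e : {e // F e = s}, w e.1 ≤ _
  unfold edgeLength
  split_ifs with hsub
  · refine le_trans ?_ (Q.edgeSum_le_arcLength hU hps hs hsub)
    exact ENNReal.tsum_comp_le_tsum_of_injective
      (f := fun e : {e // F e = s} =>
        (⟨e.1, e.1.2.1, (hF e.1).trans (congrArg Subtype.val e.2).subset⟩ : edgesIn S U s))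
      (fun e e' hee => Subtype.ext (Subtype.ext
        (congrArg (fun x : edgesIn S U s => (x : Set ℂ)) hee))) fun e => w e
  · have hnone : ∀ x ∈ (s : Set ℂ), x ∉ sphere (0 : ℂ) 1 := fun x hx hxs => by
      rw [← P.circle_none] at hxs hsub
      exact hsub (P.subset_circle hsc hsV ⟨x, hx, hxs⟩)
    have hsU : (s : Set ℂ) ⊆ S \ U := fun x hx => ⟨(hsV hx).1, by
      rintro (h | h)
      · exact (hsV hx).2 h
      · exact hnone x hx (hWs h)⟩
    have heq : ∀ e : {e // F e = s}, (e.1 : Set ℂ) = s := fun e => by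
      have hes : (e.1 : Set ℂ) ⊆ s := (hF e.1).trans (congrArg Subtype.val e.2).subset
      obtain ⟨x, hx⟩ := e.1.2.1.nonempty
      exact Subset.antisymm hes
        (e.1.2.1.subset_of_meets hU.locallyLine hsc hsU ⟨x, hes hx, hx⟩)
    have : Subsingleton {e // F e = s} :=
      ⟨fun e e' => Subtype.ext (Subtype.ext ((heq e).trans (heq e').symm))⟩
    rcases isEmpty_or_nonempty {e // F e = s} with hemp | ⟨⟨e⟩⟩
    · simp
    · rw [tsum_eq_single e fun e' h => absurd (Subsingleton.elim e' e) h]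
      have hg := e.1.2.1.gap_param
      -- Near a corner that is not a vertex the skeleton is contained in the unit circle, so an
      -- inner edge cannot end there.
      have hends : ∀ x, x ∈ closure (s : Set ℂ) → x ∈ U → x ∈ P.vertices := by
        intro x hx hxU
        by_contra hxV
        have hxs : x ∈ P.circle none := by
          rw [P.circle_none]; exact hWs (hxU.resolve_left hxV)
        obtain ⟨O, hO, hxO, hOS⟩ := P.exists_isOpen_circle hxs hxV
        obtain ⟨y, hyO, hys⟩ := mem_closure_iff.1 hx O hO hxO
        have := hOS ⟨hyO, (hsV hys).1⟩
        rw [P.circle_none] at this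
        exact hnone y hys this
      have hcl := hg.closure_inter
      rw [← e.1.2.1.eq_param, heq e] at hcl
      have h0 : param S U s 0 ∈ closure (s : Set ℂ) ∩ U := by rw [hcl]; exact Or.inl rfl
      have h1 : param S U s 1 ∈ closure (s : Set ℂ) ∩ U := by rw [hcl]; exact Or.inr rfl
      rw [heq e]
      show edist (Q.extend (param S U s 0)) (Q.extend (param S U s 1)) ≤ _
      rw [Q.extend_vertex (hends _ h0.1 h0.2), Q.extend_vertex (hends _ h1.1 h1.2)]
      exact le_iSup_of_le ⟨_, hends _ h0.1 h0.2⟩ (le_iSup_of_le ⟨_, hends _ h1.1 h1.2⟩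
        (le_iSup_of_le h0.1 (le_iSup_of_le h1.1 le_rfl)))

end LoopPartition

end

noncomputable section

/-! ### Combinatorial types of partitions -/

/-- A finite record of a partition: the end points of the edges, the edges on the boundary of each
piece and on each of the `N` arcs of the unit circle, and the `N` corners. -/
structure CellType (k R S N : ℕ) where
  ends : Fin S → Fin R × Fin R
  piece : Fin k → Finset (Fin S)
  side : Fin N → Finset (Fin S)
  corner : Fin N → Fin R

/-- Finiteness is what allows the ultrafilter to single out one type. -/
instance (k R S N : ℕ) : Finite (CellType k R S N) :=
  Finite.of_injective
    (fun c : CellType k R S N => (c.ends, c.piece, c.side, c.corner)) fun c c' h => by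
      cases c; cases c'; simpa using h

/-- The `j`-th of `N` equally spaced angles. -/
def cornerAngle (N j : ℕ) : ℝ := 2 * Real.pi * j / N

theorem cornerAngle_zero (N : ℕ) : cornerAngle N 0 = 0 := by simp [cornerAngle]

theorem cornerAngle_self {N : ℕ} (hN : 0 < N) : cornerAngle N N = 2 * Real.pi := by
  have : (N : ℝ) ≠ 0 := by positivity
  unfold cornerAngle; field_simp

theorem cornerAngle_lt {N : ℕ} (hN : 0 < N) (j : ℕ) : cornerAngle N j < cornerAngle N (j + 1) := by
  have : (0 : ℝ) < N := by positivity
  have := Real.pi_pos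
  unfold cornerAngle; gcongr; norm_num

theorem cornerAngle_le {N : ℕ} (hN : 0 < N) (j : ℕ) :
    cornerAngle N (j + 1) ≤ cornerAngle N j + 2 * Real.pi := by
  have h : (0 : ℝ) < N := by positivity
  have h1 : (1 : ℝ) ≤ N := by exact_mod_cast hN
  have := Real.pi_pos
  have e : cornerAngle N (j + 1) = cornerAngle N j + 2 * Real.pi / N := by
    unfold cornerAngle; push_cast; field_simp
  rw [e]
  gcongr
  exact div_le_self (by positivity) h1

namespace CellType

variable {k R S N : ℕ} (c : CellType k R S N)

/-- The total length of some edges when the vertices are mapped by `q`. -/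
def length {Y : Type*} [MetricSpace Y] (q : Fin R → Y) (T : Finset (Fin S)) : ℝ :=
  ∑ s ∈ T, dist (q (c.ends s).1) (q (c.ends s).2)

/-- Some partition of the disc has this type: maps of its vertices to geodesic spaces extend to the
skeleton, with edges of the expected lengths. -/
def Realizable.{u} (c : CellType k R S N) : Prop :=
  ∃ P : DiscTiling k, ∀ (Y : Type u) [MetricSpace Y], IsGeodesicSpace Y → ∀ q : Fin R → Y,
    ∃ f : ℂ → Y, ContinuousOn f P.skeleton ∧
      (∀ j : Fin N, f (circlePt (cornerAngle N j)) = q (c.corner j)) ∧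
      (∀ i, eVariationOn (f ∘ P.circ (some i)) (Icc 0 (2 * Real.pi)) ≤
        ENNReal.ofReal (c.length q (c.piece i))) ∧
      ∀ j : Fin N, eVariationOn (f ∘ circlePt) (Icc (cornerAngle N j) (cornerAngle N (j + 1))) ≤
        ENNReal.ofReal (c.length q (c.side j))

end CellType

theorem dist_le_of_eVariationOn_circ {k : ℕ} {P : DiscTiling k} {Y : Type*} [MetricSpace Y]
    {f : ℂ → Y} {δ : ℝ} (hδ : 0 ≤ δ)
    (h : ∀ i, eVariationOn (f ∘ P.circ (some i)) (Icc 0 (2 * Real.pi)) ≤ ENNReal.ofReal δ) :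
    ∀ p ∈ P.skeleton, ∀ q ∈ P.skeleton, dist (f p) (f q) ≤ k * δ := by
  refine P.dist_le_of_bdry fun i p hp q hq => ?_
  rw [← P.circle_some, P.circle_eq_image _ 0, zero_add] at hp hq
  obtain ⟨s, hs, rfl⟩ := hp
  obtain ⟨t, ht, rfl⟩ := hq
  have := (eVariationOn.edist_le (f ∘ P.circ (some i)) hs ht).trans (h i)
  rwa [edist_dist, ENNReal.ofReal_le_ofReal_iff hδ] at this

/-- There are at most `2 * k` vertices, `N` corners and `k` more edges than points of the net.
Fixing `R` and `S` beforehand puts the types of all loops with the same `k` and `N` into one finite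
set. -/
theorem exists_cellType.{u} {X : Type u} [MetricSpace X] (hX : IsGeodesicSpace X) {k R S N : ℕ}
    (hN : 0 < N) (hR : 2 * k + N ≤ R) (hS : 3 * k + N ≤ S) {γ : C(Circle, X)}
    {P : DiscPartition k} (Q : LoopPartition P γ) {δ : ℝ} (hδ : 0 ≤ δ)
    (hQ : ∀ i, Q.pieceLength i ≤ ENNReal.ofReal δ) :
    ∃ c : CellType k R S N, CellType.Realizable.{u} c ∧ ∃ q : Fin R → X,
      (∀ j : Fin N, q (c.corner j) = γ (Circle.exp (cornerAngle N j))) ∧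
      (∀ r, dist (q r) (γ 1) ≤ k * δ) ∧
      (∀ i, c.length q (c.piece i) ≤ δ) ∧
      ∀ j : Fin N, ENNReal.ofReal (c.length q (c.side j)) ≤
        eVariationOn (fun t : ℝ => γ (Circle.exp t))
          (Icc (cornerAngle N j) (cornerAngle N (j + 1))) := by
  classical
  set W : Set ℂ := range fun j : Fin N => circlePt (cornerAngle N j) with hWdef
  have hWfin : W.Finite := finite_range _
  have hWs : W ⊆ sphere 0 1 := by rintro _ ⟨j, rfl⟩; exact circlePt_mem_sphere _
  have h1 : (1 : ℂ) ∈ W := ⟨⟨0, hN⟩, by simp [cornerAngle_zero, circlePt_zero]⟩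
  have hWcard : W.ncard ≤ N := by
    have := ncard_image_le (f := fun j : Fin N => circlePt (cornerAngle N j)) (finite_univ)
    rwa [image_univ, ncard_univ, Nat.card_fin] at this
  set U := P.vertices ∪ W with hUdef
  have hU : P.IsNet U := LoopPartition.isNet P hWfin hWs h1
  set Sk := P.skeleton
  have hVcard : P.vertices.ncard ≤ 2 * k :=
    (LoopPartition.isNet P (finite_singleton 1) (by simp) rfl).vertices_le
  have hUcard : U.ncard ≤ R := (ncard_union_le _ _).trans (by omega)
  have hUcard' : U.ncard ≤ 2 * k + N := (ncard_union_le _ _).trans (by omega)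
  have hEcard : {e | IsEdge Sk U e}.ncard ≤ S := hU.edges_le.trans (by omega)
  have key : ∀ {α : Type} {A : Set α} {n : ℕ}, A.Finite → A.ncard ≤ n → 0 < n →
      ∃ f : α → Fin n, InjOn f A := by
    intro α A n hA hn h0
    have : Nonempty (Fin n) := ⟨⟨0, h0⟩⟩
    obtain ⟨f, -, hf⟩ := hA.exists_injOn_of_encard_le (t := (univ : Set (Fin n))) (by
      rw [← hA.cast_ncard_eq, encard_univ]; simpa using hn)
    exact ⟨f, hf⟩
  obtain ⟨v, hv⟩ := key hU.finite hUcard (by omega)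
  obtain ⟨ε, hε⟩ := key hU.finite_edges hEcard (by omega)
  set E := {e | IsEdge Sk U e}
  set E' : Fin S → Set ℂ := Function.invFunOn ε E
  have hE' : ∀ e ∈ E, E' (ε e) = e := fun e he => hε.leftInvOn_invFunOn he
  have hfin : ∀ A, (ε '' edgesIn Sk U A).Finite := fun A => toFinite _
  have hcorner : ∀ j : Fin N, circlePt (cornerAngle N j) ∈ U := fun j => Or.inr ⟨j, rfl⟩
  have hstrand : ∀ j : Fin N,
      Strand Sk U circlePt (cornerAngle N j) (cornerAngle N (j + 1)) := by
    intro j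
    refine ⟨cornerAngle_lt hN j, continuous_circlePt.continuousOn,
      (circlePt_injOn (cornerAngle N j)).mono (Ico_subset_Ico_right (cornerAngle_le hN j)),
      fun t _ => P.circle_subset none ⟨t, rfl⟩, hcorner j, ?_⟩
    by_cases hj : (j : ℕ) + 1 < N
    · exact hcorner ⟨j + 1, hj⟩
    · have : (j : ℕ) + 1 = N := by omega
      have h2 := circlePt_add_two_pi 0
      rw [zero_add] at h2
      rw [this, cornerAngle_self hN, h2, circlePt_zero]; exact hU.one_mem
  let c : CellType k R S N :=
    { ends := fun s => (v (param Sk U (E' s) 0), v (param Sk U (E' s) 1))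
      piece := fun i => (hfin (P.circle (some i))).toFinset
      side := fun j =>
        (hfin (circlePt '' Ioo (cornerAngle N j) (cornerAngle N (j + 1)))).toFinset
      corner := fun j => v (circlePt (cornerAngle N j)) }
  have hsum : ∀ {Y : Type u} [MetricSpace Y] (q : Fin R → Y) (A : Set ℂ),
      ENNReal.ofReal (c.length q (hfin A).toFinset) =
        edgeSum Sk U (endDist Sk U fun p => q (v p)) A := by
    intro Y _ q A
    rw [CellType.length, ENNReal.ofReal_sum_of_nonneg fun _ _ => dist_nonneg, edgeSum]
    have h2 := tsum_image (g := ε) (s := edgesIn Sk U A)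
      (fun s => edist (q (c.ends s).1) (q (c.ends s).2)) (hε.mono fun e he => he.1)
    have h3 : ∀ e : edgesIn Sk U A, edist (q (c.ends (ε e)).1) (q (c.ends (ε e)).2) =
        endDist Sk U (fun p => q (v p)) e := by
      intro e
      simp only [c, hE' e e.2.1, endDist]
    have h4 := Finset.tsum_subtype' (hfin A).toFinset
      fun s => edist (q (c.ends s).1) (q (c.ends s).2)
    have h5 := tsum_congr_set_coe (fun s => edist (q (c.ends s).1) (q (c.ends s).2))
      (hfin A).coe_toFinset
    rw [← tsum_congr h3, ← h2, ← h5, h4]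
    exact Finset.sum_congr rfl fun s _ => (edist_dist _ _).symm
  refine ⟨c, ⟨P.toDiscTiling, fun Y _ hY q => ?_⟩, ?_⟩
  · obtain ⟨f, hf, hfU, hfs, hfc⟩ := hU.exists_geodesic_map hY fun p => q (v p)
    refine ⟨f, hf, fun j => hfU _ (hcorner j), fun i => ?_, fun j => ?_⟩
    · exact (hfc (some i)).trans_eq (hsum q _).symm
    · exact (hfs _ _ _ (hstrand j)).trans_eq (hsum q _).symm
  -- Labels that number no point go to `γ 1`, so that the distance bound holds for all of them.
  · let q : Fin R → X := fun r =>
      if r ∈ v '' U then Q.extend (Function.invFunOn v U r) else γ 1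
    have hq : ∀ p ∈ U, q (v p) = Q.extend p := fun p hp => by
      simp only [q, if_pos (mem_image_of_mem v hp), hv.leftInvOn_invFunOn hp]
    have hend : ∀ A, edgeSum Sk U (endDist Sk U fun p => q (v p)) A =
        edgeSum Sk U (endDist Sk U Q.extend) A := by
      intro A
      refine tsum_congr fun e => ?_
      have hg := e.2.1.gap_param
      simp only [endDist, hq _ hg.left, hq _ hg.right]
    have hpiece : ∀ i, edgeSum Sk U (endDist Sk U Q.extend) (P.circle (some i)) ≤
        ENNReal.ofReal δ := fun i => by
      rw [P.circle_some]
      exact (Q.edgeSum_bdry_le hWfin hWs h1 i).trans (hQ i)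
    refine ⟨q, fun j => ?_, fun r => ?_, fun i => ?_, fun j => ?_⟩
    · rw [← Q.extend_circlePt]; exact hq _ (hcorner j)
    · by_cases hr : r ∈ v '' U
      · obtain ⟨p, hp, rfl⟩ := hr
        -- A geodesic realization in `X` bounds the spread of the vertices: each tile boundary has
        -- diameter at most `δ`, and the tiles form a connected chain.
        obtain ⟨f, -, hfU, -, hfc⟩ := hU.exists_geodesic_map hX Q.extend
        have := dist_le_of_eVariationOn_circ (f := f) hδ
          (fun i => (hfc (some i)).trans (hpiece i)) p (hU.subset hp) 1 (hU.subset hU.one_mem)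
        rw [hfU _ hp, hfU _ hU.one_mem] at this
        rw [hq _ hp]
        have h3 := Q.extend_circle 1
        rw [Circle.coe_one] at h3
        rwa [← h3]
      · simp only [q, if_neg hr, dist_self]; positivity
    · have h3 := hsum q (P.circle (some i))
      rw [hend] at h3
      exact (ENNReal.ofReal_le_ofReal_iff hδ).1 (h3.trans_le (hpiece i))
    · have h3 := hsum q (circlePt '' Ioo (cornerAngle N j) (cornerAngle N (j + 1)))
      rw [hend] at h3
      exact h3.trans_le (Q.edgeSum_arc_le hU (hstrand j))

end

noncomputable section

/-! ### Polygonal loops -/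

theorem IsGeodesicSpace.exists_path {Y : Type*} [MetricSpace Y] (hY : IsGeodesicSpace Y)
    {a b : ℝ} (hab : a < b) (x y : Y) : ∃ γ : ℝ → Y, γ a = x ∧ γ b = y ∧
      ContinuousOn γ (Icc a b) ∧ eVariationOn γ (Icc a b) ≤ edist x y := by
  obtain ⟨c, h0, h1, h⟩ := hY.exists_segment x y
  have hba : 0 < b - a := sub_pos.2 hab
  have hm : MapsTo (fun t => (t - a) / (b - a)) (Icc a b) (Icc 0 1) := fun t ht =>
    ⟨div_nonneg (sub_nonneg.2 ht.1) hba.le,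
      (div_le_one hba).2 (sub_le_sub_right ht.2 _)⟩
  refine ⟨c ∘ fun t => (t - a) / (b - a), by simpa using h0, ?_,
    (continuousOn_of_dist_eq dist_nonneg h).comp (by fun_prop) hm, ?_⟩
  · simp only [Function.comp_apply, div_self hba.ne', h1]
  · refine (eVariationOn.comp_le_of_monotoneOn c _ (fun s _ t _ hst => ?_) hm).trans ?_
    · exact div_le_div_of_nonneg_right (sub_le_sub_right hst _) hba.le
    · rw [edist_dist]; exact eVariationOn_le_of_dist_eq dist_nonneg h

theorem IsGeodesicSpace.exists_polygonal {Y : Type*} [MetricSpace Y] (hY : IsGeodesicSpace Y)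
    {a : ℕ → ℝ} (ha : StrictMono a) (y : ℕ → Y) (n : ℕ) :
    ∃ η : ℝ → Y, ContinuousOn η (Icc (a 0) (a n)) ∧ (∀ j ≤ n, η (a j) = y j) ∧
      ∀ j < n, eVariationOn η (Icc (a j) (a (j + 1))) ≤ edist (y j) (y (j + 1)) := by
  induction n with
  | zero => exact ⟨fun _ => y 0, continuousOn_const, fun j hj => by simp [Nat.le_zero.1 hj], by simp⟩
  | succ n ih =>
    obtain ⟨η, hη, hv, hl⟩ := ih
    obtain ⟨c, h0, h1, hc, hcl⟩ := hY.exists_path (ha (Nat.lt_succ_self n)) (y n) (y (n + 1))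
    let η' : ℝ → Y := fun t => if t ≤ a n then η t else c t
    have e1 : ∀ t ≤ a n, η' t = η t := fun t ht => if_pos ht
    have e2 : EqOn η' c (Icc (a n) (a (n + 1))) := fun t ht => by
      rcases ht.1.eq_or_lt with h | h
      · rw [← h, e1 _ le_rfl, hv n le_rfl, h0]
      · exact if_neg h.not_ge
    have hmono := ha.monotone
    refine ⟨η', ?_, fun j hj => ?_, fun j hj => ?_⟩
    · rw [← Icc_union_Icc_eq_Icc (hmono n.zero_le) (hmono n.le_succ)]
      exact (hη.congr fun t ht => e1 t ht.2).union_of_isClosed (hc.congr e2) isClosed_Icc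
        isClosed_Icc
    · rcases hj.eq_or_lt with rfl | hj
      · rw [e2 (right_mem_Icc.2 (hmono n.le_succ)), h1]
      · rw [e1 _ (hmono (Nat.lt_succ_iff.1 hj)), hv j (Nat.lt_succ_iff.1 hj)]
    · rcases (Nat.lt_succ_iff.1 hj).eq_or_lt with rfl | hj
      · rwa [eVariationOn.congr e2]
      · rw [eVariationOn.congr fun t ht => e1 t (ht.2.trans (hmono hj))]
        exact hl j hj

theorem cornerAngle_strictMono {N : ℕ} (hN : 0 < N) : StrictMono (cornerAngle N) :=
  strictMono_nat_of_lt_succ (cornerAngle_lt hN)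

theorem cornerAngle_mem {N : ℕ} (hN : 0 < N) {j : ℕ} (hj : j ≤ N) :
    cornerAngle N j ∈ Icc 0 (2 * Real.pi) := by
  have ha := (cornerAngle_strictMono hN).monotone
  rw [← cornerAngle_zero N, ← cornerAngle_self hN]
  exact ⟨ha j.zero_le, ha hj⟩

theorem IsGeodesicSpace.exists_polygonal_sphere {Y : Type*} [MetricSpace Y]
    (hY : IsGeodesicSpace Y) {N : ℕ} (hN : 0 < N) {y : ℕ → Y} (hy : y N = y 0) :
    ∃ H : ℂ → Y, ContinuousOn H (sphere 0 1) ∧ (∀ j ≤ N, H (circlePt (cornerAngle N j)) = y j) ∧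
      ∀ j < N, eVariationOn (H ∘ circlePt) (Icc (cornerAngle N j) (cornerAngle N (j + 1))) ≤
        edist (y j) (y (j + 1)) := by
  obtain ⟨η, hη, hv, hl⟩ := hY.exists_polygonal (cornerAngle_strictMono hN) y N
  rw [cornerAngle_zero, cornerAngle_self hN] at hη
  obtain ⟨H, hH, hHη⟩ := exists_continuousOn_sphere hη (by
    have h0 := hv 0 N.zero_le
    have h1 := hv N le_rfl
    rw [cornerAngle_zero] at h0
    rw [cornerAngle_self hN] at h1
    rw [h0, h1, hy])
  refine ⟨H, hH, fun j hj => by rw [hHη _ (cornerAngle_mem hN hj), hv j hj], fun j hj => ?_⟩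
  refine le_trans (eVariationOn.congr fun t ht => ?_).le (hl j hj)
  exact hHη t ⟨(cornerAngle_mem hN hj.le).1.trans ht.1, ht.2.trans (cornerAngle_mem hN hj).2⟩

theorem IsGeodesicSpace.exists_polygonal_loop {X : Type*} [MetricSpace X]
    (hX : IsGeodesicSpace X) {N : ℕ} (hN : 0 < N) {y : ℕ → X} (hy : y N = y 0) :
    ∃ γ : C(Circle, X), (∀ j ≤ N, γ (Circle.exp (cornerAngle N j)) = y j) ∧
      (∀ j < N, eVariationOn (fun t : ℝ => γ (Circle.exp t))
        (Icc (cornerAngle N j) (cornerAngle N (j + 1))) = edist (y j) (y (j + 1))) ∧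
      loopLength γ = ENNReal.ofReal (∑ j ∈ Finset.range N, dist (y j) (y (j + 1))) := by
  have ha := cornerAngle_strictMono hN
  obtain ⟨H, hH, hcor, hl⟩ := hX.exists_polygonal_sphere hN hy
  let γ : C(Circle, X) := ⟨fun z => H z, hH.comp_continuous continuous_subtype_val fun z => z.2⟩
  have hside : ∀ j < N, eVariationOn (fun t : ℝ => γ (Circle.exp t))
      (Icc (cornerAngle N j) (cornerAngle N (j + 1))) = edist (y j) (y (j + 1)) := by
    intro j hj
    refine le_antisymm (hl j hj) ?_
    rw [← hcor j hj.le, ← hcor (j + 1) hj]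
    exact eVariationOn.edist_le (fun t : ℝ => γ (Circle.exp t))
      (left_mem_Icc.2 (ha j.lt_succ_self).le) (right_mem_Icc.2 (ha j.lt_succ_self).le)
  refine ⟨γ, hcor, hside, ?_⟩
  have h := (eVariationOn.sum' (fun t : ℝ => γ (Circle.exp t)) ha.monotone (n := N)).symm
  rw [cornerAngle_zero, cornerAngle_self hN] at h
  rw [loopLength, h, ENNReal.ofReal_sum_of_nonneg fun _ _ => dist_nonneg]
  exact Finset.sum_congr rfl fun j hj => by
    rw [hside j (Finset.mem_range.1 hj), edist_dist]

theorem exists_partition_of_partitionNumber_le {X : Type*} [MetricSpace X] {γ : C(Circle, X)}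
    {δ : ℝ≥0∞} {K : ℕ} (h : partitionNumber γ δ ≤ K) :
    ∃ k ≤ K, ∃ (P : DiscPartition k) (Q : LoopPartition P γ), Q.mesh < δ := by
  by_contra hc
  push Not at hc
  have : ((K + 1 : ℕ) : ℕ∞) ≤ partitionNumber γ δ := by
    refine le_iInf₂ fun k hk => ?_
    obtain ⟨P, Q, hQ⟩ := hk
    have : K < k := by
      by_contra hkK
      exact (hc k (not_lt.1 hkK) P Q).not_gt hQ
    exact_mod_cast this
  have h2 := this.trans h
  norm_cast at h2
  omega

/-- A map of the vertices of a partition into at most `K` pieces to `X` that sends the corners to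
the closed polygon `y` of length `D` and has pieces of at most half the length. -/
structure CellType.Fits {X : Type*} [MetricSpace X] {k R S N : ℕ} (c : CellType k R S N) (K : ℕ)
    (y : ℕ → X) (D : ℝ) (q : Fin R → X) : Prop where
  corner : ∀ j : Fin N, q (c.corner j) = y j
  dist_le : ∀ r, dist (q r) (y 0) ≤ K * D
  piece_le : ∀ i, c.length q (c.piece i) ≤ D / 2
  side_le : ∀ j : Fin N, c.length q (c.side j) ≤ dist (y j) (y (j + 1))

theorem exists_cellType_polygon.{u} {X : Type u} [MetricSpace X] (hX : IsGeodesicSpace X)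
    {N K : ℕ} (hN : 0 < N) {y : ℕ → X} (hy : y N = y 0) {D : ℝ}
    (hD : D = ∑ j ∈ Finset.range N, dist (y j) (y (j + 1))) (hpos : 0 < D)
    (hdiv : divisibility X ⌈D⌉₊ ≤ K) :
    ∃ c : Σ k : Fin (K + 1), CellType k (2 * K + N) (3 * K + N) N,
      CellType.Realizable.{u} c.2 ∧ ∃ q, c.2.Fits K y D q := by
  obtain ⟨γ, hcor, hside, hlen⟩ := hX.exists_polygonal_loop hN hy
  rw [← hD] at hlen
  -- The length `D` lies in `(⌈D⌉₊ - 1, ⌈D⌉₊]`, so `γ` is one of the loops in the supremum at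
  -- `⌈D⌉₊`.
  have hP : partitionNumber γ (loopLength γ / 2) ≤ K := by
    refine le_trans ?_ hdiv
    refine le_iSup_of_le γ (le_iSup_of_le ?_ (le_iSup_of_le ?_ le_rfl))
    · rw [hlen, ← ENNReal.ofReal_natCast, ← ENNReal.ofReal_one,
        ← ENNReal.ofReal_add hpos.le zero_le_one]
      exact (ENNReal.ofReal_lt_ofReal_iff (by linarith)).2 (Nat.ceil_lt_add_one hpos.le)
    · rw [hlen, ← ENNReal.ofReal_natCast]
      exact ENNReal.ofReal_le_ofReal (Nat.le_ceil D)
  obtain ⟨k, hk, P, Q, hQ⟩ := exists_partition_of_partitionNumber_le hP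
  have hhalf : ENNReal.ofReal D / 2 = ENNReal.ofReal (D / 2) := by
    rw [ENNReal.ofReal_div_of_pos two_pos]; simp
  rw [hlen, hhalf] at hQ
  obtain ⟨c, hc, q, h1, h2, h3, h4⟩ := exists_cellType hX (R := 2 * K + N) (S := 3 * K + N) hN
    (by omega) (by omega) Q (δ := D / 2) (by positivity)
    fun i => (le_iSup Q.pieceLength i).trans hQ.le
  have h0 := hcor 0 N.zero_le
  rw [cornerAngle_zero, Circle.exp_zero] at h0
  refine ⟨⟨⟨k, Nat.lt_succ_iff.2 hk⟩, c⟩, hc, q, fun j => ?_, fun r => ?_, h3, fun j => ?_⟩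
  · rw [h1, hcor j j.2.le]
  · rw [← h0]
    refine (h2 r).trans ?_
    have : (k : ℝ) ≤ K := by exact_mod_cast hk
    nlinarith [mul_nonneg (sub_nonneg.2 this) hpos.le, mul_nonneg (Nat.cast_nonneg (α := ℝ) k) hpos.le]
  · have := h4 j
    rwa [hside j j.2, edist_dist, ENNReal.ofReal_le_ofReal_iff dist_nonneg] at this

end

noncomputable section

/-! ### Asymptotic cones are complete and geodesic -/

/-- A principal ultrafilter admits no divergent sequence. -/
theorem ScalingSequence.le_atTop {ω : Ultrafilter ℕ} (d : ScalingSequence ω) :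
    (ω : Filter ℕ) ≤ atTop := by
  rcases ω.le_cofinite_or_eq_pure with h | ⟨a, ha⟩
  · rwa [Nat.cofinite_eq_atTop] at h
  · have h := d.divergent.eventually (eventually_gt_atTop (d.seq a))
    have h' : {n | d.seq a < d.seq n} ∈ ω := h
    simp only [ha, Ultrafilter.mem_pure, mem_ofPred_eq, lt_irrefl] at h'

/-- `J n` is the largest `m ≤ n` with `p m n`. A fixed `i` is a candidate for almost every `n`,
which forces `i ≤ J n` there. -/
theorem exists_diagonal {ω : Ultrafilter ℕ} (hω : (ω : Filter ℕ) ≤ atTop) {p : ℕ → ℕ → Prop}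
    (h : ∀ m, ∀ᶠ n in (ω : Filter ℕ), p m n) :
    ∃ J : ℕ → ℕ, ∀ i, ∀ᶠ n in (ω : Filter ℕ), i ≤ J n ∧ p (J n) n := by
  classical
  refine ⟨fun n => Nat.findGreatest (fun m => p m n) n, fun i => ?_⟩
  filter_upwards [h i, hω (eventually_ge_atTop i)] with n hn hi
  exact ⟨Nat.le_findGreatest hi hn, Nat.findGreatest_spec (P := fun m => p m n) hi hn⟩

section Cone

variable {X : Type*} [MetricSpace X] {ω : Ultrafilter ℕ} {d : ScalingSequence ω} {e : ℕ → X}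

namespace PreCone

theorem dist_le_of_eventually {x y : PreCone X ω d e} {r : ℝ}
    (h : ∀ᶠ n in (ω : Filter ℕ), dist (x.seq n) (y.seq n) / d.seq n ≤ r) : dist x y ≤ r :=
  le_of_tendsto (tendsto_dist x y) h

theorem bounded_of_dist {z : ℕ → X} (x : PreCone X ω d e) {r : ℝ}
    (h : ∀ᶠ n in (ω : Filter ℕ), dist (z n) (x.seq n) / d.seq n ≤ r) :
    ∃ M : ℝ, ∀ᶠ n in (ω : Filter ℕ), dist (z n) (e n) / d.seq n < M := by
  obtain ⟨M, hM⟩ := x.bounded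
  refine ⟨r + M, ?_⟩
  filter_upwards [h, hM] with n h1 h2
  have h3 := div_le_div_of_nonneg_right (dist_triangle (z n) (x.seq n) (e n)) (d.pos n).le
  rw [add_div] at h3
  linarith

/-- For a rapidly Cauchy sequence `u`, the limit takes its `n`-th entry from `u (J n)`, where `J n`
grows slowly enough for the estimates among the first `J n` terms to hold already at `n`. -/
instance : CompleteSpace (PreCone X ω d e) := by
  refine Metric.complete_of_convergent_controlled_sequences (fun n => (1 / 2 : ℝ) ^ n)
    (fun n => by positivity) fun u hu => ?_
  have h : ∀ m, ∀ᶠ n in (ω : Filter ℕ), ∀ i ∈ Finset.range (m + 1),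
      dist ((u i).seq n) ((u m).seq n) / d.seq n < (1 / 2) ^ i := fun m =>
    (eventually_all_finset _).2 fun i hi =>
      (tendsto_dist (u i) (u m)).eventually_lt_const
        (hu i i m le_rfl (Nat.lt_succ_iff.1 (Finset.mem_range.1 hi)))
  obtain ⟨J, hJ⟩ := exists_diagonal d.le_atTop h
  have key : ∀ i, ∀ᶠ n in (ω : Filter ℕ),
      dist ((u (J n)).seq n) ((u i).seq n) / d.seq n ≤ (1 / 2) ^ i := fun i => by
    filter_upwards [hJ i] with n hn
    rw [dist_comm]
    exact (hn.2 i (Finset.mem_range.2 (Nat.lt_succ_iff.2 hn.1))).le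
  let x : PreCone X ω d e := ⟨fun n => (u (J n)).seq n, bounded_of_dist (u 0) (key 0)⟩
  refine ⟨x, tendsto_iff_dist_tendsto_zero.2 ?_⟩
  refine squeeze_zero (fun _ => dist_nonneg) (fun i => ?_)
    (tendsto_pow_atTop_nhds_zero_of_lt_one (by norm_num : (0 : ℝ) ≤ 1 / 2) (by norm_num))
  rw [dist_comm]
  exact dist_le_of_eventually (key i)

end PreCone

/-- Geodesics between representatives, parametrized proportionally to length on `[0, 1]`, have
exactly proportional distances at every `n`, and this identity passes to the limit. -/
theorem AsymptoticCone.isGeodesicSpace (hX : IsGeodesicSpace X) :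
    IsGeodesicSpace (AsymptoticCone X ω d e) := by
  intro x y
  obtain ⟨x, rfl⟩ := SeparationQuotient.surjective_mk x
  obtain ⟨y, rfl⟩ := SeparationQuotient.surjective_mk y
  choose γ h0 h1 h using fun n => hX.exists_segment (x.seq n) (y.seq n)
  let cl : ℝ → ℝ := fun s => projIcc 0 1 zero_le_one s
  have hcl : ∀ s, cl s ∈ Icc (0 : ℝ) 1 := fun s => (projIcc 0 1 zero_le_one s).2
  have hcl' : ∀ s ∈ Icc (0 : ℝ) 1, cl s = s := fun s hs =>
    congrArg Subtype.val (projIcc_of_mem zero_le_one hs)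
  have hb : ∀ s, ∃ M : ℝ, ∀ᶠ n in (ω : Filter ℕ), dist (γ n (cl s)) (e n) / d.seq n < M := by
    intro s
    refine PreCone.bounded_of_dist x (r := dist x y + 1) ?_
    filter_upwards [(PreCone.tendsto_dist x y).eventually_le_const (lt_add_one _)] with n hn
    refine le_trans (div_le_div_of_nonneg_right ?_ (d.pos n).le) hn
    rw [← h0 n, h n _ (hcl s) 0 (by simp), h0 n, sub_zero, abs_of_nonneg (hcl s).1]
    exact mul_le_of_le_one_left dist_nonneg (hcl s).2
  let c : ℝ → PreCone X ω d e := fun s => ⟨fun n => γ n (cl s), hb s⟩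
  have hc : ∀ s ∈ Icc (0 : ℝ) 1, ∀ t ∈ Icc (0 : ℝ) 1,
      dist (c s) (c t) = |s - t| * dist x y := by
    intro s hs t ht
    refine tendsto_nhds_unique (PreCone.tendsto_dist _ _) ?_
    refine ((PreCone.tendsto_dist x y).const_mul |s - t|).congr fun n => ?_
    simp only [c, hcl' s hs, hcl' t ht]
    rw [h n s hs t ht, mul_div_assoc]
  have hc0 : c 0 = x := by
    show PreCone.mk _ _ = PreCone.mk _ _
    congr 1
    funext n
    simp only [hcl' 0 (by simp), h0]
  have hc1 : c 1 = y := by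
    show PreCone.mk _ _ = PreCone.mk _ _
    congr 1
    funext n
    simp only [hcl' 1 (by simp), h1]
  simp only [SeparationQuotient.dist_mk]
  rcases (dist_nonneg (x := x) (y := y)).eq_or_lt with hD | hD
  · rw [← hD]
    refine ⟨fun _ => SeparationQuotient.mk x, rfl, ?_, fun s hs t ht => ?_⟩
    · exact SeparationQuotient.mk_eq_mk.2 (Metric.inseparable_iff.2 hD.symm)
    · rw [Icc_self, mem_singleton_iff] at hs ht
      simp [hs, ht]
  · have hm : ∀ s ∈ Icc 0 (dist x y), s / dist x y ∈ Icc (0 : ℝ) 1 := fun s hs =>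
      ⟨div_nonneg hs.1 hD.le, (div_le_one hD).2 hs.2⟩
    refine ⟨fun s => SeparationQuotient.mk (c (s / dist x y)), by simp only [zero_div, hc0], ?_,
      fun s hs t ht => ?_⟩
    · simp only [div_self hD.ne', hc1]
    · rw [SeparationQuotient.dist_mk, hc _ (hm s hs) _ (hm t ht), ← sub_div, abs_div,
        abs_of_pos hD, div_mul_cancel₀ _ hD.ne']

end Cone

/-! ### Rescaling -/

/-- Since `K` serves every `δ`, one may let `δ` tend to 0 with `n`. When `J n` tends to infinity
slowly, `ε d_n / (J n + 1)` still diverges, and `[a p_n, b p_n]` lies in `[ε d_n / (J n + 2)^2, ε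
d_n]` as soon as `J n` exceeds `b` and `1 / a`. -/
theorem UniformlyCoarselyLoopDivisible.exists_scaling {X : Type*} [MetricSpace X]
    {ω : Ultrafilter ℕ} {d : ScalingSequence ω} {ε : ℝ} (hε : 0 < ε)
    (h : UniformlyCoarselyLoopDivisible X ω d ε) :
    ∃ (K : ℕ) (p : ScalingSequence ω), ∀ a b : ℝ, 0 < a → ∀ᶠ n in (ω : Filter ℕ), ∀ m : ℕ,
      (m : ℝ) ∈ Icc (a * p.seq n) (b * p.seq n) → divisibility X m ≤ K := by
  obtain ⟨K, hK⟩ := h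
  obtain ⟨J, hJ⟩ := exists_diagonal d.le_atTop (p := fun m n =>
    (m : ℝ) ≤ ε * d.seq n / (m + 1) ∧ ∀ l : ℕ,
      (l : ℝ) ∈ Icc (ε / (m + 2) ^ 2 * d.seq n) (ε * d.seq n) → divisibility X l ≤ K)
    fun m => by
      -- The shift by 2 keeps `δ` strictly below `ε` even for `m = 0`.
      have hm : (1 : ℝ) < (m + 2) ^ 2 := one_lt_pow₀ (by linarith [Nat.cast_nonneg (α := ℝ) m])
        two_ne_zero
      obtain ⟨A, hA, hA'⟩ := hK (ε / (m + 2) ^ 2) (by positivity) (div_lt_self hε hm)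
      filter_upwards [hA, d.divergent.eventually_ge_atTop (m * (m + 1) / ε)] with n hn hd
      refine ⟨?_, hA' n hn⟩
      rw [div_le_iff₀ hε] at hd
      rw [le_div_iff₀ (by positivity)]
      linarith
  have htend : Tendsto (fun n => ε * d.seq n / (J n + 1)) (ω : Filter ℕ) atTop := by
    rw [Filter.tendsto_atTop]
    intro b
    obtain ⟨i, hi⟩ := exists_nat_ge b
    filter_upwards [hJ i] with n hn
    exact hi.trans ((Nat.cast_le.2 hn.1).trans hn.2.1)
  refine ⟨K, ⟨_, fun n => ?_, htend⟩, fun a b ha => ?_⟩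
  · have := d.pos n
    positivity
  · obtain ⟨i, hi⟩ := exists_nat_ge (max b (1 / a))
    filter_upwards [hJ i] with n hn m hm
    have hJn : (i : ℝ) ≤ J n := Nat.cast_le.2 hn.1
    have hd := d.pos n
    refine hn.2.2 m ⟨le_trans ?_ hm.1, hm.2.trans ?_⟩
    · have h1 : 1 / a ≤ J n := (le_max_right _ _).trans (hi.trans hJn)
      rw [div_le_iff₀ ha] at h1
      have h2 : ε / ((J n : ℝ) + 2) ^ 2 ≤ a * (ε / (J n + 1)) := by
        rw [div_le_iff₀ (by positivity), mul_div_assoc', div_mul_eq_mul_div,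
          le_div_iff₀ (by positivity)]
        have h3 : (J n : ℝ) + 1 ≤ a * (J n + 2) ^ 2 := by
          nlinarith [Nat.cast_nonneg (α := ℝ) (J n)]
        nlinarith
      calc _ ≤ a * (ε / (J n + 1)) * d.seq n := mul_le_mul_of_nonneg_right h2 hd.le
        _ = _ := by ring
    · have h1 : b ≤ J n := (le_max_left _ _).trans (hi.trans hJn)
      show b * (ε * d.seq n / (J n + 1)) ≤ ε * d.seq n
      rw [mul_div_assoc', div_le_iff₀ (by positivity)]
      have : 0 < ε * d.seq n := by positivity
      nlinarith

/-! ### Subdividing closed polygons in the cone -/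

/-- The partition of the disc into a single piece. -/
def DiscTiling.single : DiscTiling 1 where
  chart _ z := z
  continuousOn _ := continuousOn_id
  injOn _ := injOn_id _
  interior_disjoint i j h := absurd (Subsingleton.elim i j) h
  cover := by rw [iUnion_const, image_id']
  sphere_subset := by rw [iUnion_const, image_id']
  inter_eq i j h := absurd (Subsingleton.elim i j) h

/-- Every closed polygon in `Y` bounds a partition of the disc with at most `K` pieces, mapped to `Y`
on the skeleton, with pieces of at most half the length. -/
def PolygonDivisible (Y : Type*) [MetricSpace Y] (K : ℕ) : Prop :=
  ∀ N : ℕ, 0 < N → ∀ x : ℕ → Y, x N = x 0 → ∃ k ≤ K, ∃ (P : DiscTiling k) (f : ℂ → Y),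
    ContinuousOn f P.skeleton ∧ (∀ j < N, f (circlePt (cornerAngle N j)) = x j) ∧
    (∀ i, eVariationOn (f ∘ P.circ (some i)) (Icc 0 (2 * Real.pi)) ≤
      ENNReal.ofReal ((∑ j ∈ Finset.range N, dist (x j) (x (j + 1))) / 2)) ∧
    ∀ j < N, eVariationOn (f ∘ circlePt) (Icc (cornerAngle N j) (cornerAngle N (j + 1))) ≤
      edist (x j) (x (j + 1))

/-- Approximating polygons in `X` are divided according to finitely many types, so one type occurs
almost everywhere. Its vertex images stay at bounded rescaled distance and define points of the
cone; `Realizable` quantifies over all geodesic spaces so that it can be applied to the cone. The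
extra piece in `K + 1` leaves room for the one-piece partition of a degenerate polygon. -/
theorem AsymptoticCone.polygonDivisible.{u} {X : Type u} [MetricSpace X] (hX : IsGeodesicSpace X)
    {ω : Ultrafilter ℕ} {p : ScalingSequence ω} {e : ℕ → X} {K : ℕ}
    (hp : ∀ a b : ℝ, 0 < a → ∀ᶠ n in (ω : Filter ℕ), ∀ m : ℕ,
      (m : ℝ) ∈ Icc (a * p.seq n) (b * p.seq n) → divisibility X m ≤ K) :
    PolygonDivisible (AsymptoticCone X ω p e) (K + 1) := by
  intro N hN x hx
  set D := ∑ j ∈ Finset.range N, dist (x j) (x (j + 1)) with hDdef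
  have hD0 : 0 ≤ D := Finset.sum_nonneg fun _ _ => dist_nonneg
  rcases hD0.eq_or_lt with hD | hD
  · have hz : ∀ j < N, dist (x j) (x (j + 1)) = 0 := fun j hj =>
      (Finset.sum_eq_zero_iff_of_nonneg fun _ _ => dist_nonneg).1 hD.symm j
        (Finset.mem_range.2 hj)
    have hconst : ∀ j ≤ N, x j = x 0 := by
      intro j
      induction j with
      | zero => exact fun _ => rfl
      | succ j ih => exact fun hj => (dist_eq_zero.1 (hz j hj)).symm.trans (ih (by omega))
    have hvar : ∀ (f : ℝ → ℂ) s, eVariationOn ((fun _ : ℂ => x 0) ∘ f) s = 0 := fun f s =>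
      eVariationOn.constant_on (by
        rintro _ ⟨_, _, rfl⟩ _ ⟨_, _, rfl⟩; rfl)
    refine ⟨1, by omega, DiscTiling.single, fun _ => x 0, continuousOn_const,
      fun j hj => (hconst j hj.le).symm, fun i => ?_, fun j _ => ?_⟩
    · rw [hvar]; exact zero_le
    · rw [hvar]; exact zero_le
  · let ξ : ℕ → PreCone X ω p e := fun j => (x j).out
    have hξ : ∀ j, SeparationQuotient.mk (ξ j) = x j := fun j => Quotient.out_eq (x j)
    have hdist : ∀ i j, dist (x i) (x j) = dist (ξ i) (ξ j) := fun i j => by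
      rw [← hξ i, ← hξ j, SeparationQuotient.dist_mk]
    let Dn : ℕ → ℝ := fun n => ∑ j ∈ Finset.range N, dist ((ξ j).seq n) ((ξ (j + 1)).seq n)
    have hDn : Tendsto (fun n => Dn n / p.seq n) (ω : Filter ℕ) (𝓝 D) := by
      simp only [Dn, Finset.sum_div, hDdef]
      refine tendsto_finsetSum _ fun j _ => ?_
      rw [hdist]
      exact PreCone.tendsto_dist _ _
    have hmain : ∀ᶠ n in (ω : Filter ℕ), ∃ c : Σ k : Fin (K + 1),
        CellType k (2 * K + N) (3 * K + N) N, CellType.Realizable.{u} c.2 ∧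
        ∃ q, c.2.Fits K (fun j => (ξ j).seq n) (Dn n) q := by
      -- The rescaled length is eventually in `[D / 2, D + 1]`; rounding `Dn n` up adds at most `1 ≤
      -- p.seq n`, whence `D + 2`.
      filter_upwards [hp (D / 2) (D + 2) (by positivity),
        hDn.eventually_const_le (half_lt_self hD), hDn.eventually_le_const (lt_add_one D),
        p.divergent.eventually_ge_atTop 1] with n h1 h2 h3 h4
      have hpn := p.pos n
      rw [le_div_iff₀ hpn] at h2
      rw [div_le_iff₀ hpn] at h3
      have hDpos : 0 < Dn n := lt_of_lt_of_le (by positivity) h2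
      refine exists_cellType_polygon hX hN (y := fun j => (ξ j).seq n) ?_ rfl hDpos (h1 _ ⟨?_, ?_⟩)
      · show (ξ N).seq n = (ξ 0).seq n
        simp only [ξ, hx]
      · exact h2.trans (Nat.le_ceil _)
      · have := Nat.ceil_lt_add_one hDpos.le
        show ((⌈Dn n⌉₊ : ℕ) : ℝ) ≤ _
        nlinarith
    -- An ultrafilter commutes with the finite disjunction over all types.
    obtain ⟨⟨k, c⟩, hc⟩ := Ultrafilter.eventually_exists_iff.1 hmain
    obtain ⟨n₀, ⟨P, hP⟩, -⟩ := hc.exists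
    have hq : ∀ n, ∃ q : Fin (2 * K + N) → X, (∃ q, c.Fits K (fun j => (ξ j).seq n) (Dn n) q) →
        c.Fits K (fun j => (ξ j).seq n) (Dn n) q := fun n => by
      by_cases h : ∃ q, c.Fits K (fun j => (ξ j).seq n) (Dn n) q
      · exact ⟨h.choose, fun h => h.choose_spec⟩
      · exact ⟨fun _ => e n, fun h' => absurd h' h⟩
    choose q hq using hq
    have hq' := hc.mono fun n hn => hq n hn.2
    have hb : ∀ r, ∃ M : ℝ, ∀ᶠ n in (ω : Filter ℕ), dist (q n r) (e n) / p.seq n < M := by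
      intro r
      refine PreCone.bounded_of_dist (ξ 0) (r := K * (D + 1)) ?_
      filter_upwards [hq', hDn.eventually_le_const (lt_add_one D)] with n h1 h2
      refine (div_le_div_of_nonneg_right (h1.dist_le r) (p.pos n).le).trans ?_
      rw [mul_div_assoc]
      exact mul_le_mul_of_nonneg_left h2 (Nat.cast_nonneg K)
    let z : Fin (2 * K + N) → PreCone X ω p e := fun r => ⟨fun n => q n r, hb r⟩
    have hlen : ∀ T, Tendsto (fun n => c.length (q n) T / p.seq n) (ω : Filter ℕ)
        (𝓝 (c.length (fun r => (SeparationQuotient.mk (z r) : AsymptoticCone X ω p e)) T)) := by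
      intro T
      simp only [CellType.length, Finset.sum_div, SeparationQuotient.dist_mk]
      exact tendsto_finsetSum _ fun s _ => PreCone.tendsto_dist (z _) (z _)
    obtain ⟨f, hf, h1, h2, h3⟩ := hP (AsymptoticCone X ω p e)
      (AsymptoticCone.isGeodesicSpace hX) fun r => SeparationQuotient.mk (z r)
    refine ⟨k, by omega, P, f, hf, fun j hj => ?_, fun i => (h2 i).trans ?_, fun j hj => ?_⟩
    · rw [h1 ⟨j, hj⟩, ← hξ j]
      refine SeparationQuotient.mk_eq_mk.2 (Metric.inseparable_iff.2 ?_)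
      refine tendsto_nhds_unique (PreCone.tendsto_dist _ _) (tendsto_const_nhds.congr' ?_)
      filter_upwards [hq'] with n hn
      show 0 = dist (q n _) _ / _
      rw [hn.corner ⟨j, hj⟩, dist_self, zero_div]
    · refine ENNReal.ofReal_le_ofReal (le_of_tendsto_of_tendsto (hlen _) (hDn.div_const 2) ?_)
      filter_upwards [hq'] with n hn
      rw [div_right_comm]
      exact div_le_div_of_nonneg_right (hn.piece_le i) (p.pos n).le
    · refine (h3 ⟨j, hj⟩).trans ?_
      rw [edist_dist, hdist]
      refine ENNReal.ofReal_le_ofReal (le_of_tendsto_of_tendsto (hlen _)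
        (PreCone.tendsto_dist (ξ j) (ξ (j + 1))) ?_)
      filter_upwards [hq'] with n hn
      exact div_le_div_of_nonneg_right (hn.side_le ⟨j, hj⟩) (p.pos n).le

end

noncomputable section

/-! ### Filling by subdivision -/

/-- The division of a disc without holes. -/
def Division.full {C : Type*} [TopologicalSpace C] {F : ℂ → C}
    (hF : ContinuousOn F (closedBall 0 1)) : Division C 0 where
  chart i := i.elim0
  body := closedBall 0 1
  map := F
  continuousOn_chart i := i.elim0
  injOn_chart i := i.elim0
  isClosed_body := isClosed_closedBall
  sphere_subset := sphere_subset_closedBall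
  chart_sphere i := i.elim0
  disjoint_body i := i.elim0
  disjoint_ball i := i.elim0
  cover := by rw [iUnion_of_empty, union_empty]
  continuousOn_map := hF

/-- The rank drops by the factor `3 / 4` at each division, so after finitely many steps all regions
are small. Holes with a known filling are adjoined as extra states that divide into nothing. -/
theorem exists_filling_of_subdivision {C : Type*} [MetricSpace C] [CompleteSpace C] {σ : Type*}
    (loop : σ → ℂ → C) (region : σ → Set C) (rank : σ → ℝ)
    (hclosed : ∀ s, IsClosed (region s))
    (hsmall : ∀ δ > 0, ∃ η > 0, ∀ s, rank s ≤ η → ∀ x ∈ region s, ∀ y ∈ region s, dist x y ≤ δ)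
    (hsub : ∀ s, ∃ (k : ℕ) (D : Division C k), (∀ z ∈ sphere (0 : ℂ) 1, D.map z = loop s z) ∧
      (∀ x ∈ D.body, D.map x ∈ region s) ∧ ∀ i,
        (∃ t, rank t ≤ 3 / 4 * rank s ∧ region t ⊆ region s ∧
          ∀ z ∈ sphere (0 : ℂ) 1, loop t z = D.map (D.chart i z)) ∨
        ∃ F : ℂ → C, ContinuousOn F (closedBall 0 1) ∧
          (∀ z ∈ sphere (0 : ℂ) 1, F z = D.map (D.chart i z)) ∧
          MapsTo F (closedBall 0 1) (region s)) (s : σ) :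
    ∃ F : ℂ → C, ContinuousOn F (closedBall 0 1) ∧ (∀ z ∈ sphere (0 : ℂ) 1, F z = loop s z) ∧
      MapsTo F (closedBall 0 1) (region s) := by
  let τ := σ ⊕ {p : (ℂ → C) × Set C // ContinuousOn p.1 (closedBall 0 1) ∧ IsClosed p.2 ∧
    MapsTo p.1 (closedBall 0 1) p.2}
  let loop' : τ → ℂ → C := Sum.elim loop fun p => p.1.1
  let region' : τ → Set C := Sum.elim region fun p => p.1.2
  have key : ∀ s : τ, ∃ (k : ℕ) (D : Division C k) (child : Fin k → τ),
      (∀ z ∈ sphere (0 : ℂ) 1, D.map z = loop' s z) ∧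
      (∀ i, ∀ z ∈ sphere (0 : ℂ) 1, loop' (child i) z = D.map (D.chart i z)) ∧
      (∀ x ∈ D.body, D.map x ∈ region' s) ∧ (∀ i, region' (child i) ⊆ region' s) ∧
      ∀ i, ∃ t, s = Sum.inl t ∧ ((∃ u, child i = Sum.inl u ∧ rank u ≤ 3 / 4 * rank t) ∨
        ∃ p, child i = Sum.inr p) := by
    rintro (s | p)
    · obtain ⟨k, D, h1, h2, h3⟩ := hsub s
      have h4 : ∀ i, ∃ c : τ, (∀ z ∈ sphere (0 : ℂ) 1, loop' c z = D.map (D.chart i z)) ∧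
          region' c ⊆ region s ∧ ((∃ u, c = Sum.inl u ∧ rank u ≤ 3 / 4 * rank s) ∨
            ∃ p, c = Sum.inr p) := by
        intro i
        rcases h3 i with ⟨t, ht, ht1, ht2⟩ | ⟨F, hF, hF1, hF2⟩
        · exact ⟨Sum.inl t, ht2, ht1, Or.inl ⟨t, rfl, ht⟩⟩
        · exact ⟨Sum.inr ⟨(F, region s), hF, hclosed s, hF2⟩, hF1, Subset.rfl, Or.inr ⟨_, rfl⟩⟩
      choose c hc1 hc2 hc3 using h4
      exact ⟨k, D, c, h1, hc1, h2, hc2, fun i => ⟨s, rfl, hc3 i⟩⟩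
    · exact ⟨0, Division.full p.2.1, fun i => i.elim0, fun z _ => rfl, fun i => i.elim0,
        p.2.2.2, fun i => i.elim0, fun i => i.elim0⟩
  choose k D child h1 h2 h3 h4 h5 using key
  let Φ : FillSystem C τ :=
    { loop := loop'
      region := region'
      k := k
      div := D
      child := child
      map_eq := h1
      child_eq := h2
      isClosed_region := by
        rintro (s | p)
        exacts [hclosed s, p.2.2.1]
      map_mem := h3
      child_region := h4 }
  have hinr : ∀ δ p, Φ.Fine δ (Sum.inr p) := fun δ p =>
    FillSystem.Fine.step _ fun i => by
      obtain ⟨t, ht, -⟩ := h5 (Sum.inr p) i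
      exact absurd ht (by simp)
  refine Φ.exists_filling (fun δ hδ s => ?_) (Sum.inl s)
  obtain ⟨η, hη, hηs⟩ := hsmall δ hδ
  have hn : ∀ n : ℕ, ∀ s, rank s ≤ (4 / 3) ^ n * η → Φ.Fine δ (Sum.inl s) := by
    intro n
    induction n with
    | zero => exact fun s hs => FillSystem.Fine.small _ (hηs s (by simpa using hs))
    | succ n ih =>
      intro s hs
      refine FillSystem.Fine.step _ fun i => ?_
      show Φ.Fine δ (child _ i)
      obtain ⟨t, ht, ⟨u, hu, htu⟩ | ⟨q, hq⟩⟩ := h5 (Sum.inl s) i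
      · obtain rfl := Sum.inl_injective ht
        rw [hu]
        refine ih u ?_
        rw [pow_succ] at hs
        linarith
      · rw [hq]; exact hinr δ q
  rcases s with s | p
  · obtain ⟨n, hn'⟩ := ((tendsto_pow_atTop_atTop_of_one_lt
      (by norm_num : (1 : ℝ) < 4 / 3)).eventually_ge_atTop (rank s / η)).exists
    exact hn n s ((div_le_iff₀ hη).1 hn')
  · exact hinr δ p

end

noncomputable section

/-! ### The division of a tiled disc -/

/-- The division of the disc along the skeleton of a tiling. -/
def DiscTiling.division {k : ℕ} (P : DiscTiling k) {C : Type*} [TopologicalSpace C] {f : ℂ → C}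
    (hf : ContinuousOn f P.skeleton) : Division C k where
  chart := P.chart
  body := P.skeleton
  map := f
  continuousOn_chart := P.continuousOn
  injOn_chart := P.injOn
  isClosed_body := P.isCompact_skeleton.isClosed
  sphere_subset := P.sphere_subset
  chart_sphere i := subset_iUnion P.bdry i
  disjoint_body i := by
    rw [Set.disjoint_left]
    rintro _ ⟨z, hz, rfl⟩ hzS
    have := P.mem_sphere_of_chart_mem (ball_subset_closedBall hz) hzS
    rw [mem_sphere] at this
    rw [mem_ball] at hz
    exact hz.ne this
  disjoint_ball := P.interior_disjoint
  cover := by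
    rw [DiscTiling.skeleton, ← iUnion_union_distrib, ← P.cover]
    refine iUnion_congr fun i => ?_
    rw [DiscTiling.bdry, ← image_union, union_comm, ball_union_sphere]
  continuousOn_map := hf

theorem Division.continuousOn_hole {C : Type*} [TopologicalSpace C] {k : ℕ} (D : Division C k)
    (i : Fin k) : ContinuousOn (fun z => D.map (D.chart i z)) (sphere 0 1) :=
  D.continuousOn_map.comp ((D.continuousOn_chart i).mono sphere_subset_closedBall)
    fun z hz => D.chart_sphere i ⟨z, hz, rfl⟩

theorem eq_circlePt_of_pow_eq_one {N : ℕ} (hN : 0 < N) {z : ℂ} (hz : z ^ N = 1) :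
    ∃ j < N, z = circlePt (cornerAngle N j) := by
  have hn : ‖z‖ = 1 := by
    have := congrArg norm hz
    rw [norm_pow, norm_one] at this
    exact (pow_eq_one_iff_of_nonneg (norm_nonneg z) hN.ne').1 this
  obtain ⟨t, ht, rfl⟩ := exists_circlePt_eq 0 hn
  rw [Lens.circlePt_pow, ← circlePt_zero, circlePt_eq_iff, Circle.exp_eq_exp] at hz
  obtain ⟨m, hm⟩ := hz
  rw [zero_add] at ht hm
  have hN' : (0 : ℝ) < N := by positivity
  have hpi := Real.two_pi_pos
  have h1 : (-1 : ℝ) < m := by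
    by_contra hc
    nlinarith [mul_nonneg hN'.le ht.1]
  have h2 : (m : ℝ) < N := by
    by_contra hc
    nlinarith [mul_lt_mul_of_pos_left ht.2 hN']
  have h1' : (-1 : ℤ) < m := by exact_mod_cast h1
  obtain ⟨j, rfl⟩ := Int.eq_ofNat_of_zero_le (show 0 ≤ m by omega)
  refine ⟨j, by exact_mod_cast h2, congrArg circlePt ?_⟩
  rw [cornerAngle, eq_div_iff hN'.ne']
  push_cast at hm
  linarith

namespace Lens

variable {C : Type*} {N : ℕ} {α g : ℂ → C}

theorem angle_zero (N j : ℕ) : angle N j 0 = cornerAngle N j := by simp [angle, cornerAngle]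

theorem angle_pi (N j : ℕ) : angle N j Real.pi = cornerAngle N (j + 1) := by
  unfold angle cornerAngle; push_cast; ring

theorem monotone_angle (N j : ℕ) : Monotone (angle N j) := by
  intro s t h
  unfold angle
  gcongr

theorem mapsTo_angle (N j : ℕ) :
    MapsTo (angle N j) (Icc 0 Real.pi) (Icc (cornerAngle N j) (cornerAngle N (j + 1))) := by
  intro τ hτ
  rw [← angle_zero, ← angle_pi]
  exact ⟨monotone_angle N j hτ.1, monotone_angle N j hτ.2⟩

theorem glue_lens_upper (j : ℕ) {τ : ℝ} (hτ : τ ∈ Icc 0 Real.pi) :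
    glue α g (lens N j (circlePt τ)) = α (circlePt (angle N j τ)) := by
  rw [lens_circlePt hτ.1 hτ.2, glue_sphere _ _ (circlePt_mem_sphere _)]

theorem glue_lens_lower (hN : 0 < N) (h : ∀ z, z ^ N = 1 → α z = g z) (j : ℕ) {τ : ℝ}
    (hτ : τ ∈ Icc 0 Real.pi) :
    glue α g (lens N j (circlePt (-τ))) = g (circlePt (angle N j τ)) := by
  rw [lens_circlePt_neg hN hτ.1 hτ.2, glue_inner h (circlePt_mem_sphere _)]

variable [PseudoEMetricSpace C]

theorem eVariationOn_lens_lower (hN : 0 < N) (h : ∀ z, z ^ N = 1 → α z = g z) (j : ℕ) :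
    eVariationOn (fun t => glue α g (lens N j (circlePt t))) (Icc Real.pi (2 * Real.pi)) ≤
      eVariationOn (g ∘ circlePt) (Icc (cornerAngle N j) (cornerAngle N (j + 1))) := by
  have hm : MapsTo (fun t => 2 * Real.pi - t) (Icc Real.pi (2 * Real.pi)) (Icc 0 Real.pi) :=
    fun t ht => ⟨by linarith [ht.2], by linarith [ht.1]⟩
  have he : EqOn (fun t => glue α g (lens N j (circlePt t)))
      ((g ∘ circlePt) ∘ (fun t => angle N j (2 * Real.pi - t))) (Icc Real.pi (2 * Real.pi)) := by
    intro t ht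
    have := glue_lens_lower hN h j (hm ht)
    rw [← circlePt_add_two_pi, show -(2 * Real.pi - t) + 2 * Real.pi = t by ring] at this
    exact this
  rw [eVariationOn.congr he]
  refine eVariationOn.comp_le_of_antitoneOn _ _ (fun s _ t _ hst => ?_)
    fun t ht => mapsTo_angle N j (hm ht)
  exact monotone_angle N j (by linarith)

/-- The boundary of a lens runs along one arc of `α` and returns along the same arc of `g`. -/
theorem eVariationOn_lens_le (hN : 0 < N) (h : ∀ z, z ^ N = 1 → α z = g z) (j : ℕ) :
    eVariationOn (fun t => glue α g (lens N j (circlePt t))) (Icc 0 (2 * Real.pi)) ≤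
      eVariationOn (α ∘ circlePt) (Icc (cornerAngle N j) (cornerAngle N (j + 1))) +
      eVariationOn (g ∘ circlePt) (Icc (cornerAngle N j) (cornerAngle N (j + 1))) := by
  have hpi := Real.pi_pos
  have h1 := eVariationOn.Icc_add_Icc (fun t => glue α g (lens N j (circlePt t))) (s := univ)
    hpi.le (show Real.pi ≤ 2 * Real.pi by linarith) (mem_univ _)
  simp only [univ_inter] at h1
  rw [← h1]
  refine add_le_add ?_ (eVariationOn_lens_lower hN h j)
  have he : EqOn (fun t => glue α g (lens N j (circlePt t))) ((α ∘ circlePt) ∘ angle N j)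
      (Icc 0 Real.pi) := fun t ht => glue_lens_upper j ht
  rw [eVariationOn.congr he]
  exact eVariationOn.comp_le_of_monotoneOn _ _ ((monotone_angle N j).monotoneOn _)
    (mapsTo_angle N j)

end Lens

/-! ### Filling rectifiable loops -/

section Rectifiable

variable {C : Type*} [MetricSpace C]

/-- The corners are so dense that each arc of `α` has length at most `r / 4`. The corresponding side
of the polygon is no longer, so each lens has boundary at most `r / 2`; the polygon has length at
most `r`, so its pieces are at most `r / 2` as well. -/
theorem exists_tiling_of_rectifiable {K : ℕ} (hK : PolygonDivisible C K) {α : ℂ → C}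
    (hα : ContinuousOn α (sphere 0 1)) {r : ℝ} (hr : 0 < r)
    (hv : eVariationOn (α ∘ circlePt) (Icc 0 (2 * Real.pi)) ≤ ENNReal.ofReal r) :
    ∃ N, 2 ≤ N ∧ ∃ k ≤ K, ∃ (P : DiscTiling k) (f : ℂ → C), ContinuousOn f P.skeleton ∧
      (∀ z, z ^ N = 1 → α z = f z) ∧
      (∀ i, eVariationOn (f ∘ P.circ (some i)) (Icc 0 (2 * Real.pi)) ≤ ENNReal.ofReal (r / 2)) ∧
      ∀ j < N, eVariationOn (α ∘ circlePt) (Icc (cornerAngle N j) (cornerAngle N (j + 1))) +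
        eVariationOn (f ∘ circlePt) (Icc (cornerAngle N j) (cornerAngle N (j + 1))) ≤
        ENNReal.ofReal (r / 2) := by
  have hc : Continuous (α ∘ circlePt) := hα.comp_continuous continuous_circlePt circlePt_mem_sphere
  obtain ⟨N, hN, harc⟩ := exists_uniform_partition Real.two_pi_pos hc.continuousOn
    (ne_top_of_le_ne_top ENNReal.ofReal_ne_top hv) (ε := ENNReal.ofReal (r / 4))
    (ENNReal.ofReal_pos.2 (by positivity))
  simp only [zero_add, sub_zero] at harc
  change ∀ j < N, eVariationOn (α ∘ circlePt) (Icc (cornerAngle N j) (cornerAngle N (j + 1))) ≤ _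
    at harc
  have hN0 : 0 < N := by omega
  let x : ℕ → C := fun j => α (circlePt (cornerAngle N j))
  have hx : x N = x 0 := by
    have h := circlePt_add_two_pi 0
    rw [zero_add] at h
    simp only [x, cornerAngle_self hN0, cornerAngle_zero, h]
  have hedge : ∀ j, edist (x j) (x (j + 1)) ≤
      eVariationOn (α ∘ circlePt) (Icc (cornerAngle N j) (cornerAngle N (j + 1))) := fun j =>
    eVariationOn.edist_le (α ∘ circlePt) (left_mem_Icc.2 (cornerAngle_lt hN0 j).le)
      (right_mem_Icc.2 (cornerAngle_lt hN0 j).le)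
  have hD : ∑ j ∈ Finset.range N, dist (x j) (x (j + 1)) ≤ r := by
    rw [← ENNReal.ofReal_le_ofReal_iff hr.le, ENNReal.ofReal_sum_of_nonneg fun _ _ => dist_nonneg]
    have h := eVariationOn.sum' (α ∘ circlePt) (cornerAngle_strictMono hN0).monotone (n := N)
    rw [cornerAngle_zero, cornerAngle_self hN0] at h
    refine le_trans (Finset.sum_le_sum fun j _ => ?_) (h.trans_le hv)
    rw [← edist_dist]
    exact hedge j
  obtain ⟨k, hk, P, f, hf, h1, h2, h3⟩ := hK N hN0 x hx
  refine ⟨N, hN, k, hk, P, f, hf, fun z hz => ?_, fun i => (h2 i).trans ?_, fun j hj => ?_⟩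
  · obtain ⟨j, hj, rfl⟩ := eq_circlePt_of_pow_eq_one hN0 hz
    exact (h1 j hj).symm
  · exact ENNReal.ofReal_le_ofReal (by linarith)
  · refine (add_le_add (harc j hj) (((h3 j hj).trans (hedge j)).trans (harc j hj))).trans_eq ?_
    rw [← ENNReal.ofReal_add (by positivity) (by positivity)]
    congr 1
    ring

theorem dist_le_of_eVariationOn_circlePt {α : ℂ → C} {r : ℝ} (hr : 0 ≤ r)
    (hv : eVariationOn (α ∘ circlePt) (Icc 0 (2 * Real.pi)) ≤ ENNReal.ofReal r) {z w : ℂ}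
    (hz : z ∈ sphere (0 : ℂ) 1) (hw : w ∈ sphere (0 : ℂ) 1) : dist (α z) (α w) ≤ r := by
  obtain ⟨s, hs, rfl⟩ := exists_circlePt_eq 0 (z := z) (by simpa using hz)
  obtain ⟨t, ht, rfl⟩ := exists_circlePt_eq 0 (z := w) (by simpa using hw)
  rw [zero_add] at hs ht
  have := (eVariationOn.edist_le (α ∘ circlePt) (Ico_subset_Icc_self hs)
    (Ico_subset_Icc_self ht)).trans hv
  rwa [edist_dist, ENNReal.ofReal_le_ofReal_iff hr] at this

theorem one_mem_sphere : (1 : ℂ) ∈ sphere (0 : ℂ) 1 := by simp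

/-- The partition belongs to the inscribed polygon, and the lenses bridge the gap to `α`. The factor
`2 * K + 2` is large enough for the ball of a child, shifted by the distance of the base points, to
stay in the ball of its parent. -/
theorem exists_filling_of_pos [CompleteSpace C] {K : ℕ} (hK : PolygonDivisible C K)
    {α : ℂ → C} (hα : ContinuousOn α (sphere 0 1)) {r : ℝ} (hr : 0 < r)
    (hv : eVariationOn (α ∘ circlePt) (Icc 0 (2 * Real.pi)) ≤ ENNReal.ofReal r) :
    ∃ F : ℂ → C, ContinuousOn F (closedBall 0 1) ∧ (∀ z ∈ sphere (0 : ℂ) 1, F z = α z) ∧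
      MapsTo F (closedBall 0 1) (closedBall (α 1) ((2 * K + 2) * r)) := by
  -- Two kinds of loop: those of length at most the rank, and those bounding a tiled disc whose
  -- tiles have length at most `2 / 3` of the rank. The first kind at rank `r` leaves lenses of rank
  -- `r / 2` and an inner disc of the second kind at rank `3 / 4 * r`, where `2 / 3 * (3 / 4) = 1 /
  -- 2`; the second kind leaves tiles of the first kind at `2 / 3` of its rank.
  let σ := {s : (ℂ → C) × ℝ // 0 < s.2 ∧ ContinuousOn s.1 (sphere 0 1) ∧
    (eVariationOn (s.1 ∘ circlePt) (Icc 0 (2 * Real.pi)) ≤ ENNReal.ofReal s.2 ∨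
      ∃ k ≤ K, ∃ P : DiscTiling k, ContinuousOn s.1 P.skeleton ∧
        ∀ i, eVariationOn (s.1 ∘ P.circ (some i)) (Icc 0 (2 * Real.pi)) ≤
          ENNReal.ofReal (2 / 3 * s.2))}
  have hK0 : (0 : ℝ) ≤ K := Nat.cast_nonneg K
  refine exists_filling_of_subdivision (σ := σ) (fun s => s.1.1)
    (fun s => closedBall (s.1.1 1) ((2 * K + 2) * s.1.2)) (fun s => s.1.2)
    (fun s => isClosed_closedBall) (fun δ hδ => ⟨δ / (2 * (2 * K + 2)), by positivity, ?_⟩) ?_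
    ⟨(α, r), hr, hα, Or.inl hv⟩
  · intro s hs x hx y hy
    rw [le_div_iff₀ (by positivity)] at hs
    rw [mem_closedBall] at hx hy
    linarith [dist_triangle_right x y (s.1.1 1)]
  · rintro ⟨⟨α, r⟩, hr, hα, hv | ⟨k, hk, P, hP, hPv⟩⟩
    · dsimp only at hr hα hv ⊢
      obtain ⟨N, hN, k, hk, P, f, hf, h1, h2, h3⟩ := exists_tiling_of_rectifiable hK hα hr hv
      have hk' : (k : ℝ) ≤ K := Nat.cast_le.2 hk
      have hN0 : 0 < N := by omega
      have hfs : ContinuousOn f (sphere 0 1) := hf.mono P.sphere_subset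
      have hα1 : α 1 = f 1 := h1 1 (one_pow N)
      have hdiam : ∀ z ∈ P.skeleton, ∀ w ∈ P.skeleton, dist (f z) (f w) ≤ K * r := by
        intro z hz w hw
        refine (dist_le_of_eVariationOn_circ (by positivity) h2 z hz w hw).trans ?_
        nlinarith
      have hαr : ∀ z ∈ sphere (0 : ℂ) 1, dist (α z) (α 1) ≤ r := fun z hz =>
        dist_le_of_eVariationOn_circlePt hr.le hv hz one_mem_sphere
      refine ⟨N + 1, Lens.division hN hα hfs h1, fun z hz => Lens.glue_sphere _ _ hz, ?_,
        fun i => Or.inl ?_⟩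
      · rintro x (hx | ⟨z, hz, rfl⟩)
        · show Lens.glue α f x ∈ _
          rw [Lens.glue_sphere _ _ hx, mem_closedBall]
          nlinarith [hαr x hx]
        · show Lens.glue α f _ ∈ _
          rw [Lens.glue_inner h1 hz, mem_closedBall, hα1]
          nlinarith [hdiam z (P.sphere_subset hz) 1 (P.sphere_subset one_mem_sphere)]
      · refine Fin.cases ?_ (fun j => ?_) i
        · refine ⟨⟨(f, 3 / 4 * r), by positivity, hfs, Or.inr ⟨k, hk, P, hf, ?_⟩⟩, le_rfl, ?_, ?_⟩
          · intro i
            show _ ≤ ENNReal.ofReal (2 / 3 * (3 / 4 * r))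
            rw [show 2 / 3 * (3 / 4 * r) = r / 2 by ring]
            exact h2 i
          · dsimp only
            rw [hα1]
            exact closedBall_subset_closedBall (by nlinarith)
          · intro z hz
            exact (Lens.glue_inner h1 hz).symm
        · refine ⟨⟨(fun z => Lens.glue α f (Lens.lens N j z), r / 2), by positivity,
            (Lens.division hN hα hfs h1).continuousOn_hole j.succ, Or.inl ?_⟩, ?_, ?_, ?_⟩
          · exact (Lens.eVariationOn_lens_le hN0 h1 j).trans (h3 j j.2)
          · dsimp only; linarith
          · dsimp only
            refine closedBall_subset_closedBall' ?_
            have h4 := Lens.glue_lens_upper (α := α) (g := f) (N := N) j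
              (left_mem_Icc.2 Real.pi_pos.le)
            rw [circlePt_zero] at h4
            rw [h4]
            nlinarith [hαr _ (circlePt_mem_sphere (Lens.angle N j 0))]
          · exact fun z _ => rfl
    · dsimp only at hr hα hP hPv ⊢
      have hk' : (k : ℝ) ≤ K := Nat.cast_le.2 hk
      have hdiam : ∀ z ∈ P.skeleton, ∀ w ∈ P.skeleton, dist (α z) (α w) ≤ K * (2 / 3 * r) := by
        intro z hz w hw
        refine (dist_le_of_eVariationOn_circ (by positivity) hPv z hz w hw).trans ?_
        nlinarith
      have h1 := P.sphere_subset one_mem_sphere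
      refine ⟨k, P.division hP, fun z _ => rfl, fun x hx => ?_, fun i => Or.inl
        ⟨⟨(α ∘ P.chart i, 2 / 3 * r), by positivity, (P.division hP).continuousOn_hole i,
          Or.inl (hPv i)⟩, ?_, ?_, fun z _ => rfl⟩⟩
      · rw [mem_closedBall]
        refine (hdiam x hx 1 h1).trans ?_
        nlinarith
      · dsimp only; linarith
      · dsimp only
        refine closedBall_subset_closedBall' ?_
        have := hdiam (P.chart i 1) ((P.division hP).chart_sphere i ⟨1, one_mem_sphere, rfl⟩) 1 h1
        simp only [Function.comp_apply]
        nlinarith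

theorem exists_filling_of_rectifiable [CompleteSpace C] {K : ℕ} (hK : PolygonDivisible C K)
    {α : ℂ → C} (hα : ContinuousOn α (sphere 0 1)) {r : ℝ} (hr : 0 ≤ r)
    (hv : eVariationOn (α ∘ circlePt) (Icc 0 (2 * Real.pi)) ≤ ENNReal.ofReal r) :
    ∃ F : ℂ → C, ContinuousOn F (closedBall 0 1) ∧ (∀ z ∈ sphere (0 : ℂ) 1, F z = α z) ∧
      MapsTo F (closedBall 0 1) (closedBall (α 1) ((2 * K + 2) * r)) := by
  rcases hr.eq_or_lt with rfl | hr
  · refine ⟨fun _ => α 1, continuousOn_const, fun z hz => ?_, fun z _ => by simp⟩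
    exact (dist_le_zero.1 (dist_le_of_eVariationOn_circlePt le_rfl hv hz one_mem_sphere)).symm
  · exact exists_filling_of_pos hK hα hr hv

end Rectifiable

end

noncomputable section

/-! ### Filling arbitrary loops -/

section Curve

variable {C : Type*} [MetricSpace C]

/-- The loop `α` runs along `β` on `[a, b]` and returns from `β b` to `β a` along a curve of length
`dist (β a) (β b)`. -/
structure IsCap (β : ℝ → C) (α : ℂ → C) (a b : ℝ) : Prop where
  continuousOn : ContinuousOn α (sphere 0 1)
  lt : a < b
  upper : ∀ τ ∈ Icc 0 Real.pi, α (circlePt τ) = β (a + (b - a) * (τ / Real.pi))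
  lower : eVariationOn (α ∘ circlePt) (Icc Real.pi (2 * Real.pi)) ≤ edist (β a) (β b)

namespace IsCap

variable {β : ℝ → C} {α : ℂ → C} {a b : ℝ}

theorem upper_mem (h : IsCap β α a b) {τ : ℝ} (hτ : τ ∈ Icc 0 Real.pi) :
    α (circlePt τ) ∈ β '' Icc a b := by
  have hba := sub_pos.2 h.lt
  have h0 : 0 ≤ τ / Real.pi := div_nonneg hτ.1 Real.pi_pos.le
  have h1 : τ / Real.pi ≤ 1 := (div_le_one Real.pi_pos).2 hτ.2
  rw [h.upper τ hτ]
  exact ⟨_, ⟨by nlinarith, by nlinarith⟩, rfl⟩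

theorem apply_pi (h : IsCap β α a b) : α (circlePt Real.pi) = β b := by
  rw [h.upper _ (right_mem_Icc.2 Real.pi_pos.le), div_self Real.pi_pos.ne']
  congr 1; ring

theorem apply_zero (h : IsCap β α a b) : α (circlePt 0) = β a := by
  rw [h.upper _ (left_mem_Icc.2 Real.pi_pos.le)]
  congr 1; ring

theorem dist_image_le (hβ : Continuous β) {x y : C} (hx : x ∈ β '' Icc a b)
    (hy : y ∈ β '' Icc a b) : dist x y ≤ diam (β '' Icc a b) :=
  dist_le_diam_of_mem (isCompact_Icc.image hβ).isBounded hx hy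

theorem lower_le (hβ : Continuous β) (h : IsCap β α a b) :
    eVariationOn (α ∘ circlePt) (Icc Real.pi (2 * Real.pi)) ≤
      ENNReal.ofReal (diam (β '' Icc a b)) := by
  refine h.lower.trans ?_
  rw [edist_dist]
  exact ENNReal.ofReal_le_ofReal (dist_image_le hβ ⟨a, left_mem_Icc.2 h.lt.le, rfl⟩
    ⟨b, right_mem_Icc.2 h.lt.le, rfl⟩)

theorem dist_lower_le (hβ : Continuous β) (h : IsCap β α a b) {s t : ℝ}
    (hs : s ∈ Icc Real.pi (2 * Real.pi)) (ht : t ∈ Icc Real.pi (2 * Real.pi)) :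
    dist (α (circlePt s)) (α (circlePt t)) ≤ diam (β '' Icc a b) := by
  have := (eVariationOn.edist_le (α ∘ circlePt) hs ht).trans (h.lower_le hβ)
  rwa [edist_dist, ENNReal.ofReal_le_ofReal_iff diam_nonneg] at this

theorem mem_cthickening (hβ : Continuous β) (h : IsCap β α a b) {z : ℂ}
    (hz : z ∈ sphere (0 : ℂ) 1) :
    α z ∈ cthickening (diam (β '' Icc a b)) (β '' Icc a b) := by
  obtain ⟨t, ht, rfl⟩ := exists_circlePt_eq 0 (z := z) (by simpa using hz)
  rw [zero_add] at ht
  rcases le_total t Real.pi with h1 | h1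
  · exact self_subset_cthickening _ (h.upper_mem ⟨ht.1, h1⟩)
  · have hb : β b ∈ β '' Icc a b := ⟨b, right_mem_Icc.2 h.lt.le, rfl⟩
    refine closedBall_subset_cthickening hb _ ?_
    rw [mem_closedBall, ← h.apply_pi]
    exact h.dist_lower_le hβ ⟨h1, ht.2.le⟩ (left_mem_Icc.2 (by linarith [Real.pi_pos]))

end IsCap

theorem cornerAngle_four (j : ℕ) : cornerAngle 4 j = Real.pi / 2 * j := by
  unfold cornerAngle; push_cast; ring

/-- A geodesic quadrilateral is inscribed with corners `β a`, the value of `β` at the midpoint, `β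
b` and a point of the return curve; its sides are at most `e`, the diameter of the image of `[a,
b]`. The two upper lenses are caps over the half intervals. The two lower lenses and the
quadrilateral have lengths at most `2 * e` and `4 * e` and are filled at once; the latter accounts
for `4 * (2 * K + 2)` in `R`. -/
theorem IsCap.exists_division [CompleteSpace C] (hC : IsGeodesicSpace C) {K : ℕ}
    (hK : PolygonDivisible C K) {β : ℝ → C} (hβ : Continuous β) {α : ℂ → C} {a b : ℝ}
    (h : IsCap β α a b) {R : Set C}
    (hR : R = cthickening ((4 * (2 * K + 2) + 4) * diam (β '' Icc a b)) (β '' Icc a b)) :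
    ∃ (k : ℕ) (D : Division C k), (∀ z ∈ sphere (0 : ℂ) 1, D.map z = α z) ∧
      (∀ x ∈ D.body, D.map x ∈ R) ∧ ∀ i,
        (IsCap β (fun z => D.map (D.chart i z)) a ((a + b) / 2) ∨
          IsCap β (fun z => D.map (D.chart i z)) ((a + b) / 2) b) ∨
        ∃ F : ℂ → C, ContinuousOn F (closedBall 0 1) ∧
          (∀ z ∈ sphere (0 : ℂ) 1, F z = D.map (D.chart i z)) ∧ MapsTo F (closedBall 0 1) R := by
  have hpi := Real.pi_pos
  set S := β '' Icc a b with hS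
  set e := diam S with he
  have he0 : 0 ≤ e := diam_nonneg
  have hK0 : (0 : ℝ) ≤ K := Nat.cast_nonneg K
  set m := (a + b) / 2 with hm
  have hab := h.lt
  have hball : ∀ {x y : C} {r s : ℝ}, x ∈ S → dist y x ≤ s → r + s ≤ (4 * (2 * K + 2) + 4) * e →
      closedBall y r ⊆ R := by
    intro x y r s hx hy hrs
    rw [hR]
    refine Subset.trans ?_ (closedBall_subset_cthickening hx _)
    exact closedBall_subset_closedBall' (by linarith)
  let x : ℕ → C := fun j => α (circlePt (cornerAngle 4 j))
  have hx0 : x 0 = β a := by simp only [x, cornerAngle_zero, h.apply_zero]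
  have hx1 : x 1 = β m := by
    simp only [x, cornerAngle_four]
    rw [h.upper _ ⟨by positivity, by push_cast; linarith⟩]
    congr 1
    push_cast; field_simp; rw [hm]; ring
  have hx2 : x 2 = β b := by
    simp only [x, cornerAngle_four]
    rw [← h.apply_pi]
    congr 2
    push_cast; ring
  have h2pi : circlePt (2 * Real.pi) = circlePt 0 := by
    have := circlePt_add_two_pi 0
    rwa [zero_add] at this
  have hx4 : x 4 = x 0 := by
    have := cornerAngle_self (N := 4) (by norm_num)
    simp only [x, this, cornerAngle_zero, h2pi]
  have hlow : ∀ j, 2 ≤ j → j ≤ 4 → cornerAngle 4 j ∈ Icc Real.pi (2 * Real.pi) := by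
    intro j h1 h2
    have h1' : (2 : ℝ) ≤ j := by exact_mod_cast h1
    have h2' : (j : ℝ) ≤ 4 := by exact_mod_cast h2
    rw [cornerAngle_four]
    constructor <;> nlinarith
  have hma : β a ∈ S := ⟨a, left_mem_Icc.2 hab.le, rfl⟩
  have hmm : β m ∈ S := ⟨m, ⟨by rw [hm]; linarith, by rw [hm]; linarith⟩, rfl⟩
  have hmb : β b ∈ S := ⟨b, right_mem_Icc.2 hab.le, rfl⟩
  have hside : ∀ j < 4, dist (x j) (x (j + 1)) ≤ e := by
    intro j hj
    interval_cases j
    · rw [hx0, hx1]; exact IsCap.dist_image_le hβ hma hmm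
    · rw [hx1, hx2]; exact IsCap.dist_image_le hβ hmm hmb
    · exact h.dist_lower_le hβ (hlow 2 le_rfl (by norm_num)) (hlow 3 (by norm_num) (by norm_num))
    · exact h.dist_lower_le hβ (hlow 3 (by norm_num) (by norm_num)) (hlow 4 (by norm_num) le_rfl)
  obtain ⟨g, hg, hgx, hgv⟩ := hC.exists_polygonal_sphere (N := 4) (by norm_num) hx4
  have hgve : ∀ j < 4, eVariationOn (g ∘ circlePt) (Icc (cornerAngle 4 j) (cornerAngle 4 (j + 1))) ≤
      ENNReal.ofReal e := fun j hj => by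
    refine (hgv j hj).trans ?_
    rw [edist_dist]
    exact ENNReal.ofReal_le_ofReal (hside j hj)
  have hgtot : eVariationOn (g ∘ circlePt) (Icc 0 (2 * Real.pi)) ≤ ENNReal.ofReal (4 * e) := by
    have h1 := eVariationOn.sum' (g ∘ circlePt) (cornerAngle_strictMono (N := 4)
      (by norm_num)).monotone (n := 4)
    rw [cornerAngle_zero, cornerAngle_self (by norm_num)] at h1
    rw [← h1]
    refine (Finset.sum_le_sum fun j hj => hgve j (Finset.mem_range.1 hj)).trans_eq ?_
    rw [Finset.sum_const, Finset.card_range, nsmul_eq_mul,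
      ENNReal.ofReal_mul (by norm_num)]
    norm_num
  have hagree : ∀ z, z ^ 4 = 1 → α z = g z := by
    intro z hz
    obtain ⟨j, hj, rfl⟩ := eq_circlePt_of_pow_eq_one (by norm_num) hz
    exact (hgx j hj.le).symm
  have hg1 : g 1 = β a := by
    rw [← hagree 1 (one_pow 4), ← circlePt_zero, h.apply_zero]
  let D := Lens.division (N := 4) (by norm_num) h.continuousOn hg hagree
  have hrect : ∀ j : Fin 4, 2 ≤ (j : ℕ) → ∃ F : ℂ → C, ContinuousOn F (closedBall 0 1) ∧
      (∀ z ∈ sphere (0 : ℂ) 1, F z = D.map (D.chart j.succ z)) ∧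
      MapsTo F (closedBall 0 1) R := by
    intro j hj
    have hv : eVariationOn ((fun z => D.map (D.chart j.succ z)) ∘ circlePt)
        (Icc 0 (2 * Real.pi)) ≤ ENNReal.ofReal (2 * e) := by
      refine (Lens.eVariationOn_lens_le (by norm_num) hagree j).trans ?_
      rw [two_mul, ENNReal.ofReal_add he0 he0]
      refine add_le_add ((eVariationOn.mono _ (Icc_subset_Icc ?_ ?_)).trans (h.lower_le hβ))
        (hgve j j.2)
      · exact (hlow j hj j.2.le).1
      · exact (hlow (j + 1) (by omega) j.2).2
    obtain ⟨F, hF, hF1, hF2⟩ := exists_filling_of_rectifiable hK (D.continuousOn_hole j.succ)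
      (by positivity) hv
    refine ⟨F, hF, hF1, hF2.mono_right (hball hmb (s := e) ?_ (by nlinarith))⟩
    have h4 := Lens.glue_lens_upper (α := α) (g := g) (N := 4) j (left_mem_Icc.2 hpi.le)
    rw [circlePt_zero] at h4
    show dist (Lens.glue α g (Lens.lens 4 j 1)) (β b) ≤ e
    rw [h4, Lens.angle_zero, ← h.apply_pi]
    exact h.dist_lower_le hβ (hlow j hj j.2.le) (left_mem_Icc.2 (by linarith))
  refine ⟨5, D, fun z hz => Lens.glue_sphere _ _ hz, ?_, ?_⟩
  · rintro z (hz | ⟨w, hw, rfl⟩)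
    · show Lens.glue α g z ∈ R
      rw [Lens.glue_sphere _ _ hz, hR]
      exact cthickening_mono (by nlinarith) _ (h.mem_cthickening hβ hz)
    · show Lens.glue α g (Lens.inner 4 w) ∈ R
      rw [Lens.glue_inner hagree hw]
      refine hball (y := β a) (s := 0) (r := 4 * e) hma (dist_self _).le (by nlinarith) ?_
      rw [mem_closedBall, ← hg1]
      exact dist_le_of_eVariationOn_circlePt (by positivity) hgtot hw one_mem_sphere
  · refine fun i => Fin.cases (Or.inr ?_) (fun j => ?_) i
    · obtain ⟨F, hF, hF1, hF2⟩ := exists_filling_of_rectifiable hK hg (by positivity) hgtot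
      refine ⟨F, hF, fun z hz => (hF1 z hz).trans (Lens.glue_inner hagree hz).symm,
        hF2.mono_right (hball hma (s := 0) ?_ (by nlinarith))⟩
      rw [hg1, dist_self]
    · have hlower : ∀ j : Fin 4, eVariationOn ((fun z => D.map (D.chart j.succ z)) ∘ circlePt)
          (Icc Real.pi (2 * Real.pi)) ≤ edist (x j) (x (j + 1)) := fun j =>
        (Lens.eVariationOn_lens_lower (by norm_num) hagree j).trans (hgv j j.2)
      have hupper : ∀ j : Fin 4, (j : ℕ) ≤ 1 → ∀ τ ∈ Icc 0 Real.pi,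
          D.map (D.chart j.succ (circlePt τ)) =
            β (a + (b - a) * ((Real.pi / 2 * j + τ / 2) / Real.pi)) := by
        intro j hj τ hτ
        have hj' : ((j : ℕ) : ℝ) ≤ 1 := by exact_mod_cast hj
        refine (Lens.glue_lens_upper j hτ).trans ?_
        have : Lens.angle 4 j τ = Real.pi / 2 * j + τ / 2 := by
          unfold Lens.angle; push_cast; ring
        rw [this]
        refine h.upper _ ⟨by have := hτ.1; positivity, by nlinarith [hτ.2]⟩
      by_cases hj : 2 ≤ (j : ℕ)
      · exact Or.inr (hrect j hj)
      · refine Or.inl ?_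
        have hj2 : (j : ℕ) = 0 ∨ (j : ℕ) = 1 := by omega
        rcases hj2 with hj | hj
        · left
          refine ⟨D.continuousOn_hole j.succ, by rw [hm]; linarith, fun τ hτ => ?_, ?_⟩
          · rw [hupper j (by omega) τ hτ, hj, hm]
            congr 1
            push_cast; field_simp; ring
          · have := hlower j
            rwa [hj, hx0, hx1] at this
        · right
          refine ⟨D.continuousOn_hole j.succ, by rw [hm]; linarith, fun τ hτ => ?_, ?_⟩
          · rw [hupper j (by omega) τ hτ, hj, hm]
            congr 1
            push_cast; field_simp; ring
          · have := hlower j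
            rwa [hj, hx1, hx2] at this

/-- The rank is the length of the parameter interval. Regions are thickenings of the image of that
interval, in proportion to its diameter, so they nest, and they shrink by uniform continuity of `β`.
-/
theorem IsCap.exists_filling [CompleteSpace C] (hC : IsGeodesicSpace C) {K : ℕ}
    (hK : PolygonDivisible C K) {β : ℝ → C} (hβ : Continuous β) {α : ℂ → C}
    (h : IsCap β α 0 1) :
    ∃ F : ℂ → C, ContinuousOn F (closedBall 0 1) ∧ ∀ z ∈ sphere (0 : ℂ) 1, F z = α z := by
  let σ := {s : (ℂ → C) × ℝ × ℝ // IsCap β s.1 s.2.1 s.2.2 ∧ 0 ≤ s.2.1 ∧ s.2.2 ≤ 1}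
  have hcompact : ∀ a b, IsCompact (β '' Icc a b) := fun a b => isCompact_Icc.image hβ
  set M : ℝ := 4 * (2 * K + 2) + 4 with hM
  have hM0 : 0 ≤ M := by positivity
  let region : σ → Set C := fun s =>
    cthickening (M * diam (β '' Icc s.1.2.1 s.1.2.2)) (β '' Icc s.1.2.1 s.1.2.2)
  suffices hF : ∃ F : ℂ → C, ContinuousOn F (closedBall 0 1) ∧
      (∀ z ∈ sphere (0 : ℂ) 1, F z = α z) ∧
      MapsTo F (closedBall 0 1) (region ⟨(α, 0, 1), h, le_rfl, le_rfl⟩) by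
    obtain ⟨F, hF, hF1, -⟩ := hF
    exact ⟨F, hF, hF1⟩
  refine exists_filling_of_subdivision (σ := σ) (fun s => s.1.1) region
    (fun s => s.1.2.2 - s.1.2.1) (fun s => isClosed_cthickening) (fun δ hδ => ?_) (fun s => ?_)
    ⟨(α, 0, 1), h, le_rfl, le_rfl⟩
  · have hu := (isCompact_Icc (a := (0 : ℝ)) (b := 1)).uniformContinuousOn_of_continuous
      hβ.continuousOn
    rw [Metric.uniformContinuousOn_iff_le] at hu
    -- Two thickenings by `M` times the diameter, and the diameter itself.
    obtain ⟨η, hη, hη'⟩ := hu (δ / (2 * M + 1)) (by positivity)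
    refine ⟨η, hη, ?_⟩
    rintro ⟨⟨α, a, b⟩, hs, ha, hb⟩ hr x hx y hy
    dsimp only at hs ha hb hr
    have hd : diam (β '' Icc a b) ≤ δ / (2 * M + 1) := by
      refine diam_le_of_forall_dist_le (by positivity) ?_
      rintro _ ⟨s, hs, rfl⟩ _ ⟨t, ht, rfl⟩
      refine hη' s ⟨ha.trans hs.1, hs.2.trans hb⟩ t ⟨ha.trans ht.1, ht.2.trans hb⟩ ?_
      rw [Real.dist_eq, abs_le]
      constructor <;> linarith [hs.1, hs.2, ht.1, ht.2]
    simp only [region] at hx hy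
    rw [(hcompact a b).cthickening_eq_biUnion_closedBall (by positivity)] at hx hy
    obtain ⟨p, hp, hxp⟩ := mem_iUnion₂.1 hx
    obtain ⟨q, hq, hyq⟩ := mem_iUnion₂.1 hy
    rw [mem_closedBall] at hxp hyq
    have hpq := IsCap.dist_image_le hβ hp hq
    have h4 := dist_triangle4_right x y p q
    rw [le_div_iff₀ (by positivity)] at hd
    linarith
  · obtain ⟨⟨α, a, b⟩, hs, ha, hb⟩ := s
    dsimp only at hs ha hb
    have hab := hs.lt
    obtain ⟨k, D, h1, h2, h3⟩ := hs.exists_division hC hK hβ rfl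
    have hsub : ∀ {a' b'}, a ≤ a' → b' ≤ b →
        cthickening (M * diam (β '' Icc a' b')) (β '' Icc a' b') ⊆
          cthickening (M * diam (β '' Icc a b)) (β '' Icc a b) := by
      intro a' b' h1 h2
      have hi : β '' Icc a' b' ⊆ β '' Icc a b := image_mono (Icc_subset_Icc h1 h2)
      exact (cthickening_subset_of_subset _ hi).trans' (cthickening_mono
        (mul_le_mul_of_nonneg_left (diam_mono hi (hcompact a b).isBounded) hM0) _)
    refine ⟨k, D, h1, h2, fun i => (h3 i).imp ?_ id⟩
    rintro (h4 | h4)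
    · exact ⟨⟨(_, a, (a + b) / 2), h4, ha, by dsimp only; linarith⟩, by dsimp only; linarith,
        hsub le_rfl (by linarith), fun z _ => rfl⟩
    · exact ⟨⟨(_, (a + b) / 2, b), h4, by dsimp only; linarith, hb⟩, by dsimp only; linarith,
        hsub (by linarith) le_rfl, fun z _ => rfl⟩

end Curve

/-! ### Simple connectedness -/

theorem IsGeodesicSpace.pathConnectedSpace {C : Type*} [MetricSpace C] [Nonempty C]
    (hC : IsGeodesicSpace C) : PathConnectedSpace C where
  nonempty := inferInstance
  joined x y := by
    obtain ⟨γ, h0, h1, hγ, -⟩ := hC.exists_path zero_lt_one x y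
    exact ⟨⟨⟨fun t => γ t, hγ.comp_continuous continuous_subtype_val fun t => t.2⟩, h0, h1⟩⟩

/-- The point at height `t` of the vertical chord of the disc through `circlePt (π * s)`. -/
def chordPt (t s : ℝ) : ℂ := ⟨Real.cos (Real.pi * s), (1 - 2 * t) * Real.sin (Real.pi * s)⟩

theorem continuous_chordPt : Continuous fun p : ℝ × ℝ => chordPt p.1 p.2 := by
  have h : ∀ p : ℝ × ℝ, chordPt p.1 p.2 = (Real.cos (Real.pi * p.2) : ℂ) +
      ((1 - 2 * p.1) * Real.sin (Real.pi * p.2) : ℝ) * Complex.I := fun p => Complex.mk_eq_add_mul_I _ _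
  simp only [h]
  fun_prop

theorem chordPt_mem {t : ℝ} (ht : t ∈ Icc (0 : ℝ) 1) (s : ℝ) :
    chordPt t s ∈ closedBall (0 : ℂ) 1 := by
  rw [mem_closedBall_zero_iff, ← sq_le_one_iff₀ (norm_nonneg _), ← Complex.normSq_eq_norm_sq,
    Complex.normSq_apply]
  simp only [chordPt]
  nlinarith [Real.sin_sq_add_cos_sq (Real.pi * s),
    mul_nonneg (mul_nonneg ht.1 (sub_nonneg.2 ht.2)) (sq_nonneg (Real.sin (Real.pi * s)))]

theorem chordPt_zero (s : ℝ) : chordPt 0 s = circlePt (Real.pi * s) :=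
  Complex.ext (by rw [circlePt_re, chordPt]) (by rw [circlePt_im, chordPt]; ring)

theorem chordPt_one (s : ℝ) : chordPt 1 s = circlePt (2 * Real.pi - Real.pi * s) :=
  Complex.ext (by rw [circlePt_re, Real.cos_two_pi_sub, chordPt])
    (by rw [circlePt_im, Real.sin_two_pi_sub, chordPt]; ring)

theorem chordPt_eq {s : ℝ} (hs : Real.sin (Real.pi * s) = 0) (t : ℝ) : chordPt t s = chordPt 1 s := by
  simp only [chordPt, hs, mul_zero]

/-- The curves `chordPt t` sweep the disc from the upper to the lower half circle with both ends
fixed at `1` and `-1`. -/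
theorem Path.homotopic_refl_of_filling {C : Type*} [TopologicalSpace C] {x : C} (γ : Path x x)
    {F : ℂ → C} (hF : ContinuousOn F (closedBall 0 1))
    (h0 : ∀ s : unitInterval, F (circlePt (Real.pi * s)) = γ s)
    (h1 : ∀ s : unitInterval, F (circlePt (2 * Real.pi - Real.pi * s)) = x) :
    γ.Homotopic (Path.refl x) := by
  have hc : Continuous fun p : unitInterval × unitInterval => ((p.1 : ℝ), (p.2 : ℝ)) := by fun_prop
  let G : C(unitInterval × unitInterval, C) := ⟨fun p => F (chordPt p.1 p.2),
    hF.comp_continuous (continuous_chordPt.comp hc) fun p => chordPt_mem p.1.2 _⟩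
  have hG0 : ∀ s, G (0, s) = γ s := fun s => by
    rw [← h0, ← chordPt_zero]; rfl
  have hG1 : ∀ s, G (1, s) = x := fun s => by
    rw [← h1 s, ← chordPt_one]; rfl
  have hGe : ∀ t s, s ∈ ({0, 1} : Set unitInterval) → G (t, s) = γ s := by
    intro t s hs
    have hs' : γ s = x ∧ Real.sin (Real.pi * (s : ℝ)) = 0 := by
      rcases hs with rfl | rfl
      · exact ⟨γ.source, by simp⟩
      · exact ⟨γ.target, by simp⟩
    rw [hs'.1, ← h1 s, ← chordPt_one, ← chordPt_eq hs'.2 t]; rfl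
  exact ⟨⟨⟨G, hG0, hG1⟩, hGe⟩⟩

/-- A loop run along the upper half circle and held constant on the lower one is a cap over `[0,
1]`, because its end points coincide. -/
theorem IsGeodesicSpace.simplyConnectedSpace {C : Type*} [MetricSpace C] [CompleteSpace C]
    [Nonempty C] (hC : IsGeodesicSpace C) {K : ℕ} (hK : PolygonDivisible C K) :
    SimplyConnectedSpace C := by
  rw [simply_connected_iff_loops_nullhomotopic]
  refine ⟨hC.pathConnectedSpace, fun x γ => ?_⟩
  have hpi := Real.pi_pos
  have hβ : Continuous γ.extend := γ.continuous_extend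
  have hβ1 : ∀ t, 1 ≤ t → γ.extend t = x := fun t ht => γ.extend_of_one_le ht
  obtain ⟨α, hα, hαβ⟩ := exists_continuousOn_sphere (η := fun t => γ.extend (t / Real.pi))
    (hβ.comp (continuous_id.div_const _)).continuousOn (by
      rw [zero_div, γ.extend_zero, hβ1]
      rw [le_div_iff₀ hpi]; linarith)
  have hx : ∀ t ∈ Icc Real.pi (2 * Real.pi), α (circlePt t) = x := fun t ht => by
    rw [hαβ t ⟨by linarith [ht.1], ht.2⟩, hβ1]
    rw [le_div_iff₀ hpi]; linarith [ht.1]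
  have hcap : IsCap γ.extend α 0 1 := by
    refine ⟨hα, zero_lt_one, fun τ hτ => ?_, ?_⟩
    · rw [hαβ τ ⟨hτ.1, by linarith [hτ.2]⟩, sub_zero, one_mul, zero_add]
    · rw [eVariationOn.constant_on]
      · exact zero_le
      · rintro _ ⟨s, hs, rfl⟩ _ ⟨t, ht, rfl⟩
        exact (hx s hs).trans (hx t ht).symm
  obtain ⟨F, hF, hFα⟩ := hcap.exists_filling hC hK hβ
  refine γ.homotopic_refl_of_filling hF (fun s => ?_) fun s => ?_
  · rw [hFα _ (circlePt_mem_sphere _), hαβ _ ⟨mul_nonneg hpi.le s.2.1, by nlinarith [s.2.2]⟩,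
      mul_div_cancel_left₀ _ hpi.ne']
    exact γ.extend_apply s.2
  · rw [hFα _ (circlePt_mem_sphere _)]
    exact hx _ ⟨by nlinarith [s.2.2], by nlinarith [s.2.1]⟩

theorem mainTheorem5 (X : Type*) [MetricSpace X] [CompleteSpace X] [Nonempty X]
    (hX : IsGeodesicSpace X) (ω : Ultrafilter ℕ) (d : ScalingSequence ω) (ε : ℝ) (hε : 0 < ε)
    (hdiv : UniformlyCoarselyLoopDivisible X ω d ε) :
    ∃ (μ : Ultrafilter ℕ) (p : ScalingSequence μ) (e : ℕ → X),
      SimplyConnectedSpace (AsymptoticCone X μ p e) := by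
  obtain ⟨K, p, hp⟩ := hdiv.exists_scaling hε
  obtain ⟨x⟩ := ‹Nonempty X›
  -- Any observation sequence would do; the ultrafilter is kept and only the scale changes.
  let e : ℕ → X := fun _ => x
  have hb : ∃ M : ℝ, ∀ᶠ n in (ω : Filter ℕ), dist (e n) (e n) / p.seq n < M :=
    ⟨1, Eventually.of_forall fun n => by simp⟩
  have : Nonempty (AsymptoticCone X ω p e) := ⟨SeparationQuotient.mk ⟨e, hb⟩⟩
  exact ⟨ω, p, e, (AsymptoticCone.isGeodesicSpace hX).simplyConnectedSpace
    (AsymptoticCone.polygonDivisible hX hp)⟩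

end
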